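/- **Theorem 1.1.** Let $\alpha_1,\alpha_2\in(0,2]$ satisfy $\max\{\alpha_1,\alpha_2\}>1$ and let $T>0$. Let $X=\{X_t\}_{t\ge 0}$ and $\widetilde X=\{\widetilde X_t\}_{t\ge 0}$ be two independent real-valued symmetric stable processes with indices $\alpha_1$ and $\alpha_2$ on a filtered probability space $(\Omega,\mathcal F,(\mathcal F_t)_{t\ge0},P)$; that is, each is adapted, starts at $0$, has right-continuous paths with left limits, and for all $0\le s<t$ and $u\in\mathbb R$, $$\mathbb E\big[e^{i u(X_t-X_s)}\,\big|\,\mathcal F_s\big]=e^{-(t-s)|u|^{\alpha_1}},\qquad \mathbb E\big[e^{i u(\widetilde X_t-\widetilde X_s)}\,\big|\,\mathcal F_s\big]=e^{-(t-s)|u|^{\alpha_2}}.$$ For $\varepsilon>0$ put $$\widetilde L_\varepsilon(T)=\int_0^T p_\varepsilon(X_t-\widetilde X_t)\,dt,\qquad p_\varepsilon(x)=\frac1{\sqrt{2\pi\varepsilon}}\,e^{-|x|^2/(2\varepsilon)}.$$ Then $\widetilde L_\varepsilon(T)$ converges in $L^2$ as $\varepsilon\downarrow0$. Call the limit $\widetilde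 L(T)$ the collision local time of $X$ and $\widetilde X$ (a limit in $L^p$ for any $p\ge 1$ may be used instead). Moreover $$\lim_{\varepsilon\downarrow0}\varepsilon^{-1}P\big(\widetilde L(T)\le\varepsilon\big)= \begin{cases} \displaystyle \frac2T\int_0^{\infty}\frac{\operatorname{Im}\big\{e^{i r/\sqrt2}\,\Phi(re^{-3\pi i/4})\big\}}{|\Phi(re^{3\pi i/4})|^2}\cdot\frac{e^{-r/\sqrt2}}{r}\,dr+\frac{3\pi}{2\int_{\mathbb R}\frac{dv}{|v|^{\alpha_1}+|v|^{\alpha_2}}}, & \min\{\alpha_1,\alpha_2\}<1,\\[3ex] \displaystyle \frac2T\int_0^{\infty}\frac{\operatorname{Im}\big\{e^{i r/\sqrt2}\,\Phi(re^{-3\pi i/4})\big\}}{|\Phi(re^{3\pi i/4})|^2}\cdot\frac{e^{-r/\sqrt2}}{r}\,dr, & \min\{\alpha_1,\alpha_2\}\ge1, \end{cases}$$ where $$\Phi(z)=\int_{\mathbb R}\frac{dv}{z+T|v|^{\alpha_1}+T|v|^{\alpha_2}},\qquad z\in\mathbb C\setminus(-\infty,0].$$ The integral defining $\Phi(z)$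 converges absolutely for each such $z$, the integral over $r$ converges absolutely, and $\int_{\mathbb R}\frac{dv}{|v|^{\alpha_1}+|v|^{\alpha_2}}<\infty$ when $\min\{\alpha_1,\alpha_2\}<1$. -/

import Mathlib

open MeasureTheory ProbabilityTheory Filter Topology
open scoped NNReal ENNReal

noncomputable section

/-- Right-continuous on `[0, ∞)` with finite left limits. -/
def IsCadlagPath (x : ℝ≥0 → ℝ) : Prop :=
  ∀ t : ℝ≥0, ContinuousWithinAt x (Set.Ici t) t ∧ ∃ l : ℝ, Tendsto x (𝓝[<] t) (𝓝 l)

/-- `X` is a symmetric `α`-stable process with respect to the filtration `F`: adapted, with càdlàg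
paths, `X 0 = 0`, and `E[exp(i u (X_t - X_s)) | F_s] = exp(-(t - s) |u| ^ α)` for `s < t`. -/
structure IsSymmetricStable {Ω : Type*} {mΩ : MeasurableSpace Ω} (P : Measure Ω)
    (F : Filtration ℝ≥0 mΩ) (α : ℝ) (X : ℝ≥0 → Ω → ℝ) : Prop where
  adapted : StronglyAdapted F X
  cadlag : ∀ ω, IsCadlagPath (fun t => X t ω)
  zero : ∀ᵐ ω ∂P, X 0 ω = 0
  condExp_increment : ∀ s t : ℝ≥0, s < t → ∀ u : ℝ,
    P[fun ω => Complex.exp (Complex.I * (u : ℂ) * ((X t ω - X s ω : ℝ) : ℂ)) | F s]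
      =ᵐ[P] fun _ => ((Real.exp (-((t : ℝ) - (s : ℝ)) * |u| ^ α) : ℝ) : ℂ)

/-- The heat kernel `p_ε(x)` on the real line. -/
def heatKernel (ε x : ℝ) : ℝ :=
  1 / Real.sqrt (2 * Real.pi * ε) * Real.exp (-|x| ^ 2 / (2 * ε))

/-- The approximating collision local time `∫_0^T p_ε(X_t - Y_t) dt`. -/
def approxCollisionLocalTime {Ω : Type*} (X Y : ℝ≥0 → Ω → ℝ) (T ε : ℝ) (ω : Ω) : ℝ :=
  ∫ t in (0 : ℝ)..T, heatKernel ε (X t.toNNReal ω - Y t.toNNReal ω)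

/-- `L` is the collision local time of `X` and `Y` up to time `T`, in the sense of `L^p`:
the approximating collision local times converge to `L` in `L^p` as `ε ↓ 0`. -/
def IsCollisionLocalTime {Ω : Type*} {mΩ : MeasurableSpace Ω} (P : Measure Ω)
    (X Y : ℝ≥0 → Ω → ℝ) (T : ℝ) (p : ℝ≥0∞) (L : Ω → ℝ) : Prop :=
  (∀ ε : ℝ, 0 < ε → MemLp (approxCollisionLocalTime X Y T ε) p P) ∧ MemLp L p P ∧
    Tendsto (fun ε : ℝ => eLpNorm (fun ω => approxCollisionLocalTime X Y T ε ω - L ω) p P)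
      (𝓝[>] 0) (𝓝 0)

/-- The integrand `1 / (z + T |v| ^ α₁ + T |v| ^ α₂)` of `Φ`. -/
def PhiIntegrand (T α₁ α₂ : ℝ) (z : ℂ) (v : ℝ) : ℂ :=
  1 / (z + ((T * |v| ^ α₁ : ℝ) : ℂ) + ((T * |v| ^ α₂ : ℝ) : ℂ))

/-- `Φ(z) = ∫_ℝ dv / (z + T |v| ^ α₁ + T |v| ^ α₂)`. -/
def Phi (T α₁ α₂ : ℝ) (z : ℂ) : ℂ := ∫ v : ℝ, PhiIntegrand T α₁ α₂ z v

/-- `Im{e^{i r/√2} Φ(r e^{-3πi/4})} / |Φ(r e^{3πi/4})|² · e^{-r/√2} / r`. -/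
def rayIntegrand (T α₁ α₂ r : ℝ) : ℝ :=
  (Complex.exp (Complex.I * ((r / Real.sqrt 2 : ℝ) : ℂ)) *
      Phi T α₁ α₂ ((r : ℂ) * Complex.exp (-(Complex.I * ((3 * Real.pi / 4 : ℝ) : ℂ))))).im /
    ‖Phi T α₁ α₂ ((r : ℂ) * Complex.exp (Complex.I * ((3 * Real.pi / 4 : ℝ) : ℂ)))‖ ^ 2 *
    (Real.exp (-(r / Real.sqrt 2)) / r)

/-- The limiting constant. -/
def smallBallConstant (T α₁ α₂ : ℝ) : ℝ :=
  if min α₁ α₂ < 1 then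
    2 / T * (∫ r in Set.Ioi (0 : ℝ), rayIntegrand T α₁ α₂ r) +
      3 * Real.pi / (2 * ∫ v : ℝ, 1 / (|v| ^ α₁ + |v| ^ α₂))
  else
    2 / T * ∫ r in Set.Ioi (0 : ℝ), rayIntegrand T α₁ α₂ r

end

/-! The difference `Z = X - Y` is a symmetric Lévy process with exponent `ψ(v) = |v|^α₁ + |v|^α₂`,
and the collision local time is the local time `L(T)` of `Z` at zero. Heuristically `{L(T) ≤ ε}`
says that the inverse local time, a subordinator, has reached `T` by time `ε`. For small `ε` this is
due to a single jump longer than `T`, so its probability is asymptotic to `ε κ(T)`, where `κ` is the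
tail of the Lévy measure. The potential density of `Z` at zero is `G(z) / 2π` with `G(z) = ∫ dv / (z
+ ψ(v))`, hence the Laplace transform of `κ` is `2π / (z G(z))`. The proof keeps the function `κ`
but does not construct the subordinator.

Probabilistic side. The mollified local times converge in `L²` because their mixed second moments
have one common limit (`IsLevyProcess.tendsto_integral_mul`). Splitting the exponential of the
additive functional at the running time and applying the Markov property gives, for `h_θ(t) = E
exp(-θ L(t))` and the return density `q`, the renewal equation `h_θ = 1 - θ (q * h_θ)`
(`IsLevyProcess.exists_laplace`).

Analytic side. `κ` is defined as a Hankel integral of `exp(tz) / (z G(z))`. Inserting the truncated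
convolution of `q` with `exp(sz)` under the contour integral gives `q * κ = 1`
(`IsSymbol.integral_returnDensity_mul_levyTail`). Convolving the renewal equation with `κ` then
yields `θ ∫₀ᵗ h_θ = ∫₀ᵗ κ(s) (1 - h_θ(t - s)) ds`, whose right side tends to `∫₀ᵗ κ` as `θ → ∞`.
Since `h_θ` is decreasing and `κ` is continuous, this can be differentiated: `θ h_θ(T) → κ(T)`
(`IsSymbol.tendsto_mul_of_renewal`). Karamata's argument converts this into `ε⁻¹ P(L(T) ≤ ε) → κ(T)`
(`tendsto_smallBall_of_laplace`).

The explicit constant comes from shrinking the circular arc of the contour to the origin. The two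
rays at angles `±3π/4` give the integral over `r`. The arc contributes `(3π/2) / G(0+)`, which is
nonzero exactly when `1/ψ` is integrable at zero, that is, when the smaller index is below one
(`levyTail_stableSymbol`). -/

/-! ### Resolvents of a symbol on the slit plane. -/

/-- The properties of a characteristic exponent that the analysis uses. -/
structure IsSymbol (ψ : ℝ → ℝ) : Prop where
  continuous : Continuous ψ
  nonneg : ∀ v, 0 ≤ ψ v
  integrable : Integrable (fun v => 1 / (1 + ψ v))
  growth : ∀ v, ψ v ≤ 2 * (1 + v ^ 2)

/-- `∫ ρ(v) / (z + ψ(v)) dv`. -/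
noncomputable def weightedResolvent (ψ ρ : ℝ → ℝ) (z : ℂ) : ℂ := ∫ v, (ρ v : ℂ) / (z + ψ v)

/-- `∫ 1 / (r + ψ(v)) dv` for real `r`. -/
noncomputable def realResolvent (ψ : ℝ → ℝ) (r : ℝ) : ℝ := ∫ v, 1 / (r + ψ v)

theorem cos_half_arg_pos {z : ℂ} (hz : z ∈ Complex.slitPlane) : 0 < Real.cos (z.arg / 2) := by
  have h1 := Complex.neg_pi_lt_arg z
  have h2 : z.arg < Real.pi :=
    lt_of_le_of_ne (Complex.arg_le_pi z) (Complex.mem_slitPlane_iff_arg.mp hz).1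
  apply Real.cos_pos_of_mem_Ioo
  constructor <;> linarith

/-- After rotation by `-arg z / 2` the two summands make the angles `± arg z / 2` with the positive
axis, so their real parts add up without cancellation. Every domination of a complex resolvent by a
real one rests on this bound. -/
theorem cos_half_arg_mul_le (z : ℂ) (s : ℝ) :
    Real.cos (z.arg / 2) * (‖z‖ + s) ≤ ‖z + s‖ := by
  have h : (Complex.exp (((-(z.arg / 2) : ℝ) : ℂ) * Complex.I) * (z + s)).re
      = Real.cos (z.arg / 2) * (‖z‖ + s) := by
    have hz : z + s = ‖z‖ * Complex.exp (z.arg * Complex.I) + s := by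
      rw [Complex.norm_mul_exp_arg_mul_I]
    rw [hz, mul_add, mul_left_comm, ← Complex.exp_add, ← add_mul, ← Complex.ofReal_add]
    rw [Complex.add_re, Complex.re_ofReal_mul, mul_comm _ (s : ℂ), Complex.re_ofReal_mul,
      Complex.exp_ofReal_mul_I_re, Complex.exp_ofReal_mul_I_re, Real.cos_neg]
    rw [show -(z.arg / 2) + z.arg = z.arg / 2 by ring]
    ring
  rw [← h]
  refine (Complex.re_le_norm _).trans ?_
  rw [norm_mul, Complex.norm_exp_ofReal_mul_I, one_mul]

namespace IsSymbol

variable {ψ : ℝ → ℝ}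

theorem inv_le (hψ : IsSymbol ψ) {r : ℝ} (hr : 0 < r) (v : ℝ) :
    1 / (r + ψ v) ≤ max 1 (1 / r) * (1 / (1 + ψ v)) := by
  have h0 := hψ.nonneg v
  rw [mul_one_div, div_le_div_iff₀ (by linarith) (by linarith)]
  have h1 : 1 ≤ max 1 (1 / r) * r := by
    calc 1 = 1 / r * r := by field_simp
      _ ≤ _ := by gcongr; exact le_max_right _ _
  have h2 : ψ v ≤ max 1 (1 / r) * ψ v := le_mul_of_one_le_left h0 (le_max_left _ _)
  linarith

theorem integrable_inv (hψ : IsSymbol ψ) {r : ℝ} (hr : 0 < r) :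
    Integrable (fun v => 1 / (r + ψ v)) := by
  refine (hψ.integrable.const_mul (max 1 (1 / r))).mono' ?_ (Eventually.of_forall fun v => ?_)
  · have := hψ.continuous
    have h : ∀ v, r + ψ v ≠ 0 := fun v => by have := hψ.nonneg v; positivity
    exact (continuous_const.div (by fun_prop) h).aestronglyMeasurable
  · have := hψ.nonneg v
    rw [Real.norm_of_nonneg (by positivity)]
    exact hψ.inv_le hr v

theorem add_ne_zero (hψ : IsSymbol ψ) {z : ℂ} (hz : z ∈ Complex.slitPlane) (v : ℝ) :
    z + ψ v ≠ 0 := by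
  have h := cos_half_arg_mul_le z (ψ v)
  have h1 : 0 < Real.cos (z.arg / 2) * (‖z‖ + ψ v) := by
    have := norm_pos_iff.mpr (Complex.slitPlane_ne_zero hz)
    have := hψ.nonneg v
    have := cos_half_arg_pos hz
    positivity
  exact norm_pos_iff.mp (h1.trans_le h)

theorem norm_weighted_le (hψ : IsSymbol ψ) {ρ : ℝ → ℝ} (hρ1 : ∀ v, |ρ v| ≤ 1)
    {z : ℂ} (hz : z ∈ Complex.slitPlane) (v : ℝ) :
    ‖(ρ v : ℂ) / (z + ψ v)‖ ≤ (Real.cos (z.arg / 2))⁻¹ * (1 / (‖z‖ + ψ v)) := by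
  have h0 := hψ.nonneg v
  have h1 := norm_pos_iff.mpr (Complex.slitPlane_ne_zero hz)
  have h2 := cos_half_arg_pos hz
  rw [norm_div, Complex.norm_real, ← one_div, one_div_mul_one_div]
  gcongr
  · exact hρ1 v
  · exact cos_half_arg_mul_le z (ψ v)

theorem integrable_weighted (hψ : IsSymbol ψ) {ρ : ℝ → ℝ} (hρ : Continuous ρ)
    (hρ1 : ∀ v, |ρ v| ≤ 1) {z : ℂ} (hz : z ∈ Complex.slitPlane) :
    Integrable (fun v => (ρ v : ℂ) / (z + ψ v)) := by
  refine ((hψ.integrable_inv (norm_pos_iff.mpr (Complex.slitPlane_ne_zero hz))).const_mul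
    (Real.cos (z.arg / 2))⁻¹).mono' ?_ (Eventually.of_forall (hψ.norm_weighted_le hρ1 hz))
  have := hψ.continuous
  exact (Continuous.div (by fun_prop) (by fun_prop) (hψ.add_ne_zero hz)).aestronglyMeasurable

theorem hasDerivAt_weightedResolvent (hψ : IsSymbol ψ) {ρ : ℝ → ℝ} (hρ : Continuous ρ)
    (hρ1 : ∀ v, |ρ v| ≤ 1) {z : ℂ} (hz : z ∈ Complex.slitPlane) :
    HasDerivAt (weightedResolvent ψ ρ) (∫ v, -(ρ v : ℂ) / (z + ψ v) ^ 2) z := by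
  have hz0 := norm_pos_iff.mpr (Complex.slitPlane_ne_zero hz)
  have hc := cos_half_arg_pos hz
  set c := Real.cos (z.arg / 2) with hcdef
  have hcont := hψ.continuous
  have hε : 0 < c * ‖z‖ / 2 := by positivity
  obtain ⟨ε', hε', hball⟩ := Metric.isOpen_iff.mp Complex.isOpen_slitPlane z hz
  set ε := min ε' (c * ‖z‖ / 2) with hεdef
  have hεpos : 0 < ε := lt_min hε' hε
  -- The radius is at most half of `c ‖z‖`, so a perturbation inside the ball costs at most half of
  -- the lower bound at `z`.
  have hlow : ∀ y ∈ Metric.ball z ε, ∀ v, c / 2 * (‖z‖ + ψ v) ≤ ‖y + ψ v‖ := by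
    intro y hy v
    have h1 := cos_half_arg_mul_le z (ψ v)
    have h2 : ‖z + ψ v‖ ≤ ‖y + ψ v‖ + ‖y - z‖ := by
      have : z + ψ v = (y + ψ v) - (y - z) := by ring
      rw [this]; exact norm_sub_le _ _
    have h3 : ‖y - z‖ < c * ‖z‖ / 2 := by
      rw [← dist_eq_norm]; exact lt_of_lt_of_le hy (min_le_right _ _)
    have h4 : 0 ≤ c * ψ v := mul_nonneg hc.le (hψ.nonneg v)
    rw [← hcdef] at h1
    nlinarith
  have hsl : ∀ y ∈ Metric.ball z ε, y ∈ Complex.slitPlane := fun y hy =>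
    hball (Metric.ball_subset_ball (min_le_left _ _) hy)
  refine (hasDerivAt_integral_of_dominated_loc_of_deriv_le
    (F := fun (z : ℂ) (v : ℝ) => (ρ v : ℂ) / (z + ψ v))
    (F' := fun (z : ℂ) (v : ℝ) => -(ρ v : ℂ) / (z + ψ v) ^ 2)
    (bound := fun v => ((c / 2) ^ 2 * ‖z‖)⁻¹ * (1 / (‖z‖ + ψ v)))
    (Metric.ball_mem_nhds z hεpos) ?_ ?_ ?_ ?_ ?_ ?_).2
  · filter_upwards [Metric.ball_mem_nhds z hεpos] with y hy
    exact (Continuous.div (by fun_prop) (by fun_prop)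
      (hψ.add_ne_zero (hsl y hy))).aestronglyMeasurable
  · exact hψ.integrable_weighted hρ hρ1 hz
  · exact (Continuous.div (by fun_prop) (by fun_prop)
      (fun v => pow_ne_zero 2 (hψ.add_ne_zero hz v))).aestronglyMeasurable
  · refine Eventually.of_forall fun v y hy => ?_
    have h0 := hψ.nonneg v
    rw [norm_div, norm_neg, Complex.norm_real, norm_pow, ← one_div, one_div_mul_one_div]
    gcongr
    · exact hρ1 v
    · calc (c / 2) ^ 2 * ‖z‖ * (‖z‖ + ψ v) ≤ (c / 2) ^ 2 * (‖z‖ + ψ v) * (‖z‖ + ψ v) := by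
            gcongr; linarith
        _ = (c / 2 * (‖z‖ + ψ v)) ^ 2 := by ring
        _ ≤ _ := by
          have := hlow y hy v
          gcongr
  · exact (hψ.integrable_inv hz0).const_mul _
  · refine Eventually.of_forall fun v y hy => ?_
    have h := ((hasDerivAt_id y).add_const (ψ v : ℂ)).fun_inv (hψ.add_ne_zero (hsl y hy) v)
    have h2 := h.const_mul (ρ v : ℂ)
    simp only [id, ← div_eq_mul_inv] at h2
    exact h2.congr_deriv (by ring)

theorem weightedResolvent_one_ofReal (ψ : ℝ → ℝ) (r : ℝ) :
    weightedResolvent ψ (fun _ => 1) r = realResolvent ψ r := by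
  rw [weightedResolvent, realResolvent, ← integral_complex_ofReal]
  congr 1; ext v; push_cast; rfl

theorem realResolvent_pos (hψ : IsSymbol ψ) {r : ℝ} (hr : 0 < r) : 0 < realResolvent ψ r := by
  have h : ∀ v, 0 < 1 / (r + ψ v) := fun v => by have := hψ.nonneg v; positivity
  refine (integral_pos_iff_support_of_nonneg (fun v => (h v).le) (hψ.integrable_inv hr)).mpr ?_
  have : Function.support (fun v => 1 / (r + ψ v)) = Set.univ := by
    ext v; simp only [Function.mem_support, Set.mem_univ, iff_true]; exact (h v).ne'
  rw [this]; simp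

theorem realResolvent_antitone (hψ : IsSymbol ψ) {r s : ℝ} (hr : 0 < r) (hrs : r ≤ s) :
    realResolvent ψ s ≤ realResolvent ψ r := by
  refine integral_mono (hψ.integrable_inv (hr.trans_le hrs)) (hψ.integrable_inv hr) fun v => ?_
  have := hψ.nonneg v
  dsimp only
  gcongr

/-- On `|v| ≤ √r` with `r ≥ 1` the growth bound gives `r + ψ(v) ≤ 5r`, and this interval has length
`2√r`. The resulting `1 / G(r) = O(√r)` limits the growth of the Hankel integrand at infinity. -/
theorem realResolvent_ge (hψ : IsSymbol ψ) {r : ℝ} (hr : 1 ≤ r) :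
    2 / 5 * r ^ (-(1 / 2 : ℝ)) ≤ realResolvent ψ r := by
  have hr0 : 0 < r := by linarith
  have h1 : ∫ v in Set.Icc (-(r ^ (1 / 2 : ℝ))) (r ^ (1 / 2 : ℝ)), 1 / (5 * r)
      = 2 / 5 * r ^ (-(1 / 2 : ℝ)) := by
    rw [setIntegral_const, Measure.real, Real.volume_Icc, ENNReal.toReal_ofReal (by
      have := Real.rpow_nonneg hr0.le (1 / 2 : ℝ); linarith)]
    rw [Real.rpow_neg hr0.le, smul_eq_mul]
    have h : r = r ^ (1 / 2 : ℝ) * r ^ (1 / 2 : ℝ) := by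
      rw [← Real.rpow_add hr0]; norm_num
    have hp := Real.rpow_pos_of_pos hr0 (1 / 2 : ℝ)
    set y := r ^ (1 / 2 : ℝ)
    rw [h]; field_simp; ring
  rw [← h1, realResolvent]
  refine (setIntegral_mono_on (by
    rw [integrableOn_const_iff]; right; simp) (hψ.integrable_inv hr0).integrableOn
    measurableSet_Icc fun v hv => ?_).trans
    (setIntegral_le_integral (hψ.integrable_inv hr0) (Eventually.of_forall fun v => ?_))
  · have := hψ.nonneg v
    have h2 := hψ.growth v
    have h3 : v ^ 2 ≤ r := by
      have : v ^ 2 ≤ (r ^ (1 / 2 : ℝ)) ^ 2 := sq_le_sq' hv.1 hv.2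
      rwa [← Real.rpow_mul_natCast hr0.le, show (1 / 2 : ℝ) * (2 : ℕ) = 1 by norm_num,
        Real.rpow_one] at this
    gcongr
    linarith
  · have := hψ.nonneg v
    simp only [Pi.zero_apply]; positivity

/-- Multiplication by `exp(i arg z / 2)` puts all values `1 / (z + ψ(v))` in the right half plane,
with real part at least `cos(arg z / 2) / (‖z‖ + ψ(v))`. The integral therefore cannot cancel, so `1
/ G` is holomorphic on the whole slit plane. -/
theorem norm_resolvent_ge (hψ : IsSymbol ψ) {z : ℂ} (hz : z ∈ Complex.slitPlane) :
    Real.cos (z.arg / 2) * realResolvent ψ ‖z‖ ≤ ‖weightedResolvent ψ (fun _ => 1) z‖ := by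
  have hz0 := norm_pos_iff.mpr (Complex.slitPlane_ne_zero hz)
  have hc := cos_half_arg_pos hz
  set e := Complex.exp (((z.arg / 2 : ℝ) : ℂ) * Complex.I) with he
  have hint := hψ.integrable_weighted (ρ := fun _ => 1) continuous_const (by simp) hz
  have h1 : ‖weightedResolvent ψ (fun _ => 1) z‖ = ‖e * weightedResolvent ψ (fun _ => 1) z‖ := by
    rw [norm_mul, he, Complex.norm_exp_ofReal_mul_I, one_mul]
  rw [h1]
  refine le_trans ?_ (Complex.re_le_norm _)
  rw [weightedResolvent, ← integral_const_mul]
  have h2 : (∫ v, e * (((1 : ℝ) : ℂ) / (z + ψ v))).re = ∫ v, (e * (((1 : ℝ) : ℂ) / (z + ψ v))).re :=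
    (integral_re (hint.const_mul e)).symm
  rw [h2, realResolvent, ← integral_const_mul]
  refine integral_mono ((hψ.integrable_inv hz0).const_mul _) (hint.const_mul e).re fun v => ?_
  have h0 := hψ.nonneg v
  have hne := hψ.add_ne_zero hz v
  have h3 : (e * (((1 : ℝ) : ℂ) / (z + ψ v))).re
      = Real.cos (z.arg / 2) * (‖z‖ + ψ v) / ‖z + ψ v‖ ^ 2 := by
    have : e * (((1 : ℝ) : ℂ) / (z + ψ v))
        = (((‖z + ψ v‖ ^ 2)⁻¹ : ℝ) : ℂ) * (e * (starRingEnd ℂ) (z + ψ v)) := by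
      rw [Complex.ofReal_one, one_div, Complex.inv_def, Complex.normSq_eq_norm_sq]
      ring
    rw [this, Complex.re_ofReal_mul, map_add, Complex.conj_ofReal, mul_add, Complex.add_re]
    have hzc : (starRingEnd ℂ) z = ‖z‖ * Complex.exp (((-z.arg : ℝ) : ℂ) * Complex.I) := by
      conv_lhs => rw [← Complex.norm_mul_exp_arg_mul_I z]
      rw [map_mul, Complex.conj_ofReal, ← Complex.exp_conj, map_mul, Complex.conj_ofReal,
        Complex.conj_I]
      simp
    rw [hzc, he, mul_left_comm, ← Complex.exp_add, ← add_mul, ← Complex.ofReal_add,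
      Complex.re_ofReal_mul, mul_comm _ (ψ v : ℂ), Complex.re_ofReal_mul,
      Complex.exp_ofReal_mul_I_re, Complex.exp_ofReal_mul_I_re,
      show z.arg / 2 + -z.arg = -(z.arg / 2) by ring, Real.cos_neg]
    rw [div_eq_inv_mul]; ring
  change Real.cos (z.arg / 2) * (1 / (‖z‖ + ψ v)) ≤ (e * (((1 : ℝ) : ℂ) / (z + ψ v))).re
  rw [h3, mul_one_div, div_le_div_iff₀ (by positivity) (pow_pos (norm_pos_iff.mpr hne) 2)]
  have h4 : ‖z + ψ v‖ ≤ ‖z‖ + ψ v := (norm_add_le _ _).trans (by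
    rw [Complex.norm_real, Real.norm_of_nonneg h0])
  calc Real.cos (z.arg / 2) * ‖z + ψ v‖ ^ 2 ≤ Real.cos (z.arg / 2) * (‖z‖ + ψ v) ^ 2 := by gcongr
    _ = _ := by ring

theorem resolvent_ne_zero (hψ : IsSymbol ψ) {z : ℂ} (hz : z ∈ Complex.slitPlane) :
    weightedResolvent ψ (fun _ => 1) z ≠ 0 := by
  have h := hψ.norm_resolvent_ge hz
  have h1 := mul_pos (cos_half_arg_pos hz)
    (hψ.realResolvent_pos (norm_pos_iff.mpr (Complex.slitPlane_ne_zero hz)))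
  exact norm_pos_iff.mp (h1.trans_le h)

theorem differentiableOn_weightedResolvent (hψ : IsSymbol ψ) {ρ : ℝ → ℝ} (hρ : Continuous ρ)
    (hρ1 : ∀ v, |ρ v| ≤ 1) : DifferentiableOn ℂ (weightedResolvent ψ ρ) Complex.slitPlane :=
  fun _ hz => (hψ.hasDerivAt_weightedResolvent hρ hρ1 hz).differentiableAt.differentiableWithinAt

theorem conj_resolvent (ψ ρ : ℝ → ℝ) (z : ℂ) :
    weightedResolvent ψ ρ ((starRingEnd ℂ) z) = (starRingEnd ℂ) (weightedResolvent ψ ρ z) := by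
  rw [weightedResolvent, weightedResolvent, ← integral_conj]
  congr 1; ext v; simp

end IsSymbol

/-! ### Hankel contours in the logarithmic coordinate `z = exp ζ`. -/

theorem exp_mem_slitPlane {ζ : ℂ} (hζ : |ζ.im| < Real.pi) : Complex.exp ζ ∈ Complex.slitPlane := by
  rw [Complex.mem_slitPlane_iff_arg]
  have h := abs_lt.mp hζ
  have h1 : (Complex.exp ζ).arg = ζ.im := by
    rw [← Complex.log_im, Complex.log_exp h.1 h.2.le]
  exact ⟨by rw [h1]; exact h.2.ne, Complex.exp_ne_zero _⟩

theorem arg_exp_eq_im {ζ : ℂ} (hζ : |ζ.im| < Real.pi) : (Complex.exp ζ).arg = ζ.im := by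
  have h := abs_lt.mp hζ
  rw [← Complex.log_im, Complex.log_exp h.1 h.2.le]

/-- The integral of `F` along the boundary of the half strip `{x ≥ c, |y| ≤ β}`, run through
clockwise from `+∞ - iβ` to `+∞ + iβ`. For `F ζ = f (exp ζ)` it is the integral of `f(z) dz / z`
along a Hankel contour. -/
noncomputable def stripContour (β c : ℝ) (F : ℂ → ℂ) : ℂ :=
  (∫ x in Set.Ioi c, (F (x + β * Complex.I) - F (x - β * Complex.I))) +
    Complex.I * ∫ y in (-β)..β, F (c + y * Complex.I)

theorem strip_rect {a b c d : ℝ} {F : ℂ → ℂ} (hab : a ≤ b)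
    (hF : DifferentiableOn ℂ F {ζ | ζ.im ∈ Set.Icc a b}) :
    (∫ x in c..d, (F (x + b * Complex.I) - F (x + a * Complex.I))) +
      Complex.I * (∫ y in a..b, F (c + y * Complex.I)) =
    Complex.I * ∫ y in a..b, F (d + y * Complex.I) := by
  have h := Complex.integral_boundary_rect_eq_zero_of_differentiableOn F (c + a * Complex.I)
    (d + b * Complex.I) (hF.mono fun z hz => by
      have := hz.2
      simp only [Set.mem_preimage, Complex.add_im, Complex.ofReal_im,
        Complex.im_ofReal_mul, Complex.I_im, mul_one, zero_add] at this
      rwa [Set.uIcc_of_le hab] at this)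
  simp only [Complex.add_re, Complex.ofReal_re, Complex.re_ofReal_mul, Complex.I_re, mul_zero,
    add_zero, Complex.add_im, Complex.ofReal_im, Complex.im_ofReal_mul, Complex.I_im, mul_one,
    zero_add, smul_eq_mul] at h
  have hc := hF.continuousOn
  have h1 : ∀ y ∈ Set.Icc a b,
      IntervalIntegrable (fun x : ℝ => F (x + y * Complex.I)) volume c d := by
    intro y hy
    refine Continuous.intervalIntegrable ?_ _ _
    exact hc.comp_continuous (by fun_prop) fun x => by simpa using hy
  rw [intervalIntegral.integral_sub (h1 b ⟨hab, le_rfl⟩) (h1 a ⟨le_rfl, hab⟩)]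
  linear_combination -h

theorem stripContour_shift {β c d : ℝ} {F : ℂ → ℂ} (hβ : 0 ≤ β) (hcd : c ≤ d)
    (hF : DifferentiableOn ℂ F {ζ | |ζ.im| ≤ β})
    (hint : IntegrableOn (fun x : ℝ => F (x + β * Complex.I) - F (x - β * Complex.I))
      (Set.Ioi c)) :
    stripContour β c F = stripContour β d F := by
  have h := strip_rect (a := -β) (b := β) (c := c) (d := d) (by linarith)
    (hF.mono fun z hz => abs_le.mpr hz)
  simp only [Complex.ofReal_neg, neg_mul, ← sub_eq_add_neg] at h
  rw [stripContour, stripContour, ← h, ← intervalIntegral.integral_Ioi_sub_Ioi hint hcd]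
  ring

theorem tendsto_setIntegral_Ioi_zero {f : ℝ → ℂ} {c : ℝ} (hf : IntegrableOn f (Set.Ioi c)) :
    Tendsto (fun d : ℝ => ∫ x in Set.Ioi d, f x) atTop (𝓝 0) := by
  have h := intervalIntegral_tendsto_integral_Ioi c hf tendsto_id
  have h2 : Tendsto (fun d : ℝ => (∫ x in Set.Ioi c, f x) - ∫ x in c..d, f x) atTop
      (𝓝 ((∫ x in Set.Ioi c, f x) - ∫ x in Set.Ioi c, f x)) := tendsto_const_nhds.sub h
  rw [sub_self] at h2
  refine h2.congr' ?_
  filter_upwards [eventually_ge_atTop c] with d hd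
  rw [← intervalIntegral.integral_Ioi_sub_Ioi hf hd]; ring

theorem strip_integrable {β c C δ : ℝ} {F : ℂ → ℂ} (hδ : 0 < δ)
    (hF : ContinuousOn F {ζ | |ζ.im| ≤ β})
    (hb : ∀ x y : ℝ, c ≤ x → |y| ≤ β → ‖F (x + y * Complex.I)‖ ≤ C * Real.exp (-δ * x))
    {y : ℝ} (hy : |y| ≤ β) :
    IntegrableOn (fun x : ℝ => F (x + y * Complex.I)) (Set.Ioi c) := by
  have h : IntegrableOn (fun x : ℝ => C * Real.exp (-δ * x)) (Set.Ioi c) :=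
    (exp_neg_integrableOn_Ioi c hδ).const_mul C
  refine h.mono' ?_ ?_
  · exact (hF.comp_continuous (by fun_prop) fun x => by simpa using hy).aestronglyMeasurable
  · exact (ae_restrict_iff' measurableSet_Ioi).mpr (Eventually.of_forall fun x hx =>
      hb x y (le_of_lt hx) hy)

/-- Exponential decay throughout the closed half strip allows the vertical side to be pushed to
`+∞`, where every part of the contour vanishes. -/
theorem stripContour_eq_zero {β c C δ : ℝ} {F : ℂ → ℂ} (hβ : 0 ≤ β) (hδ : 0 < δ)
    (hF : DifferentiableOn ℂ F {ζ | |ζ.im| ≤ β})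
    (hb : ∀ x y : ℝ, c ≤ x → |y| ≤ β → ‖F (x + y * Complex.I)‖ ≤ C * Real.exp (-δ * x)) :
    stripContour β c F = 0 := by
  have hi : IntegrableOn (fun x : ℝ => F (x + β * Complex.I) - F (x - β * Complex.I))
      (Set.Ioi c) := by
    refine (strip_integrable hδ hF.continuousOn hb (abs_of_nonneg hβ).le).sub ?_
    have := strip_integrable hδ hF.continuousOn hb (y := -β) (by rw [abs_neg, abs_of_nonneg hβ])
    simpa [← sub_eq_add_neg] using this
  have h1 : Tendsto (fun d => stripContour β d F) atTop (𝓝 (0 + Complex.I * 0)) := by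
    refine (tendsto_setIntegral_Ioi_zero hi).add (tendsto_const_nhds.mul ?_)
    rw [tendsto_zero_iff_norm_tendsto_zero]
    have h2 : Tendsto (fun d : ℝ => C * Real.exp (-δ * d) * |β - -β|) atTop
        (𝓝 (C * 0 * |β - -β|)) := by
      refine Tendsto.mul_const _ (Tendsto.const_mul _ ?_)
      exact Real.tendsto_exp_atBot.comp (tendsto_id.const_mul_atTop_of_neg (by linarith))
    rw [mul_zero, zero_mul] at h2
    refine squeeze_zero' (Eventually.of_forall fun _ => norm_nonneg _) ?_ h2
    filter_upwards [eventually_ge_atTop c] with d hd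
    refine intervalIntegral.norm_integral_le_of_norm_le_const fun y hy => hb d y hd ?_
    rw [Set.uIoc_of_le (by linarith)] at hy
    exact abs_le.mpr ⟨hy.1.le, hy.2⟩
  rw [mul_zero, add_zero] at h1
  refine tendsto_nhds_unique (tendsto_const_nhds.congr' ?_) h1
  filter_upwards [eventually_ge_atTop c] with d hd
  exact stripContour_shift hβ hd hF hi

theorem norm_exp_mul_exp (t x y : ℝ) :
    ‖Complex.exp (t * Complex.exp (x + y * Complex.I))‖
      = Real.exp (t * (Real.exp x * Real.cos y)) := by
  rw [Complex.norm_exp, Complex.re_ofReal_mul, Complex.exp_re]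
  simp

/-- The Hankel integral of `exp (t z) / z`. -/
theorem stripContour_exp {β t : ℝ} (ht : 0 < t) (hβ : Real.pi / 2 < β) (hβ' : β < Real.pi) :
    stripContour β 0 (fun ζ => Complex.exp (t * Complex.exp ζ)) = 2 * Real.pi * Complex.I := by
  set F : ℂ → ℂ := fun ζ => Complex.exp (t * Complex.exp ζ) with hF
  have hπ := Real.pi_pos
  have hFd : Differentiable ℂ F := by rw [hF]; fun_prop
  have hFc : Continuous F := hFd.continuous
  have hcos : Real.cos β < 0 := Real.cos_neg_of_pi_div_two_lt_of_lt hβ (by linarith)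
  -- By `2πi`-periodicity the lower side is moved to height `2π - β`. The strip `β ≤ y ≤ 2π - β`
  -- lies where `cos y ≤ cos β < 0`, so there the integrand decays and Cauchy's theorem closes the
  -- contour on the right.
  have hper : ∀ x : ℝ, F (x - β * Complex.I) = F (x + (2 * Real.pi - β : ℝ) * Complex.I) := by
    intro x
    simp only [hF]
    have : (x : ℂ) + (2 * Real.pi - β : ℝ) * Complex.I
        = (x - β * Complex.I) + 2 * Real.pi * Complex.I := by push_cast; ring
    rw [this, Complex.exp_periodic]
  have hbd : ∀ x y : ℝ, β ≤ y → y ≤ 2 * Real.pi - β →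
      ‖F (x + y * Complex.I)‖ ≤ Real.exp (t * (Real.exp x * Real.cos β)) := by
    intro x y h1 h2
    rw [hF, norm_exp_mul_exp]
    gcongr
    have h3 : Real.cos (Real.pi - β) ≤ Real.cos |y - Real.pi| :=
      Real.cos_le_cos_of_nonneg_of_le_pi (abs_nonneg _) (by linarith)
        (abs_le.mpr ⟨by linarith, by linarith⟩)
    rw [Real.cos_abs, Real.cos_pi_sub, Real.cos_sub_pi] at h3
    linarith
  have hk : 0 < -(t * Real.cos β) := by nlinarith
  have hbd0 : ∀ x y : ℝ, 0 ≤ x → β ≤ y → y ≤ 2 * Real.pi - β →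
      ‖F (x + y * Complex.I)‖ ≤ Real.exp (-(-(t * Real.cos β)) * x) := by
    intro x y hx h1 h2
    refine (hbd x y h1 h2).trans (Real.exp_le_exp.mpr ?_)
    have := Real.add_one_le_exp x
    nlinarith
  have hi : ∀ y : ℝ, β ≤ y → y ≤ 2 * Real.pi - β →
      IntegrableOn (fun x : ℝ => F (x + y * Complex.I)) (Set.Ioi 0) := by
    intro y h1 h2
    refine (exp_neg_integrableOn_Ioi 0 hk).mono'
      (Continuous.aestronglyMeasurable (by fun_prop)) ?_
    exact (ae_restrict_iff' measurableSet_Ioi).mpr (Eventually.of_forall fun x hx =>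
      hbd0 x y (le_of_lt hx) h1 h2)
  have hI : IntegrableOn (fun x : ℝ => F (x + β * Complex.I) - F (x - β * Complex.I))
      (Set.Ioi 0) := by
    simp_rw [hper]
    exact (hi _ le_rfl (by linarith)).sub (hi _ (by linarith) le_rfl)
  have hlim : Tendsto (fun d : ℝ => Complex.I * ∫ y in β..(2 * Real.pi - β),
      F (d + y * Complex.I)) atTop (𝓝 (Complex.I * 0)) := by
    refine tendsto_const_nhds.mul ?_
    rw [tendsto_zero_iff_norm_tendsto_zero]
    have h2 : Tendsto (fun d : ℝ => Real.exp (-(-(t * Real.cos β)) * d) *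
        |2 * Real.pi - β - β|) atTop (𝓝 (0 * |2 * Real.pi - β - β|)) := by
      refine Tendsto.mul_const _ ?_
      exact Real.tendsto_exp_atBot.comp (tendsto_id.const_mul_atTop_of_neg (by linarith))
    rw [zero_mul] at h2
    refine squeeze_zero' (Eventually.of_forall fun _ => norm_nonneg _) ?_ h2
    filter_upwards [eventually_ge_atTop 0] with d hd
    refine intervalIntegral.norm_integral_le_of_norm_le_const fun y hy => ?_
    rw [Set.uIoc_of_le (by linarith)] at hy
    exact hbd0 d y hd hy.1.le hy.2
  have hlim2 : Tendsto (fun d : ℝ => (∫ x in (0 : ℝ)..d,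
      (F (x + (2 * Real.pi - β : ℝ) * Complex.I) - F (x + β * Complex.I))) +
      Complex.I * ∫ y in β..(2 * Real.pi - β), F ((0 : ℝ) + y * Complex.I)) atTop
      (𝓝 (-(∫ x in Set.Ioi (0 : ℝ), (F (x + β * Complex.I) - F (x - β * Complex.I))) +
      Complex.I * ∫ y in β..(2 * Real.pi - β), F ((0 : ℝ) + y * Complex.I))) := by
    refine Tendsto.add_const _ ?_
    have := (intervalIntegral_tendsto_integral_Ioi 0 hI tendsto_id).neg
    refine this.congr fun d => ?_
    rw [← intervalIntegral.integral_neg]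
    simp only [hper, neg_sub, id]
  have hrect : ∀ d : ℝ, _ := fun d => strip_rect (a := β) (b := 2 * Real.pi - β) (c := 0) (d := d)
    (F := F) (by linarith) hFd.differentiableOn
  have heq := tendsto_nhds_unique (hlim2.congr hrect) hlim
  -- The vertical sides now make up one full period, that is, the unit circle in `z`; the mean value
  -- property evaluates the average of `exp(tz)` as `1`.
  have hcircle : ∫ y in (-β)..(2 * Real.pi - β), F (y * Complex.I) = 2 * Real.pi := by
    have hp : Function.Periodic (fun y : ℝ => F (y * Complex.I)) (2 * Real.pi) := by
      intro y
      simp only [hF]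
      push_cast
      rw [add_mul, Complex.exp_periodic]
    have h1 := hp.intervalIntegral_add_eq (-β) 0
    rw [zero_add, show -β + 2 * Real.pi = 2 * Real.pi - β by ring] at h1
    rw [h1]
    have h2 := DiffContOnCl.circleAverage (f := fun z : ℂ => Complex.exp (t * z)) (c := 0)
      (R := 1) (Differentiable.diffContOnCl (by fun_prop))
    rw [Real.circleAverage_def] at h2
    simp only [mul_zero, Complex.exp_zero, circleMap_zero, Complex.ofReal_one, one_mul,
      Complex.real_smul, Complex.ofReal_inv] at h2
    rw [inv_mul_eq_one₀ (by exact_mod_cast (by positivity : 2 * Real.pi ≠ 0))] at h2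
    rw [← h2]; push_cast; rfl
  have hsplit := intervalIntegral.integral_add_adjacent_intervals
    (μ := volume) (f := fun y : ℝ => F (y * Complex.I)) (a := -β) (b := β) (c := 2 * Real.pi - β)
    (Continuous.intervalIntegrable (by fun_prop) _ _)
    (Continuous.intervalIntegrable (by fun_prop) _ _)
  rw [hcircle] at hsplit
  simp only [Complex.ofReal_zero, zero_add] at heq
  rw [stripContour]
  simp only [Complex.ofReal_zero, zero_add]
  linear_combination -heq + Complex.I * hsplit

/-! ### The return density, the Lévy tail and bounds on the contour. -/

/-- The density at the origin of the symmetric infinitely divisible law with exponent `t ψ`. -/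
noncomputable def returnDensity (ψ : ℝ → ℝ) (t : ℝ) : ℝ :=
  (2 * Real.pi)⁻¹ * ∫ v, Real.exp (-t * ψ v)

/-- The half opening angle of the Hankel contour. -/
noncomputable def hankelAngle : ℝ := 3 * Real.pi / 4

theorem hankelAngle_pos : 0 < hankelAngle := by have := Real.pi_pos; unfold hankelAngle; linarith

theorem hankelAngle_lt : hankelAngle < Real.pi := by
  have := Real.pi_pos; unfold hankelAngle; linarith

theorem cos_hankelAngle : Real.cos hankelAngle = -(Real.sqrt 2 / 2) := by
  rw [hankelAngle, show 3 * Real.pi / 4 = Real.pi - Real.pi / 4 by ring, Real.cos_pi_sub,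
    Real.cos_pi_div_four]

theorem sin_hankelAngle : Real.sin hankelAngle = Real.sqrt 2 / 2 := by
  rw [hankelAngle, show 3 * Real.pi / 4 = Real.pi - Real.pi / 4 by ring, Real.sin_pi_sub,
    Real.sin_pi_div_four]

theorem cos_half_hankelAngle_pos : 0 < Real.cos (hankelAngle / 2) := by
  have := hankelAngle_pos
  have := hankelAngle_lt
  apply Real.cos_pos_of_mem_Ioo
  constructor <;> linarith

theorem cos_half_hankelAngle_le {y : ℝ} (hy : |y| ≤ hankelAngle) :
    Real.cos (hankelAngle / 2) ≤ Real.cos (y / 2) := by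
  have := hankelAngle_lt
  have := Real.pi_pos
  rw [← Real.cos_abs (y / 2)]
  refine Real.cos_le_cos_of_nonneg_of_le_pi (abs_nonneg _) (by linarith) ?_
  rw [abs_div, abs_two]; linarith

/-- `exp (t z) / G(z)` at `z = exp ζ`, with `G` the resolvent at the origin. -/
noncomputable def hankelIntegrand (ψ : ℝ → ℝ) (t : ℝ) (ζ : ℂ) : ℂ :=
  Complex.exp (t * Complex.exp ζ) / weightedResolvent ψ (fun _ => 1) (Complex.exp ζ)

/-- The inverse Laplace transform at `t` of `2π / (z G(z))`: the tail of the Lévy measure of the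
inverse local time at the origin. -/
noncomputable def levyTail (ψ : ℝ → ℝ) (t : ℝ) : ℝ :=
  (stripContour hankelAngle 0 (hankelIntegrand ψ t)).im

theorem stripContour_integral {β c : ℝ} {μ : Measure ℝ} [SFinite μ] {F : ℝ → ℂ → ℂ}
    (hβ : 0 ≤ β)
    (h1 : Integrable (fun p : ℝ × ℝ => F p.1 (p.2 + β * Complex.I))
      (μ.prod (volume.restrict (Set.Ioi c))))
    (h2 : Integrable (fun p : ℝ × ℝ => F p.1 (p.2 - β * Complex.I))
      (μ.prod (volume.restrict (Set.Ioi c))))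
    (h3 : Integrable (fun p : ℝ × ℝ => F p.1 (c + p.2 * Complex.I))
      (μ.prod (volume.restrict (Set.Ioc (-β) β)))) :
    Integrable (fun s => stripContour β c (F s)) μ ∧
    ∫ s, stripContour β c (F s) ∂μ = stripContour β c (fun ζ => ∫ s, F s ζ ∂μ) := by
  have h4 := h1.sub h2
  have h5 : Integrable (fun s => ∫ x in Set.Ioi c,
      (F s (x + β * Complex.I) - F s (x - β * Complex.I))) μ := h4.integral_prod_left
  have h6 : Integrable (fun s => Complex.I * ∫ y in (-β)..β, F s (c + y * Complex.I)) μ := by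
    simp_rw [intervalIntegral.integral_of_le (neg_le_self hβ)]
    exact h3.integral_prod_left.const_mul _
  refine ⟨h5.add h6, ?_⟩
  simp only [stripContour]
  rw [integral_add h5 h6, integral_const_mul]
  congr 1
  · rw [integral_integral_swap h4]
    refine integral_congr_ae ?_
    filter_upwards [h1.prod_left_ae, h2.prod_left_ae] with x hx1 hx2
    exact integral_sub hx1 hx2
  · simp_rw [intervalIntegral.integral_of_le (neg_le_self hβ)]
    rw [integral_integral_swap h3]

/-- The exponent `3/4` lies strictly between `1/2` and `1`. With `u` proportional to `s exp x`, the
decay `exp(-3x/4)` beats the growth `exp(x/2)` of `1 / G`, while `s^(-3/4)` remains integrable at `s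
= 0`. -/
theorem exp_neg_le_rpow {u : ℝ} (hu : 0 < u) : Real.exp (-u) ≤ u ^ (-(3 / 4 : ℝ)) := by
  rw [Real.exp_neg, Real.rpow_neg hu.le]
  refine inv_anti₀ (Real.rpow_pos_of_pos hu _) ?_
  rcases le_total u 1 with h | h
  · exact (Real.rpow_le_one hu.le h (by norm_num)).trans (Real.one_le_exp hu.le)
  · calc u ^ (3 / 4 : ℝ) ≤ u ^ (1 : ℝ) := Real.rpow_le_rpow_of_exponent_le h (by norm_num)
      _ = u := Real.rpow_one u
      _ ≤ _ := by have := Real.add_one_le_exp u; linarith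

namespace IsSymbol

variable {ψ : ℝ → ℝ}

theorem integrable_exp (hψ : IsSymbol ψ) {t : ℝ} (ht : 0 < t) :
    Integrable (fun v => Real.exp (-t * ψ v)) := by
  have hc := hψ.continuous
  refine ((hψ.integrable_inv (r := 1 / t) (by positivity)).const_mul (1 / t)).mono'
    (Continuous.aestronglyMeasurable (by fun_prop)) (Eventually.of_forall fun v => ?_)
  have h0 := hψ.nonneg v
  rw [Real.norm_of_nonneg (Real.exp_pos _).le, neg_mul, Real.exp_neg, one_div_mul_one_div,
    ← one_div]
  refine one_div_le_one_div_of_le (by positivity) ?_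
  have := Real.add_one_le_exp (t * ψ v)
  have h1 : t * (1 / t + ψ v) = t * ψ v + 1 := by field_simp; ring
  linarith

theorem returnDensity_nonneg (ψ : ℝ → ℝ) (t : ℝ) : 0 ≤ returnDensity ψ t := by
  have := Real.pi_pos
  exact mul_nonneg (by positivity) (integral_nonneg fun v => (Real.exp_pos _).le)

theorem returnDensity_antitone (hψ : IsSymbol ψ) {s t : ℝ} (hs : 0 < s) (hst : s ≤ t) :
    returnDensity ψ t ≤ returnDensity ψ s := by
  have := Real.pi_pos
  refine mul_le_mul_of_nonneg_left ?_ (by positivity)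
  refine integral_mono (hψ.integrable_exp (hs.trans_le hst)) (hψ.integrable_exp hs) fun v => ?_
  have := hψ.nonneg v
  dsimp only
  gcongr

theorem measurable_returnDensity (hψ : IsSymbol ψ) : Measurable (returnDensity ψ) := by
  have hc := hψ.continuous
  have : StronglyMeasurable (fun p : ℝ × ℝ => Real.exp (-p.1 * ψ p.2)) :=
    Continuous.stronglyMeasurable (by fun_prop)
  exact (this.integral_prod_right'.measurable).const_mul _

/-- The factor `exp t` replaces `ψ` by `1 + ψ` in the exponent, which keeps the bound finite at
zeros of `ψ` and integrable in `v`. -/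
theorem setIntegral_exp_le (hψ : IsSymbol ψ) {t : ℝ} (ht : 0 ≤ t) (v : ℝ) :
    ∫ u in Set.Ioc 0 t, Real.exp (-u * ψ v) ≤ Real.exp t * (1 / (1 + ψ v)) := by
  have h0 := hψ.nonneg v
  have h1 : ∫ u in (0 : ℝ)..t, Real.exp (-u * ψ v) ≤
      ∫ u in (0 : ℝ)..t, Real.exp t * Real.exp (-(1 + ψ v) * u) := by
    refine intervalIntegral.integral_mono_on ht (Continuous.intervalIntegrable (by fun_prop) _ _)
      (Continuous.intervalIntegrable (by fun_prop) _ _) fun u hu => ?_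
    rw [← Real.exp_add]
    refine Real.exp_le_exp.mpr ?_
    have := hu.2
    linarith
  rw [← intervalIntegral.integral_of_le ht]
  refine h1.trans ?_
  rw [intervalIntegral.integral_const_mul]
  gcongr
  have hne : -(1 + ψ v) ≠ 0 := by linarith
  rw [intervalIntegral.integral_comp_mul_left Real.exp hne, integral_exp, mul_zero, Real.exp_zero,
    smul_eq_mul, inv_neg, neg_mul, ← mul_neg, neg_sub, ← div_eq_inv_mul]
  gcongr
  linarith [Real.exp_pos (-(1 + ψ v) * t)]

theorem integrable_exp_prod (hψ : IsSymbol ψ) {t : ℝ} (ht : 0 ≤ t) :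
    Integrable (fun p : ℝ × ℝ => Real.exp (-p.1 * ψ p.2))
      ((volume.restrict (Set.Ioc 0 t)).prod volume) := by
  have hc := hψ.continuous
  rw [integrable_prod_iff' (Continuous.aestronglyMeasurable (by fun_prop))]
  constructor
  · refine Eventually.of_forall fun v => ?_
    have : Continuous (fun u => Real.exp (-u * ψ v)) := by fun_prop
    exact (this.integrableOn_Icc (a := 0) (b := t)).mono_set Set.Ioc_subset_Icc_self
  · refine (hψ.integrable.const_mul (Real.exp t)).mono' ?_ (Eventually.of_forall fun v => ?_)
    · have : StronglyMeasurable (fun p : ℝ × ℝ => ‖Real.exp (-p.2 * ψ p.1)‖) :=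
        Continuous.stronglyMeasurable (by fun_prop)
      exact (this.integral_prod_right').aestronglyMeasurable
    · simp only [Real.norm_of_nonneg (Real.exp_pos _).le]
      rw [Real.norm_of_nonneg (integral_nonneg fun u => (Real.exp_pos _).le)]
      exact hψ.setIntegral_exp_le ht v

theorem integrableOn_returnDensity (hψ : IsSymbol ψ) {t : ℝ} (ht : 0 ≤ t) :
    IntegrableOn (returnDensity ψ) (Set.Ioc 0 t) :=
  ((hψ.integrable_exp_prod ht).integral_prod_left).const_mul _

theorem intervalIntegrable_returnDensity (hψ : IsSymbol ψ) {t : ℝ} (ht : 0 ≤ t) :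
    IntervalIntegrable (returnDensity ψ) volume 0 t :=
  (intervalIntegrable_iff_integrableOn_Ioc_of_le ht).mpr (hψ.integrableOn_returnDensity ht)

theorem intervalIntegrable_returnDensity_sub (hψ : IsSymbol ψ) {t : ℝ} (ht : 0 ≤ t) :
    IntervalIntegrable (fun s => returnDensity ψ (t - s)) volume 0 t := by
  have := ((hψ.intervalIntegrable_returnDensity ht).comp_sub_left t).symm
  simpa using this

/-- Convolving the return density with an exponential. -/
theorem integral_returnDensity_mul_exp (hψ : IsSymbol ψ) {t : ℝ} (ht : 0 < t) {z : ℂ}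
    (hz : z ∈ Complex.slitPlane) :
    ∫ s in (0 : ℝ)..t, (returnDensity ψ (t - s) : ℂ) * Complex.exp (s * z) =
      (2 * Real.pi)⁻¹ * (Complex.exp (t * z) * weightedResolvent ψ (fun _ => 1) z -
        weightedResolvent ψ (fun v => Real.exp (-t * ψ v)) z) := by
  have hc := hψ.continuous
  have h1 : ∫ s in (0 : ℝ)..t, (returnDensity ψ (t - s) : ℂ) * Complex.exp (s * z) =
      ∫ u in (0 : ℝ)..t, (returnDensity ψ u : ℂ) * Complex.exp (((t - u : ℝ) : ℂ) * z) := by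
    have := intervalIntegral.integral_comp_sub_left (a := 0) (b := t)
      (fun u : ℝ => (returnDensity ψ u : ℂ) * Complex.exp (((t - u : ℝ) : ℂ) * z)) t
    simpa using this
  rw [h1, intervalIntegral.integral_of_le ht.le]
  have h2 : ∀ u : ℝ, (returnDensity ψ u : ℂ) * Complex.exp (((t - u : ℝ) : ℂ) * z) =
      (2 * Real.pi)⁻¹ * ∫ v, (Real.exp (-u * ψ v) : ℂ) * Complex.exp (((t - u : ℝ) : ℂ) * z) := by
    intro u
    rw [integral_mul_const, returnDensity, integral_complex_ofReal]
    push_cast; ring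
  simp_rw [h2]
  rw [integral_const_mul]
  congr 1
  have h3 : Integrable (Function.uncurry fun (u v : ℝ) =>
      (Real.exp (-u * ψ v) : ℂ) * Complex.exp (((t - u : ℝ) : ℂ) * z))
      ((volume.restrict (Set.Ioc 0 t)).prod volume) := by
    refine ((hψ.integrable_exp_prod ht.le).mul_const (Real.exp (t * ‖z‖))).mono'
      (Continuous.aestronglyMeasurable (by fun_prop)) ?_
    have hae : ∀ᵐ p : ℝ × ℝ ∂((volume.restrict (Set.Ioc 0 t)).prod volume),
        p.1 ∈ Set.Ioc 0 t :=
      Measure.quasiMeasurePreserving_fst.ae (ae_restrict_mem measurableSet_Ioc)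
    filter_upwards [hae] with p hp
    simp only [Function.uncurry]
    rw [norm_mul, Complex.norm_real, Real.norm_of_nonneg (Real.exp_pos _).le, Complex.norm_exp]
    gcongr
    rw [Complex.re_ofReal_mul]
    have h5 := Complex.abs_re_le_norm z
    have h6 := le_abs_self z.re
    have h7 : t - p.1 ≤ t := by linarith [hp.1]
    have h8 : 0 ≤ t - p.1 := by linarith [hp.2]
    have h9 := norm_nonneg z
    calc (t - p.1) * z.re ≤ (t - p.1) * ‖z‖ := by gcongr; linarith
      _ ≤ t * ‖z‖ := by gcongr
  rw [integral_integral_swap h3]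
  have h4 : ∀ v, ∫ u in Set.Ioc 0 t,
      (Real.exp (-u * ψ v) : ℂ) * Complex.exp (((t - u : ℝ) : ℂ) * z) =
      Complex.exp (t * z) * (((1 : ℝ) : ℂ) / (z + ψ v)) - (Real.exp (-t * ψ v) : ℂ) / (z + ψ v) := by
    intro v
    have hne := hψ.add_ne_zero hz v
    rw [← intervalIntegral.integral_of_le ht.le]
    have h5 : ∀ u : ℝ, (Real.exp (-u * ψ v) : ℂ) * Complex.exp (((t - u : ℝ) : ℂ) * z) =
        Complex.exp (t * z) * Complex.exp (-(z + ψ v) * u) := by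
      intro u
      push_cast
      rw [← Complex.exp_add, ← Complex.exp_add]; congr 1; ring
    simp_rw [h5]
    rw [intervalIntegral.integral_const_mul, integral_exp_mul_complex (neg_ne_zero.mpr hne)]
    have h6 : Complex.exp (t * z) * Complex.exp (-(z + ψ v) * t) = (Real.exp (-t * ψ v) : ℂ) := by
      push_cast
      rw [← Complex.exp_add]; congr 1; ring
    rw [← h6]
    field_simp
    simp
  simp_rw [h4]
  rw [integral_sub, integral_const_mul, weightedResolvent, weightedResolvent]
  · exact (hψ.integrable_weighted continuous_const (by simp) hz).const_mul _
  · refine hψ.integrable_weighted (ρ := fun v => Real.exp (-t * ψ v)) (by fun_prop) (fun v => ?_) hz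
    have := hψ.nonneg v
    rw [abs_of_pos (Real.exp_pos _), Real.exp_le_one_iff]
    nlinarith

theorem norm_exp_add_mul_I (x y : ℝ) : ‖Complex.exp (x + y * Complex.I)‖ = Real.exp x := by
  rw [Complex.norm_exp]; simp

theorem norm_inv_resolvent_exp_le (hψ : IsSymbol ψ) {x y : ℝ} (hx : 0 ≤ x)
    (hy : |y| ≤ hankelAngle) :
    ‖(weightedResolvent ψ (fun _ => 1) (Complex.exp (x + y * Complex.I)))⁻¹‖ ≤
      5 / 2 * (Real.cos (hankelAngle / 2))⁻¹ * Real.exp (x / 2) := by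
  have him : (x + y * Complex.I : ℂ).im = y := by simp
  have hlt : |(x + y * Complex.I : ℂ).im| < Real.pi := by
    rw [him]; exact hy.trans_lt hankelAngle_lt
  have h1 := hψ.norm_resolvent_ge (exp_mem_slitPlane hlt)
  rw [arg_exp_eq_im hlt, him, norm_exp_add_mul_I] at h1
  have h2 := hψ.realResolvent_ge (Real.one_le_exp hx)
  have h3 := cos_half_hankelAngle_le hy
  have h4 := cos_half_hankelAngle_pos
  have h5 : (Real.exp x) ^ (-(1 / 2 : ℝ)) = (Real.exp (x / 2))⁻¹ := by
    rw [← Real.exp_mul, ← Real.exp_neg]; congr 1; ring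
  rw [h5] at h2
  rw [norm_inv]
  have h6 : Real.cos (hankelAngle / 2) * (2 / 5 * (Real.exp (x / 2))⁻¹) ≤
      ‖weightedResolvent ψ (fun _ => 1) (Complex.exp (x + y * Complex.I))‖ := by
    refine le_trans ?_ h1
    have := Real.exp_pos (x / 2)
    have := h4.le.trans h3
    gcongr
  calc _ ≤ (Real.cos (hankelAngle / 2) * (2 / 5 * (Real.exp (x / 2))⁻¹))⁻¹ := by
        refine inv_anti₀ ?_ h6
        have := Real.exp_pos (x / 2)
        positivity
    _ = _ := by
      have := Real.exp_pos (x / 2)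
      field_simp

theorem hankelIntegrand_eq (ψ : ℝ → ℝ) (t : ℝ) (ζ : ℂ) :
    hankelIntegrand ψ t ζ = Complex.exp (t * Complex.exp ζ) *
      (weightedResolvent ψ (fun _ => 1) (Complex.exp ζ))⁻¹ := div_eq_mul_inv _ _

/-- On the two rays `|exp(sz)| = exp(-s |z| √2 / 2)`, which is traded for `2 (s |z|)^(-3/4)` and
multiplied by the `|z|^(1/2)` bound on `1 / G`. -/
theorem norm_hankelIntegrand_le (hψ : IsSymbol ψ) {s x y : ℝ} (hs : 0 < s) (hx : 0 ≤ x)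
    (hy : |y| = hankelAngle) :
    ‖hankelIntegrand ψ s (x + y * Complex.I)‖ ≤
      5 * (Real.cos (hankelAngle / 2))⁻¹ * (s ^ (-(3 / 4 : ℝ)) * Real.exp (-(1 / 4) * x)) := by
  rw [hankelIntegrand_eq, norm_mul, norm_exp_mul_exp]
  have h1 := hψ.norm_inv_resolvent_exp_le hx hy.le
  have h2 : Real.exp (s * (Real.exp x * Real.cos y)) ≤
      2 * (s ^ (-(3 / 4 : ℝ)) * Real.exp (-(3 / 4) * x)) := by
    rw [← Real.cos_abs, hy, cos_hankelAngle]
    have h3 := exp_neg_le_rpow (u := s * Real.exp x * (Real.sqrt 2 / 2)) (by positivity)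
    rw [Real.mul_rpow (by positivity) (by positivity), Real.mul_rpow hs.le (Real.exp_pos _).le,
      ← Real.exp_mul] at h3
    rw [show s * (Real.exp x * -(Real.sqrt 2 / 2)) = -(s * Real.exp x * (Real.sqrt 2 / 2)) by ring]
    refine h3.trans ?_
    have h4 : (Real.sqrt 2 / 2) ^ (-(3 / 4 : ℝ)) ≤ 2 := by
      rw [Real.rpow_neg (by positivity)]
      have h6 : (1 / 2 : ℝ) ≤ Real.sqrt 2 / 2 := by
        have : (1 : ℝ) ≤ Real.sqrt 2 := by rw [Real.one_le_sqrt]; norm_num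
        linarith
      have h7 : (1 / 2 : ℝ) ≤ (Real.sqrt 2 / 2) ^ (3 / 4 : ℝ) := by
        calc (1 / 2 : ℝ) = (1 / 2 : ℝ) ^ (1 : ℝ) := by rw [Real.rpow_one]
          _ ≤ (1 / 2 : ℝ) ^ (3 / 4 : ℝ) :=
            Real.rpow_le_rpow_of_exponent_ge (by norm_num) (by norm_num) (by norm_num)
          _ ≤ _ := Real.rpow_le_rpow (by norm_num) h6 (by norm_num)
      calc _ ≤ (1 / 2 : ℝ)⁻¹ := inv_anti₀ (by norm_num) h7
        _ = 2 := by norm_num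
    rw [mul_comm x, mul_comm]
    gcongr
  calc _ ≤ (2 * (s ^ (-(3 / 4 : ℝ)) * Real.exp (-(3 / 4) * x))) *
        (5 / 2 * (Real.cos (hankelAngle / 2))⁻¹ * Real.exp (x / 2)) := by gcongr
    _ = 5 * (Real.cos (hankelAngle / 2))⁻¹ * (s ^ (-(3 / 4 : ℝ)) *
        (Real.exp (-(3 / 4) * x) * Real.exp (x / 2))) := by ring
    _ = _ := by rw [← Real.exp_add]; ring_nf

theorem norm_hankelIntegrand_arc_le (hψ : IsSymbol ψ) {s y : ℝ} (hs : 0 ≤ s)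
    (hy : |y| ≤ hankelAngle) :
    ‖hankelIntegrand ψ s ((0 : ℝ) + y * Complex.I)‖ ≤
      5 * (Real.cos (hankelAngle / 2))⁻¹ * Real.exp s := by
  rw [hankelIntegrand_eq, norm_mul, norm_exp_mul_exp]
  have h1 := hψ.norm_inv_resolvent_exp_le le_rfl hy
  have h4 := cos_half_hankelAngle_pos
  rw [zero_div, Real.exp_zero, mul_one] at h1
  have h2 : Real.exp (s * (Real.exp 0 * Real.cos y)) ≤ Real.exp s := by
    refine Real.exp_le_exp.mpr ?_
    rw [Real.exp_zero, one_mul]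
    exact mul_le_of_le_one_right hs (Real.cos_le_one y)
  calc _ ≤ Real.exp s * (5 / 2 * (Real.cos (hankelAngle / 2))⁻¹) := by gcongr
    _ ≤ _ := by
      have : 0 ≤ Real.exp s * (Real.cos (hankelAngle / 2))⁻¹ := by positivity
      linarith

theorem differentiableOn_resolvent_exp (hψ : IsSymbol ψ) {ρ : ℝ → ℝ} (hρ : Continuous ρ)
    (hρ1 : ∀ v, |ρ v| ≤ 1) :
    DifferentiableOn ℂ (fun ζ => weightedResolvent ψ ρ (Complex.exp ζ))
      {ζ | |ζ.im| ≤ hankelAngle} :=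
  (hψ.differentiableOn_weightedResolvent hρ hρ1).comp
    (Complex.differentiable_exp.differentiableOn)
    fun _ hζ => exp_mem_slitPlane (lt_of_le_of_lt hζ hankelAngle_lt)

theorem resolvent_exp_ne_zero (hψ : IsSymbol ψ) {ζ : ℂ} (hζ : |ζ.im| ≤ hankelAngle) :
    weightedResolvent ψ (fun _ => 1) (Complex.exp ζ) ≠ 0 :=
  hψ.resolvent_ne_zero (exp_mem_slitPlane (lt_of_le_of_lt hζ hankelAngle_lt))

theorem differentiableOn_hankelIntegrand (hψ : IsSymbol ψ) (t : ℝ) :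
    DifferentiableOn ℂ (hankelIntegrand ψ t) {ζ | |ζ.im| ≤ hankelAngle} :=
  DifferentiableOn.div (by fun_prop)
    (hψ.differentiableOn_resolvent_exp continuous_const (by simp))
    fun _ hζ => hψ.resolvent_exp_ne_zero hζ

theorem continuousOn_hankelIntegrand (hψ : IsSymbol ψ) :
    ContinuousOn (fun p : ℝ × ℂ => hankelIntegrand ψ p.1 p.2) {p | |p.2.im| ≤ hankelAngle} := by
  refine ContinuousOn.div (by fun_prop) ?_ fun p hp => hψ.resolvent_exp_ne_zero hp
  exact (hψ.differentiableOn_resolvent_exp continuous_const (by simp)).continuousOn.comp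
    continuous_snd.continuousOn fun p hp => hp

theorem continuous_hankelIntegrand_comp (hψ : IsSymbol ψ) {E : Type*} [TopologicalSpace E]
    {f : E → ℝ} {g : E → ℂ} (hf : Continuous f) (hg : Continuous g)
    (hy : ∀ p, |(g p).im| ≤ hankelAngle) :
    Continuous (fun p => hankelIntegrand ψ (f p) (g p)) :=
  hψ.continuousOn_hankelIntegrand.comp_continuous (hf.prodMk hg) hy

end IsSymbol

/-! ### The convolution identity between return density and Lévy tail. -/

namespace IsSymbol

variable {ψ : ℝ → ℝ}

/-- The two factors are singular at opposite ends of the interval. Cut at `t/2`: on each half the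
factor that is regular there is bounded, by monotonicity, by its value at `t/2`. -/
theorem integrableOn_returnDensity_mul_rpow (hψ : IsSymbol ψ) {t : ℝ} (ht : 0 < t) :
    IntegrableOn (fun s => returnDensity ψ (t - s) * s ^ (-(3 / 4 : ℝ))) (Set.Ioc 0 t) := by
  have h1 : IntegrableOn (fun s : ℝ => s ^ (-(3 / 4 : ℝ))) (Set.Ioc 0 t) :=
    (intervalIntegrable_iff_integrableOn_Ioc_of_le ht.le).mp
      (intervalIntegral.intervalIntegrable_rpow' (by norm_num))
  have h2 : IntegrableOn (fun s => returnDensity ψ (t - s)) (Set.Ioc 0 t) :=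
    (intervalIntegrable_iff_integrableOn_Ioc_of_le ht.le).mp
      (hψ.intervalIntegrable_returnDensity_sub ht.le)
  have hm := hψ.measurable_returnDensity
  refine ((h1.const_mul (returnDensity ψ (t / 2))).add
    (h2.const_mul ((t / 2) ^ (-(3 / 4 : ℝ))))).mono' (by fun_prop) ?_
  refine (ae_restrict_iff' measurableSet_Ioc).mpr (Eventually.of_forall fun s hs => ?_)
  have h3 := returnDensity_nonneg ψ (t - s)
  have h4 := Real.rpow_nonneg hs.1.le (-(3 / 4 : ℝ))
  have h5 := returnDensity_nonneg ψ (t / 2)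
  have h6 := Real.rpow_nonneg (by positivity : 0 ≤ t / 2) (-(3 / 4 : ℝ))
  rw [Real.norm_of_nonneg (by positivity)]
  simp only [Pi.add_apply]
  rcases le_total s (t / 2) with h | h
  · have := hψ.returnDensity_antitone (s := t / 2) (t := t - s) (by positivity) (by linarith)
    have h7 : returnDensity ψ (t - s) * s ^ (-(3 / 4 : ℝ)) ≤
      returnDensity ψ (t / 2) * s ^ (-(3 / 4 : ℝ)) := by gcongr
    have : 0 ≤ (t / 2) ^ (-(3 / 4 : ℝ)) * returnDensity ψ (t - s) := by positivity
    linarith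
  · have h7 : s ^ (-(3 / 4 : ℝ)) ≤ (t / 2) ^ (-(3 / 4 : ℝ)) :=
      Real.rpow_le_rpow_of_nonpos (by positivity) h (by norm_num)
    have h8 : returnDensity ψ (t - s) * s ^ (-(3 / 4 : ℝ)) ≤
      (t / 2) ^ (-(3 / 4 : ℝ)) * returnDensity ψ (t - s) := by
      rw [mul_comm]; gcongr
    have : 0 ≤ returnDensity ψ (t / 2) * s ^ (-(3 / 4 : ℝ)) := by positivity
    linarith

theorem norm_hankelIntegrand_add_le (hψ : IsSymbol ψ) {s x : ℝ} (hs : 0 < s) (hx : 0 ≤ x) :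
    ‖hankelIntegrand ψ s (x + hankelAngle * Complex.I)‖ ≤
      5 * (Real.cos (hankelAngle / 2))⁻¹ * (s ^ (-(3 / 4 : ℝ)) * Real.exp (-(1 / 4) * x)) :=
  hψ.norm_hankelIntegrand_le hs hx (abs_of_nonneg hankelAngle_pos.le)

theorem norm_hankelIntegrand_sub_le (hψ : IsSymbol ψ) {s x : ℝ} (hs : 0 < s) (hx : 0 ≤ x) :
    ‖hankelIntegrand ψ s (x - hankelAngle * Complex.I)‖ ≤
      5 * (Real.cos (hankelAngle / 2))⁻¹ * (s ^ (-(3 / 4 : ℝ)) * Real.exp (-(1 / 4) * x)) := by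
  have := hψ.norm_hankelIntegrand_le (y := -hankelAngle) hs hx
    (by rw [abs_neg, abs_of_nonneg hankelAngle_pos.le])
  simpa [← sub_eq_add_neg] using this

theorem continuous_hankelIntegrand_add (hψ : IsSymbol ψ) :
    Continuous (fun p : ℝ × ℝ => hankelIntegrand ψ p.1 (p.2 + hankelAngle * Complex.I)) :=
  hψ.continuous_hankelIntegrand_comp (by fun_prop) (by fun_prop)
    fun p => by simp [abs_of_nonneg hankelAngle_pos.le]

theorem continuous_hankelIntegrand_sub (hψ : IsSymbol ψ) :
    Continuous (fun p : ℝ × ℝ => hankelIntegrand ψ p.1 (p.2 - hankelAngle * Complex.I)) :=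
  hψ.continuous_hankelIntegrand_comp (by fun_prop) (by fun_prop)
    fun p => by simp [abs_of_nonneg hankelAngle_pos.le]

theorem integrableOn_exp_quarter :
    IntegrableOn (fun x : ℝ => Real.exp (-(1 / 4) * x)) (Set.Ioi 0) :=
  exp_neg_integrableOn_Ioi 0 (by norm_num)

theorem integrableOn_hankelIntegrand_add (hψ : IsSymbol ψ) {s : ℝ} (hs : 0 < s) :
    IntegrableOn (fun x : ℝ => hankelIntegrand ψ s (x + hankelAngle * Complex.I))
      (Set.Ioi 0) := by
  refine ((integrableOn_exp_quarter.const_mul (s ^ (-(3 / 4 : ℝ)))).const_mul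
    (5 * (Real.cos (hankelAngle / 2))⁻¹)).mono' ?_ ?_
  · exact (hψ.continuous_hankelIntegrand_add.comp (by fun_prop : Continuous fun x : ℝ =>
      (s, x))).aestronglyMeasurable
  · exact (ae_restrict_iff' measurableSet_Ioi).mpr (Eventually.of_forall fun x hx =>
      hψ.norm_hankelIntegrand_add_le hs (le_of_lt hx))

/-- Clamping the ordinate to `[-hankelAngle, hankelAngle]` gives a function continuous on the whole
plane that agrees with the integrand on the arc, so measurability and parameter continuity come for
free. -/
theorem continuous_hankelIntegrand_arc (hψ : IsSymbol ψ) : Continuous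
    (fun p : ℝ × ℝ => hankelIntegrand ψ p.1 ((0 : ℝ) +
      (max (-hankelAngle) (min p.2 hankelAngle) : ℝ) * Complex.I)) := by
  refine hψ.continuous_hankelIntegrand_comp (by fun_prop) (by fun_prop) fun p => ?_
  have h := hankelAngle_pos
  simp only [Complex.add_im, Complex.ofReal_im, Complex.im_ofReal_mul, Complex.I_im, mul_one,
    zero_add]
  exact abs_le.mpr ⟨le_max_left _ _, max_le (by linarith) (min_le_right _ _)⟩

theorem clamp_eq {y : ℝ} (hy : y ∈ Set.Ioc (-hankelAngle) hankelAngle) :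
    max (-hankelAngle) (min y hankelAngle) = y := by
  rw [min_eq_left hy.2, max_eq_right hy.1.le]

/-- The rays contribute the power of `s` and the arc contributes `exp s`. The power is integrable at
zero, which makes the Lévy tail locally integrable. -/
theorem exists_norm_stripContour_le (hψ : IsSymbol ψ) : ∃ C : ℝ, 0 ≤ C ∧ ∀ s : ℝ, 0 < s →
    ‖stripContour hankelAngle 0 (hankelIntegrand ψ s)‖ ≤
      C * (s ^ (-(3 / 4 : ℝ)) + Real.exp s) := by
  have hκ := cos_half_hankelAngle_pos
  have hβ := hankelAngle_pos
  set K := 5 * (Real.cos (hankelAngle / 2))⁻¹ with hK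
  have hKpos : 0 < K := by positivity
  set J := ∫ x in Set.Ioi (0 : ℝ), Real.exp (-(1 / 4) * x)
  have hJ : 0 ≤ J := integral_nonneg fun x => (Real.exp_pos _).le
  refine ⟨K * (2 * J) + K * |hankelAngle - -hankelAngle|, by positivity, fun s hs => ?_⟩
  have hs' := Real.rpow_pos_of_pos hs (-(3 / 4 : ℝ))
  have hes := Real.exp_pos s
  have h1 : ‖∫ x in Set.Ioi (0 : ℝ), (hankelIntegrand ψ s (x + hankelAngle * Complex.I) -
      hankelIntegrand ψ s (x - hankelAngle * Complex.I))‖ ≤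
      K * (2 * J) * s ^ (-(3 / 4 : ℝ)) := by
    have : K * (2 * J) * s ^ (-(3 / 4 : ℝ)) = ∫ x in Set.Ioi (0 : ℝ),
        2 * K * s ^ (-(3 / 4 : ℝ)) * Real.exp (-(1 / 4) * x) := by
      rw [integral_const_mul]; ring
    rw [this]
    refine norm_integral_le_of_norm_le (integrableOn_exp_quarter.const_mul _) ?_
    refine (ae_restrict_iff' measurableSet_Ioi).mpr (Eventually.of_forall fun x hx => ?_)
    refine (norm_sub_le _ _).trans ?_
    have h2 := hψ.norm_hankelIntegrand_add_le hs (le_of_lt hx)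
    have h3 := hψ.norm_hankelIntegrand_sub_le hs (le_of_lt hx)
    rw [← hK] at h2 h3
    linarith
  have h2 : ‖∫ y in (-hankelAngle)..hankelAngle,
      hankelIntegrand ψ s ((0 : ℝ) + y * Complex.I)‖ ≤
      K * Real.exp s * |hankelAngle - -hankelAngle| := by
    refine intervalIntegral.norm_integral_le_of_norm_le_const fun y hy => ?_
    rw [Set.uIoc_of_le (by linarith)] at hy
    exact hψ.norm_hankelIntegrand_arc_le hs.le (abs_le.mpr ⟨hy.1.le, hy.2⟩)
  rw [stripContour]
  refine (norm_add_le _ _).trans ?_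
  rw [norm_mul, Complex.norm_I, one_mul]
  have h3 : 0 ≤ K * (2 * J) * Real.exp s := by positivity
  have h4 : 0 ≤ K * |hankelAngle - -hankelAngle| * s ^ (-(3 / 4 : ℝ)) := by positivity
  linarith

theorem continuousOn_stripContour (hψ : IsSymbol ψ) :
    ContinuousOn (fun s => stripContour hankelAngle 0 (hankelIntegrand ψ s)) (Set.Ioi 0) := by
  have hβ := hankelAngle_pos
  intro s₀ hs₀
  have hs₀' : (0 : ℝ) < s₀ := hs₀
  refine ContinuousAt.continuousWithinAt ?_
  refine ContinuousAt.add ?_ (continuousAt_const.mul ?_)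
  · refine continuousAt_of_dominated (bound := fun x => 2 * (5 * (Real.cos (hankelAngle / 2))⁻¹) *
      (s₀ / 2) ^ (-(3 / 4 : ℝ)) * Real.exp (-(1 / 4) * x)) ?_ ?_ ?_ ?_
    · refine Eventually.of_forall fun s => ?_
      exact ((hψ.continuous_hankelIntegrand_add.comp (by fun_prop : Continuous fun x : ℝ =>
        (s, x))).sub (hψ.continuous_hankelIntegrand_sub.comp (by fun_prop : Continuous fun x : ℝ =>
        (s, x)))).aestronglyMeasurable
    · filter_upwards [lt_mem_nhds (half_lt_self hs₀')] with s hs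
      refine (ae_restrict_iff' measurableSet_Ioi).mpr (Eventually.of_forall fun x hx => ?_)
      refine (norm_sub_le _ _).trans ?_
      have hspos : 0 < s := by linarith
      have h2 := hψ.norm_hankelIntegrand_add_le hspos (le_of_lt hx)
      have h3 := hψ.norm_hankelIntegrand_sub_le hspos (le_of_lt hx)
      have h4 : s ^ (-(3 / 4 : ℝ)) ≤ (s₀ / 2) ^ (-(3 / 4 : ℝ)) :=
        Real.rpow_le_rpow_of_nonpos (by positivity) hs.le (by norm_num)
      have hκ := cos_half_hankelAngle_pos
      calc _ ≤ 2 * (5 * (Real.cos (hankelAngle / 2))⁻¹) *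
            s ^ (-(3 / 4 : ℝ)) * Real.exp (-(1 / 4) * x) := by linarith
        _ ≤ _ := by gcongr
    · exact integrableOn_exp_quarter.const_mul _
    · refine Eventually.of_forall fun x => Continuous.continuousAt ?_
      exact (hψ.continuous_hankelIntegrand_add.comp (by fun_prop : Continuous fun s : ℝ =>
        (s, x))).sub (hψ.continuous_hankelIntegrand_sub.comp (by fun_prop : Continuous fun s : ℝ =>
        (s, x)))
  · have : (fun s : ℝ => ∫ y in (-hankelAngle)..hankelAngle,
        hankelIntegrand ψ s ((0 : ℝ) + y * Complex.I)) = fun s : ℝ =>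
        ∫ y in (-hankelAngle)..hankelAngle, hankelIntegrand ψ s ((0 : ℝ) +
          (max (-hankelAngle) (min y hankelAngle) : ℝ) * Complex.I) := by
      ext s
      refine intervalIntegral.integral_congr_ae (Eventually.of_forall fun y hy => ?_)
      rw [Set.uIoc_of_le (by linarith)] at hy
      rw [clamp_eq hy]
    rw [this]
    exact (intervalIntegral.continuous_parametric_intervalIntegral_of_continuous'
      hψ.continuous_hankelIntegrand_arc _ _).continuousAt

theorem continuousOn_levyTail (hψ : IsSymbol ψ) : ContinuousOn (levyTail ψ) (Set.Ioi 0) :=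
  Complex.continuous_im.comp_continuousOn hψ.continuousOn_stripContour

theorem integrableOn_levyTail (hψ : IsSymbol ψ) {t : ℝ} (ht : 0 ≤ t) :
    IntegrableOn (levyTail ψ) (Set.Ioc 0 t) := by
  obtain ⟨C, hC, h⟩ := hψ.exists_norm_stripContour_le
  have h1 : IntegrableOn (fun s : ℝ => s ^ (-(3 / 4 : ℝ))) (Set.Ioc 0 t) :=
    (intervalIntegrable_iff_integrableOn_Ioc_of_le ht).mp
      (intervalIntegral.intervalIntegrable_rpow' (by norm_num))
  have h2 : IntegrableOn (fun s : ℝ => Real.exp s) (Set.Ioc 0 t) :=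
    (Real.continuous_exp.integrableOn_Icc).mono_set Set.Ioc_subset_Icc_self
  refine ((h1.add h2).const_mul C).mono' ?_ ?_
  · exact ((hψ.continuousOn_levyTail).mono fun x hx => hx.1).aestronglyMeasurable measurableSet_Ioc
  · refine (ae_restrict_iff' measurableSet_Ioc).mpr (Eventually.of_forall fun s hs => ?_)
    exact (Complex.abs_im_le_norm _).trans (h s hs.1)

theorem stripContour_sub {β c : ℝ} {F G : ℂ → ℂ} (hβ : 0 ≤ β)
    (hF1 : IntegrableOn (fun x : ℝ => F (x + β * Complex.I) - F (x - β * Complex.I)) (Set.Ioi c))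
    (hG1 : IntegrableOn (fun x : ℝ => G (x + β * Complex.I) - G (x - β * Complex.I)) (Set.Ioi c))
    (hF3 : ContinuousOn F {ζ | |ζ.im| ≤ β}) (hG3 : ContinuousOn G {ζ | |ζ.im| ≤ β}) :
    stripContour β c (fun ζ => F ζ - G ζ) = stripContour β c F - stripContour β c G := by
  have hi : ∀ H : ℂ → ℂ, ContinuousOn H {ζ | |ζ.im| ≤ β} →
      IntervalIntegrable (fun y : ℝ => H (c + y * Complex.I)) volume (-β) β := by
    intro H hH
    refine ContinuousOn.intervalIntegrable (hH.comp (by fun_prop) fun y hy => ?_)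
    rw [Set.uIcc_of_le (by linarith)] at hy
    simpa using abs_le.mpr hy
  simp only [stripContour]
  rw [intervalIntegral.integral_sub (hi F hF3) (hi G hG3)]
  have : ∀ x : ℝ, F (x + β * Complex.I) - G (x + β * Complex.I) -
      (F (x - β * Complex.I) - G (x - β * Complex.I)) =
      (F (x + β * Complex.I) - F (x - β * Complex.I)) -
      (G (x + β * Complex.I) - G (x - β * Complex.I)) := fun x => by ring
  simp_rw [this]
  rw [integral_sub hF1 hG1]
  ring

theorem stripContour_const_mul (β c : ℝ) (a : ℂ) (F : ℂ → ℂ) :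
    stripContour β c (fun ζ => a * F ζ) = a * stripContour β c F := by
  simp only [stripContour, ← mul_sub]
  rw [integral_const_mul, intervalIntegral.integral_const_mul]
  ring

theorem abs_exp_neg_mul_le_one (hψ : IsSymbol ψ) {t : ℝ} (ht : 0 ≤ t) (v : ℝ) :
    |Real.exp (-t * ψ v)| ≤ 1 := by
  have := mul_nonneg ht (hψ.nonneg v)
  rw [abs_of_pos (Real.exp_pos _), Real.exp_le_one_iff]
  linarith

/-- The remainder of the truncated convolution, divided by the resolvent. -/
theorem remainder_properties (hψ : IsSymbol ψ) {t : ℝ} (ht : 0 < t) :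
    ∃ F : ℂ → ℂ, (∀ ζ, F ζ = weightedResolvent ψ (fun v => Real.exp (-t * ψ v)) (Complex.exp ζ) /
      weightedResolvent ψ (fun _ => 1) (Complex.exp ζ)) ∧
    DifferentiableOn ℂ F {ζ | |ζ.im| ≤ hankelAngle} ∧
    ∃ C : ℝ, ∀ x y : ℝ, 0 ≤ x → |y| ≤ hankelAngle →
      ‖F (x + y * Complex.I)‖ ≤ C * Real.exp (-(1 / 2) * x) := by
  have hc := hψ.continuous
  have hκ := cos_half_hankelAngle_pos
  refine ⟨_, fun ζ => rfl, ?_, ?_⟩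
  · exact DifferentiableOn.div (hψ.differentiableOn_resolvent_exp (by fun_prop)
      (hψ.abs_exp_neg_mul_le_one ht.le))
      (hψ.differentiableOn_resolvent_exp continuous_const (by simp))
      fun _ hζ => hψ.resolvent_exp_ne_zero hζ
  -- The weight `exp(-tψ)` is integrable by itself, so the numerator is `O(1/|z|)`; against `1/G =
  -- O(|z|^(1/2))` this leaves the decay `exp(-x/2)`.
  · set J := ∫ v, Real.exp (-t * ψ v) with hJ
    have hJ0 : 0 ≤ J := integral_nonneg fun v => (Real.exp_pos _).le
    refine ⟨(Real.cos (hankelAngle / 2))⁻¹ * J *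
      (5 / 2 * (Real.cos (hankelAngle / 2))⁻¹), fun x y hx hy => ?_⟩
    have h1 := hψ.norm_inv_resolvent_exp_le hx hy
    have him : (x + y * Complex.I : ℂ).im = y := by simp
    have hlt : |(x + y * Complex.I : ℂ).im| < Real.pi := by
      rw [him]; exact hy.trans_lt hankelAngle_lt
    have h2 : ‖weightedResolvent ψ (fun v => Real.exp (-t * ψ v))
        (Complex.exp (x + y * Complex.I))‖ ≤
        (Real.cos (hankelAngle / 2))⁻¹ * J * Real.exp (-x) := by
      have : (Real.cos (hankelAngle / 2))⁻¹ * J * Real.exp (-x) =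
          ∫ v, (Real.cos (hankelAngle / 2))⁻¹ * Real.exp (-x) * Real.exp (-t * ψ v) := by
        rw [integral_const_mul]; ring
      rw [this]
      refine norm_integral_le_of_norm_le ((hψ.integrable_exp ht).const_mul _)
        (Eventually.of_forall fun v => ?_)
      have h3 := cos_half_arg_mul_le (Complex.exp (x + y * Complex.I)) (ψ v)
      rw [arg_exp_eq_im hlt, him, norm_exp_add_mul_I] at h3
      have h4 := cos_half_hankelAngle_le hy
      have h0 := hψ.nonneg v
      rw [norm_div, Complex.norm_real, Real.norm_of_nonneg (Real.exp_pos _).le, div_eq_inv_mul]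
      have h5 : (Real.cos (hankelAngle / 2))⁻¹ * Real.exp (-x) =
          (Real.cos (hankelAngle / 2) * Real.exp x)⁻¹ := by
        rw [mul_inv, Real.exp_neg]
      rw [h5]
      have hex := Real.exp_pos x
      gcongr
      calc Real.cos (hankelAngle / 2) * Real.exp x ≤ Real.cos (y / 2) * (Real.exp x + ψ v) := by
            have := hκ.le.trans h4
            gcongr
            linarith
        _ ≤ _ := h3
    rw [div_eq_mul_inv, norm_mul]
    calc _ ≤ ((Real.cos (hankelAngle / 2))⁻¹ * J * Real.exp (-x)) *
          (5 / 2 * (Real.cos (hankelAngle / 2))⁻¹ * Real.exp (x / 2)) := by gcongr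
      _ = (Real.cos (hankelAngle / 2))⁻¹ * J * (5 / 2 * (Real.cos (hankelAngle / 2))⁻¹) *
          (Real.exp (-x) * Real.exp (x / 2)) := by ring
      _ = _ := by rw [← Real.exp_add]; ring_nf

theorem integrableOn_exp_exp_sub {t : ℝ} (ht : 0 < t) :
    IntegrableOn (fun x : ℝ => Complex.exp (t * Complex.exp (x + hankelAngle * Complex.I)) -
      Complex.exp (t * Complex.exp (x - hankelAngle * Complex.I))) (Set.Ioi 0) := by
  have hk : 0 < t * (Real.sqrt 2 / 2) := by positivity
  have hb : ∀ x y : ℝ, Real.cos y = -(Real.sqrt 2 / 2) →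
      ‖Complex.exp (t * Complex.exp (x + y * Complex.I))‖ ≤
        Real.exp (-(t * (Real.sqrt 2 / 2)) * x) := by
    intro x y hy
    rw [norm_exp_mul_exp, hy]
    refine Real.exp_le_exp.mpr ?_
    have := Real.add_one_le_exp x
    nlinarith
  have hi : ∀ y : ℝ, Real.cos y = -(Real.sqrt 2 / 2) → IntegrableOn
      (fun x : ℝ => Complex.exp (t * Complex.exp (x + y * Complex.I))) (Set.Ioi 0) :=
    fun y hy => (exp_neg_integrableOn_Ioi 0 hk).mono'
      (Continuous.aestronglyMeasurable (by fun_prop)) (Eventually.of_forall fun x => hb x y hy)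
  refine (hi _ cos_hankelAngle).sub ?_
  have := hi (-hankelAngle) (by rw [Real.cos_neg, cos_hankelAngle])
  simpa [← sub_eq_add_neg] using this

/-- The return density and the Lévy tail are inverse to each other under convolution. -/
theorem integral_returnDensity_mul_levyTail (hψ : IsSymbol ψ) {t : ℝ} (ht : 0 < t) :
    ∫ s in (0 : ℝ)..t, returnDensity ψ (t - s) * levyTail ψ s = 1 := by
  have hβ := hankelAngle_pos
  have hm := hψ.measurable_returnDensity
  have hκ := cos_half_hankelAngle_pos
  set μ := volume.restrict (Set.Ioc (0 : ℝ) t) with hμ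
  have hae : ∀ (ν : Measure ℝ) [SFinite ν] (S : Set ℝ), MeasurableSet S →
      ∀ᵐ p : ℝ × ℝ ∂(μ.prod (ν.restrict S)), p.1 ∈ Set.Ioc 0 t ∧ p.2 ∈ S := by
    intro ν _ S hS
    filter_upwards [Measure.quasiMeasurePreserving_fst.ae (ae_restrict_mem measurableSet_Ioc),
      Measure.quasiMeasurePreserving_snd.ae (ae_restrict_mem hS)] with p h1 h2
    exact ⟨h1, h2⟩
  have hdom : Integrable (fun p : ℝ × ℝ => returnDensity ψ (t - p.1) * p.1 ^ (-(3 / 4 : ℝ)) *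
      Real.exp (-(1 / 4) * p.2)) (μ.prod (volume.restrict (Set.Ioi 0))) :=
    Integrable.mul_prod (hψ.integrableOn_returnDensity_mul_rpow ht) integrableOn_exp_quarter
  have hq : Measurable fun p : ℝ × ℝ => (returnDensity ψ (t - p.1) : ℂ) := by fun_prop
  have h1 : Integrable (fun p : ℝ × ℝ => (returnDensity ψ (t - p.1) : ℂ) *
      hankelIntegrand ψ p.1 (p.2 + hankelAngle * Complex.I))
      (μ.prod (volume.restrict (Set.Ioi 0))) := by
    refine (hdom.const_mul (5 * (Real.cos (hankelAngle / 2))⁻¹)).mono'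
      (hq.aestronglyMeasurable.mul hψ.continuous_hankelIntegrand_add.aestronglyMeasurable) ?_
    filter_upwards [hae volume _ measurableSet_Ioi] with p hp
    rw [norm_mul, Complex.norm_real, Real.norm_of_nonneg (returnDensity_nonneg _ _)]
    refine (mul_le_mul_of_nonneg_left (hψ.norm_hankelIntegrand_add_le hp.1.1 (le_of_lt hp.2))
      (returnDensity_nonneg _ _)).trans (le_of_eq (by ring))
  have h2 : Integrable (fun p : ℝ × ℝ => (returnDensity ψ (t - p.1) : ℂ) *
      hankelIntegrand ψ p.1 (p.2 - hankelAngle * Complex.I))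
      (μ.prod (volume.restrict (Set.Ioi 0))) := by
    refine (hdom.const_mul (5 * (Real.cos (hankelAngle / 2))⁻¹)).mono'
      (hq.aestronglyMeasurable.mul hψ.continuous_hankelIntegrand_sub.aestronglyMeasurable) ?_
    filter_upwards [hae volume _ measurableSet_Ioi] with p hp
    rw [norm_mul, Complex.norm_real, Real.norm_of_nonneg (returnDensity_nonneg _ _)]
    refine (mul_le_mul_of_nonneg_left (hψ.norm_hankelIntegrand_sub_le hp.1.1 (le_of_lt hp.2))
      (returnDensity_nonneg _ _)).trans (le_of_eq (by ring))
  have hq1 : IntegrableOn (fun s => returnDensity ψ (t - s)) (Set.Ioc 0 t) :=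
    (intervalIntegrable_iff_integrableOn_Ioc_of_le ht.le).mp
      (hψ.intervalIntegrable_returnDensity_sub ht.le)
  have h3 : Integrable (fun p : ℝ × ℝ => (returnDensity ψ (t - p.1) : ℂ) *
      hankelIntegrand ψ p.1 ((0 : ℝ) + p.2 * Complex.I))
      (μ.prod (volume.restrict (Set.Ioc (-hankelAngle) hankelAngle))) := by
    have hd : Integrable (fun p : ℝ × ℝ => returnDensity ψ (t - p.1) *
        (5 * (Real.cos (hankelAngle / 2))⁻¹ * Real.exp t))
        (μ.prod (volume.restrict (Set.Ioc (-hankelAngle) hankelAngle))) :=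
      Integrable.mul_prod hq1 (integrable_const _)
    refine hd.mono' ?_ ?_
    · refine AEStronglyMeasurable.congr (hq.aestronglyMeasurable.mul
        hψ.continuous_hankelIntegrand_arc.aestronglyMeasurable) ?_
      filter_upwards [hae volume _ measurableSet_Ioc] with p hp
      simp only [Pi.mul_apply]
      rw [clamp_eq hp.2]
    · filter_upwards [hae volume _ measurableSet_Ioc] with p hp
      rw [norm_mul, Complex.norm_real, Real.norm_of_nonneg (returnDensity_nonneg _ _)]
      refine mul_le_mul_of_nonneg_left ?_ (returnDensity_nonneg _ _)
      refine (hψ.norm_hankelIntegrand_arc_le hp.1.1.le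
        (abs_le.mpr ⟨hp.2.1.le, hp.2.2⟩)).trans ?_
      have := hp.1.2
      gcongr
  obtain ⟨hint, hswap⟩ := stripContour_integral (μ := μ) (c := 0) (β := hankelAngle)
    (F := fun s ζ => (returnDensity ψ (t - s) : ℂ) * hankelIntegrand ψ s ζ) hβ.le h1 h2 h3
  obtain ⟨R, hR, hRd, C, hRb⟩ := hψ.remainder_properties ht
  have hEhat : stripContour hankelAngle 0 (fun ζ => ∫ s, (returnDensity ψ (t - s) : ℂ) *
      hankelIntegrand ψ s ζ ∂μ) = stripContour hankelAngle 0 (fun ζ =>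
      ((2 * Real.pi)⁻¹ : ℂ) * (Complex.exp (t * Complex.exp ζ) - R ζ)) := by
    -- The truncated convolution of `q` with `exp(sz)` is `(2π)⁻¹ (exp(tz) G(z) - R_t(z))`; dividing
    -- by `G` frees the exponential from the resolvent.
    have key : ∀ ζ : ℂ, |ζ.im| ≤ hankelAngle → ∫ s, (returnDensity ψ (t - s) : ℂ) *
        hankelIntegrand ψ s ζ ∂μ =
        ((2 * Real.pi)⁻¹ : ℂ) * (Complex.exp (t * Complex.exp ζ) - R ζ) := by
      intro ζ hζ
      have hne := hψ.resolvent_exp_ne_zero hζ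
      have h4 := hψ.integral_returnDensity_mul_exp ht
        (exp_mem_slitPlane (lt_of_le_of_lt hζ hankelAngle_lt))
      rw [intervalIntegral.integral_of_le ht.le] at h4
      simp_rw [hankelIntegrand_eq, ← mul_assoc]
      rw [integral_mul_const, h4, hR]
      have hπ : (Real.pi : ℂ) ≠ 0 := by exact_mod_cast Real.pi_ne_zero
      push_cast
      field_simp
    simp only [stripContour]
    congr 1
    · congr 1; ext x
      rw [key _ (by simp [abs_of_nonneg hβ.le]), key _ (by simp [abs_of_nonneg hβ.le])]
    · congr 1
      refine intervalIntegral.integral_congr_ae (Eventually.of_forall fun y hy => ?_)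
      rw [Set.uIoc_of_le (by linarith)] at hy
      exact key _ (by simpa using abs_le.mpr ⟨hy.1.le, hy.2⟩)
  have hRint : IntegrableOn (fun x : ℝ => R (x + hankelAngle * Complex.I) -
      R (x - hankelAngle * Complex.I)) (Set.Ioi 0) := by
    refine (strip_integrable (by norm_num) hRd.continuousOn hRb (abs_of_nonneg hβ.le).le).sub ?_
    have := strip_integrable (by norm_num) hRd.continuousOn hRb (y := -hankelAngle)
      (by rw [abs_neg, abs_of_nonneg hβ.le])
    simpa [← sub_eq_add_neg] using this
  -- The exponential integrates to `2πi` over the contour, and the remainder, holomorphic and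
  -- decaying on the half strip, integrates to zero.
  rw [hEhat, stripContour_const_mul, stripContour_sub hβ.le (integrableOn_exp_exp_sub ht) hRint
    (Continuous.continuousOn (by fun_prop)) hRd.continuousOn,
    stripContour_exp ht (by unfold hankelAngle; have := Real.pi_pos; linarith) hankelAngle_lt,
    stripContour_eq_zero hβ.le (by norm_num) hRd hRb, sub_zero] at hswap
  have hπ : (Real.pi : ℂ) ≠ 0 := by exact_mod_cast Real.pi_ne_zero
  have hI : ((2 * Real.pi)⁻¹ : ℂ) * (2 * Real.pi * Complex.I) = Complex.I := by field_simp
  rw [hI] at hswap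
  simp_rw [stripContour_const_mul] at hswap hint
  have him := congrArg Complex.im hswap
  rw [Complex.I_im] at him
  rw [intervalIntegral.integral_of_le ht.le, ← him]
  have h5 := integral_im hint
  rw [show ∀ z : ℂ, RCLike.im z = z.im from fun _ => rfl] at h5
  rw [← h5]
  refine integral_congr_ae (Eventually.of_forall fun s => ?_)
  simp [levyTail]

end IsSymbol

/-! ### Shrinking the arc of the Hankel contour to the origin. -/

/-- The integrals over `(a, b]` equal `u b - u a ≤ u b`, a bound independent of `a`. -/
theorem integrableOn_Iic_of_hasDerivAt_nonneg {u u' : ℝ → ℝ} (hd : ∀ x, HasDerivAt u (u' x) x)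
    (h0 : ∀ x, 0 ≤ u' x) (hu : ∀ x, 0 ≤ u x) (b : ℝ) : IntegrableOn u' (Set.Iic b) := by
  have hi : ∀ a, a ≤ b → IntegrableOn u' (Set.Ioc a b) := fun a hab =>
    intervalIntegral.integrableOn_deriv_of_nonneg
      (fun x _ => (hd x).continuousAt.continuousWithinAt) (fun x _ => hd x) (fun x _ => h0 x)
  have hi' : ∀ a, IntegrableOn u' (Set.Ioc a b) := by
    intro a
    rcases le_total a b with h | h
    · exact hi a h
    · rw [Set.Ioc_eq_empty (by linarith)]; exact integrableOn_empty
  refine integrableOn_Iic_of_intervalIntegral_norm_bounded (u b) b (a := id) (l := atBot)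
    hi' tendsto_id ?_
  filter_upwards [eventually_le_atBot b] with a ha
  simp_rw [Real.norm_of_nonneg (h0 _), id]
  rw [intervalIntegral.integral_eq_sub_of_hasDerivAt (fun x _ => hd x)
    ((intervalIntegrable_iff_integrableOn_Ioc_of_le ha).mpr (hi a ha))]
  linarith [hu a]

namespace IsSymbol

variable {ψ : ℝ → ℝ}

theorem integrable_inv_sq (hψ : IsSymbol ψ) {r : ℝ} (hr : 0 < r) :
    Integrable (fun v => 1 / (r + ψ v) ^ 2) := by
  have hc := hψ.continuous
  refine ((hψ.integrable_inv hr).const_mul (1 / r)).mono'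
    (Continuous.aestronglyMeasurable (continuous_const.div (by fun_prop)
      fun v => by have := hψ.nonneg v; positivity)) (Eventually.of_forall fun v => ?_)
  have h0 := hψ.nonneg v
  rw [Real.norm_of_nonneg (by positivity), one_div_mul_one_div]
  refine one_div_le_one_div_of_le (by positivity) ?_
  rw [sq]
  gcongr
  linarith

theorem hasDerivAt_realResolvent (hψ : IsSymbol ψ) {r : ℝ} (hr : 0 < r) :
    HasDerivAt (realResolvent ψ) (-∫ v, 1 / (r + ψ v) ^ 2) r := by
  have h := hψ.hasDerivAt_weightedResolvent (ρ := fun _ => 1) continuous_const (by simp)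
    (z := (r : ℂ)) (Complex.ofReal_mem_slitPlane.mpr hr)
  have h2 := h.real_of_complex
  have h3 : (∫ v, -((1 : ℝ) : ℂ) / ((r : ℂ) + ψ v) ^ 2) =
      ((-∫ v, 1 / (r + ψ v) ^ 2 : ℝ) : ℂ) := by
    rw [← integral_neg, ← integral_complex_ofReal]
    congr 1; ext v; push_cast; ring
  rw [h3, Complex.ofReal_re] at h2
  refine h2.congr_of_eventuallyEq (Eventually.of_forall fun x => ?_)
  simp only [weightedResolvent_one_ofReal, Complex.ofReal_re]

/-- The integrand is the derivative of `x ↦ 1 / G(exp x)`, which is increasing and nonnegative. This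
needs no information on the behaviour of `G` at zero, so it serves both cases of the theorem. -/
theorem integrableOn_inv_sq_div (hψ : IsSymbol ψ) : IntegrableOn (fun x : ℝ =>
    Real.exp x * (∫ v, 1 / (Real.exp x + ψ v) ^ 2) / realResolvent ψ (Real.exp x) ^ 2)
    (Set.Iic 0) := by
  refine integrableOn_Iic_of_hasDerivAt_nonneg (u := fun x => (realResolvent ψ (Real.exp x))⁻¹)
    (fun x => ?_) (fun x => ?_) (fun x => ?_) 0
  · have h1 := (hψ.hasDerivAt_realResolvent (Real.exp_pos x)).comp x (Real.hasDerivAt_exp x)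
    have h2 := h1.inv (hψ.realResolvent_pos (Real.exp_pos x)).ne'
    refine h2.congr_deriv ?_
    simp only [Function.comp]
    ring
  · have : 0 ≤ ∫ v, 1 / (Real.exp x + ψ v) ^ 2 := integral_nonneg fun v => by
      simp only [Pi.zero_apply]; positivity
    have := Real.exp_pos x
    positivity
  · exact inv_nonneg.mpr (hψ.realResolvent_pos (Real.exp_pos x)).le

theorem abs_im_exp_le (x y : ℝ) : |(Complex.exp (x + y * Complex.I)).im| ≤
    Real.exp x := by
  refine (Complex.abs_im_le_norm _).trans (norm_exp_add_mul_I x y).le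

/-- Since `ψ` is real, `Im 1/(z + ψ) = -Im z / |z + ψ|²`. The imaginary part of `G(z)` is thus
controlled by `-r G'(r)` at `r = |z|`. -/
theorem abs_im_resolvent_le (hψ : IsSymbol ψ) {x y : ℝ} (hy : |y| ≤ hankelAngle) :
    |(weightedResolvent ψ (fun _ => 1) (Complex.exp (x + y * Complex.I))).im| ≤
      (Real.cos (hankelAngle / 2))⁻¹ ^ 2 * (Real.exp x * ∫ v, 1 / (Real.exp x + ψ v) ^ 2) := by
  have hκ := cos_half_hankelAngle_pos
  have him : (x + y * Complex.I : ℂ).im = y := by simp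
  have hlt : |(x + y * Complex.I : ℂ).im| < Real.pi := by
    rw [him]; exact hy.trans_lt hankelAngle_lt
  set z := Complex.exp (x + y * Complex.I) with hz
  have hzs := exp_mem_slitPlane hlt
  have hint := hψ.integrable_weighted (ρ := fun _ => 1) continuous_const (by simp) hzs
  rw [weightedResolvent, ← mul_assoc, ← integral_const_mul]
  have h1 : (∫ v, ((1 : ℝ) : ℂ) / (z + ψ v)).im = ∫ v, (((1 : ℝ) : ℂ) / (z + ψ v)).im :=
    (integral_im hint).symm
  rw [h1]
  rw [← Real.norm_eq_abs]
  refine norm_integral_le_of_norm_le (((hψ.integrable_inv_sq (Real.exp_pos x)).const_mul _))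
    (Eventually.of_forall fun v => ?_)
  have h0 := hψ.nonneg v
  have hex := Real.exp_pos x
  have h2 := cos_half_arg_mul_le z (ψ v)
  rw [hz, arg_exp_eq_im hlt, him, norm_exp_add_mul_I, ← hz] at h2
  have h3 := cos_half_hankelAngle_le hy
  have h4 : Real.cos (hankelAngle / 2) * (Real.exp x + ψ v) ≤ ‖z + ψ v‖ :=
    le_trans (by gcongr) h2
  rw [Complex.ofReal_one, one_div, Complex.inv_im, Complex.normSq_eq_norm_sq, Real.norm_eq_abs,
    abs_div, abs_neg, abs_of_nonneg (sq_nonneg ‖z + ψ v‖)]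
  have h5 : (z + ψ v).im = z.im := by simp
  rw [h5]
  have h6 : |z.im| ≤ Real.exp x := abs_im_exp_le x y
  calc |z.im| / ‖z + ψ v‖ ^ 2
      ≤ Real.exp x / (Real.cos (hankelAngle / 2) * (Real.exp x + ψ v)) ^ 2 := by gcongr
    _ = _ := by field_simp

theorem resolvent_exp_ge (hψ : IsSymbol ψ) {x y : ℝ} (hy : |y| ≤ hankelAngle) :
    Real.cos (hankelAngle / 2) * realResolvent ψ (Real.exp x) ≤
      ‖weightedResolvent ψ (fun _ => 1) (Complex.exp (x + y * Complex.I))‖ := by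
  have him : (x + y * Complex.I : ℂ).im = y := by simp
  have hlt : |(x + y * Complex.I : ℂ).im| < Real.pi := by
    rw [him]; exact hy.trans_lt hankelAngle_lt
  have h1 := hψ.norm_resolvent_ge (exp_mem_slitPlane hlt)
  rw [arg_exp_eq_im hlt, him, norm_exp_add_mul_I] at h1
  refine le_trans ?_ h1
  have := hψ.realResolvent_pos (Real.exp_pos x)
  have := cos_half_hankelAngle_le hy
  gcongr

/-- As `x → -∞` the integrand itself may tend to the nonzero value `1 / G(0)`, so only its imaginary
part can be integrable. That part splits in two: `Im exp(tz)` is `O(exp x)`, and `Im G / |G|²` is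
bounded by a multiple of the derivative of `1 / G(exp x)`. -/
theorem integrable_im_hankelIntegrand (hψ : IsSymbol ψ) {t : ℝ} (ht : 0 < t) :
    Integrable (fun x : ℝ => (hankelIntegrand ψ t (x + hankelAngle * Complex.I)).im) := by
  have hβ := hankelAngle_pos
  have hκ := cos_half_hankelAngle_pos
  rw [← integrableOn_univ, ← Set.Iic_union_Ioi (a := (0 : ℝ)), integrableOn_union]
  refine ⟨?_, (hψ.integrableOn_hankelIntegrand_add ht).im⟩
  have hy : |hankelAngle| ≤ hankelAngle := (abs_of_pos hβ).le
  set κ := Real.cos (hankelAngle / 2)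
  have hg1 := hψ.realResolvent_pos one_pos
  have hd : IntegrableOn (fun x : ℝ => t * (κ * realResolvent ψ 1)⁻¹ * Real.exp x + κ⁻¹ ^ 4 *
    (Real.exp x * (∫ v, 1 / (Real.exp x + ψ v) ^ 2) / realResolvent ψ (Real.exp x) ^ 2))
    (Set.Iic 0) :=
    ((integrableOn_exp_Iic 0).const_mul _).add (hψ.integrableOn_inv_sq_div.const_mul _)
  refine hd.mono' ?_ ((ae_restrict_iff' measurableSet_Iic).mpr (Eventually.of_forall
    fun x hx => ?_))
  · exact (Complex.continuous_im.comp (hψ.continuous_hankelIntegrand_add.comp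
      (by fun_prop : Continuous fun x : ℝ => (t, x)))).aestronglyMeasurable
  set a := Complex.exp (t * Complex.exp (x + hankelAngle * Complex.I)) with ha
  set G := weightedResolvent ψ (fun _ => 1) (Complex.exp (x + hankelAngle * Complex.I)) with hG
  have hGpos : κ * realResolvent ψ (Real.exp x) ≤ ‖G‖ := hψ.resolvent_exp_ge hy
  have hgx := hψ.realResolvent_pos (Real.exp_pos x)
  have hgx1 : realResolvent ψ 1 ≤ realResolvent ψ (Real.exp x) :=
    hψ.realResolvent_antitone (Real.exp_pos x) (Real.exp_le_one_iff.mpr hx)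
  have hG0 : 0 < ‖G‖ := lt_of_lt_of_le (by positivity) hGpos
  have hna : ‖a‖ ≤ 1 := by
    rw [ha, norm_exp_mul_exp, Real.exp_le_one_iff, cos_hankelAngle]
    have : 0 ≤ t * (Real.exp x * (Real.sqrt 2 / 2)) := by positivity
    linarith
  have hare : |a.re| ≤ 1 := (Complex.abs_re_le_norm a).trans hna
  have haim : |a.im| ≤ t * Real.exp x := by
    have h1 : a.im = ‖a‖ * Real.sin (t * Complex.exp (x + hankelAngle * Complex.I)).im := by
      rw [ha, Complex.exp_im, Complex.norm_exp]
    rw [h1, abs_mul, abs_norm]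
    calc _ ≤ 1 * |(t * Complex.exp (x + hankelAngle * Complex.I)).im| := by
          exact mul_le_mul hna Real.abs_sin_le_abs (abs_nonneg _) zero_le_one
      _ ≤ _ := by
        rw [one_mul, Complex.im_ofReal_mul, abs_mul, abs_of_pos ht]
        gcongr
        exact abs_im_exp_le x _
  have h1 : (hankelIntegrand ψ t (x + hankelAngle * Complex.I)).im =
      (a.im * G.re - a.re * G.im) / ‖G‖ ^ 2 := by
    rw [hankelIntegrand, ← ha, ← hG, Complex.div_im, Complex.normSq_eq_norm_sq]; ring
  rw [h1, Real.norm_eq_abs, abs_div, abs_of_nonneg (sq_nonneg ‖G‖)]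
  have hGim := hψ.abs_im_resolvent_le (x := x) hy
  rw [← hG] at hGim
  have hGre := Complex.abs_re_le_norm G
  have h2 : |a.im * G.re - a.re * G.im| ≤ t * Real.exp x * ‖G‖ + κ⁻¹ ^ 2 *
      (Real.exp x * ∫ v, 1 / (Real.exp x + ψ v) ^ 2) := by
    refine (abs_sub _ _).trans ?_
    rw [abs_mul, abs_mul]
    have : |a.re| * |G.im| ≤ 1 * (κ⁻¹ ^ 2 *
      (Real.exp x * ∫ v, 1 / (Real.exp x + ψ v) ^ 2)) := by gcongr
    have : |a.im| * |G.re| ≤ t * Real.exp x * ‖G‖ := by gcongr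
    linarith
  have hK0 : 0 ≤ ∫ v, 1 / (Real.exp x + ψ v) ^ 2 := integral_nonneg fun v => by
    simp only [Pi.zero_apply]; positivity
  have hex := Real.exp_pos x
  calc _ ≤ (t * Real.exp x * ‖G‖ + κ⁻¹ ^ 2 *
      (Real.exp x * ∫ v, 1 / (Real.exp x + ψ v) ^ 2)) / ‖G‖ ^ 2 := by gcongr
    _ = t * Real.exp x * ‖G‖⁻¹ + κ⁻¹ ^ 2 *
      (Real.exp x * ∫ v, 1 / (Real.exp x + ψ v) ^ 2) * (‖G‖ ^ 2)⁻¹ := by field_simp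
    _ ≤ t * Real.exp x * (κ * realResolvent ψ 1)⁻¹ + κ⁻¹ ^ 2 *
      (Real.exp x * ∫ v, 1 / (Real.exp x + ψ v) ^ 2) *
        ((κ * realResolvent ψ (Real.exp x)) ^ 2)⁻¹ := by
        gcongr
        exact le_trans (by gcongr) hGpos
    _ = _ := by field_simp

/-- Schwarz reflection: the values on the two rays are complex conjugates, so only imaginary parts
survive. -/
theorem hankelIntegrand_sub_eq (ψ : ℝ → ℝ) (t x : ℝ) :
    hankelIntegrand ψ t (x + hankelAngle * Complex.I) -
      hankelIntegrand ψ t (x - hankelAngle * Complex.I) =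
      2 * Complex.I * ((hankelIntegrand ψ t (x + hankelAngle * Complex.I)).im : ℂ) := by
  have h : hankelIntegrand ψ t (x - hankelAngle * Complex.I) =
      (starRingEnd ℂ) (hankelIntegrand ψ t (x + hankelAngle * Complex.I)) := by
    rw [hankelIntegrand, hankelIntegrand, map_div₀, ← Complex.exp_conj, ← conj_resolvent, map_mul,
      ← Complex.exp_conj]
    simp [← sub_eq_add_neg]
  rw [h, Complex.sub_conj]
  push_cast; ring

/-- Moving the arc of the Hankel contour to the origin. -/
theorem levyTail_eq_of_tendsto (hψ : IsSymbol ψ) {t : ℝ} (ht : 0 < t) {ℓ : ℝ}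
    (hℓ : Tendsto (fun c : ℝ => ∫ y in (-hankelAngle)..hankelAngle,
      hankelIntegrand ψ t (c + y * Complex.I)) atBot (𝓝 (ℓ : ℂ))) :
    levyTail ψ t = 2 * (∫ x : ℝ, (hankelIntegrand ψ t (x + hankelAngle * Complex.I)).im) + ℓ := by
  have hβ := hankelAngle_pos
  have hi := hψ.integrable_im_hankelIntegrand ht
  have hD : Integrable (fun x : ℝ => hankelIntegrand ψ t (x + hankelAngle * Complex.I) -
      hankelIntegrand ψ t (x - hankelAngle * Complex.I)) := by
    simp_rw [hankelIntegrand_sub_eq]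
    exact hi.ofReal.const_mul _
  have h1 : Tendsto (fun c : ℝ => stripContour hankelAngle c (hankelIntegrand ψ t)) atBot
      (𝓝 ((∫ x : ℝ, (hankelIntegrand ψ t (x + hankelAngle * Complex.I) -
      hankelIntegrand ψ t (x - hankelAngle * Complex.I))) + Complex.I * ℓ)) := by
    refine Tendsto.add ?_ (tendsto_const_nhds.mul hℓ)
    exact (aecover_Ioi tendsto_id).integral_tendsto_of_countably_generated hD
  have h2 : stripContour hankelAngle 0 (hankelIntegrand ψ t) =
      (∫ x : ℝ, (hankelIntegrand ψ t (x + hankelAngle * Complex.I) -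
      hankelIntegrand ψ t (x - hankelAngle * Complex.I))) + Complex.I * ℓ := by
    refine tendsto_nhds_unique (tendsto_const_nhds.congr' ?_) h1
    filter_upwards [eventually_le_atBot 0] with c hc
    exact (stripContour_shift hβ.le hc (hψ.differentiableOn_hankelIntegrand t)
      hD.integrableOn).symm
  rw [levyTail, h2]
  simp_rw [hankelIntegrand_sub_eq]
  rw [integral_const_mul, integral_complex_ofReal]
  simp

/-- On the shrinking arc `exp(tz) → 1`, so the limit is the opening angle `2 * hankelAngle` times
the limit of `1 / G`. Domination uses that `G` is decreasing on the positive axis. -/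
theorem tendsto_arc (hψ : IsSymbol ψ) {t : ℝ} (ht : 0 < t) {a : ℂ}
    (ha : ∀ y : ℝ, |y| ≤ hankelAngle → Tendsto (fun c : ℝ =>
      (weightedResolvent ψ (fun _ => 1) (Complex.exp (c + y * Complex.I)))⁻¹) atBot (𝓝 a)) :
    Tendsto (fun c : ℝ => ∫ y in (-hankelAngle)..hankelAngle,
      hankelIntegrand ψ t (c + y * Complex.I)) atBot (𝓝 (2 * hankelAngle * a)) := by
  have hβ := hankelAngle_pos
  have hκ := cos_half_hankelAngle_pos
  have h1 : (2 * hankelAngle * a) = ∫ y in (-hankelAngle)..hankelAngle, a := by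
    rw [intervalIntegral.integral_const, Complex.real_smul]; push_cast; ring
  have hmem : ∀ y ∈ Set.uIoc (-hankelAngle) hankelAngle, |y| ≤ hankelAngle := by
    intro y hy
    rw [Set.uIoc_of_le (by linarith)] at hy
    exact abs_le.mpr ⟨hy.1.le, hy.2⟩
  rw [h1]
  refine intervalIntegral.tendsto_integral_filter_of_dominated_convergence
    (fun _ => Real.exp t * (Real.cos (hankelAngle / 2) * realResolvent ψ 1)⁻¹) ?_ ?_ ?_ ?_
  · refine Eventually.of_forall fun c => ?_
    refine ContinuousOn.aestronglyMeasurable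
      ((hψ.differentiableOn_hankelIntegrand t).continuousOn.comp (by fun_prop) fun y hy => ?_)
      measurableSet_uIoc
    simpa using hmem y hy
  · filter_upwards [eventually_le_atBot 0] with c hc
    refine Eventually.of_forall fun y hy => ?_
    have hy' := hmem y hy
    rw [hankelIntegrand_eq, norm_mul, norm_exp_mul_exp, norm_inv]
    have h2 := hψ.resolvent_exp_ge (x := c) hy'
    have hgx1 : realResolvent ψ 1 ≤ realResolvent ψ (Real.exp c) :=
      hψ.realResolvent_antitone (Real.exp_pos c) (Real.exp_le_one_iff.mpr hc)
    have hg1 := hψ.realResolvent_pos one_pos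
    gcongr
    · refine mul_le_of_le_one_right ht.le ?_
      calc Real.exp c * Real.cos y ≤ Real.exp c * 1 := by gcongr; exact Real.cos_le_one y
        _ ≤ 1 := by rw [mul_one]; exact Real.exp_le_one_iff.mpr hc
    · exact le_trans (by gcongr) h2
  · simp
  · refine Eventually.of_forall fun y hy => ?_
    simp_rw [hankelIntegrand_eq]
    have h3 : Tendsto (fun c : ℝ => Complex.exp (t * Complex.exp (c + y * Complex.I))) atBot
        (𝓝 1) := by
      have h4 : Tendsto (fun c : ℝ => Complex.exp (c + y * Complex.I)) atBot (𝓝 0) := by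
        rw [tendsto_zero_iff_norm_tendsto_zero]
        simp_rw [norm_exp_add_mul_I]
        exact Real.tendsto_exp_atBot
      have h5 := (Complex.continuous_exp.tendsto _).comp (h4.const_mul (t : ℂ))
      simpa [Function.comp_def] using h5
    simpa using h3.mul (ha y (hmem y hy))

/-- The bound `|G(z)| ≥ cos(hankelAngle / 2) G(|z|)` transfers the divergence from the positive axis
to every direction of the sector. -/
theorem tendsto_arc_of_tendsto_atTop (hψ : IsSymbol ψ) {t : ℝ} (ht : 0 < t)
    (h : Tendsto (realResolvent ψ) (𝓝[>] 0) atTop) :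
    Tendsto (fun c : ℝ => ∫ y in (-hankelAngle)..hankelAngle,
      hankelIntegrand ψ t (c + y * Complex.I)) atBot (𝓝 ((0 : ℝ) : ℂ)) := by
  have hκ := cos_half_hankelAngle_pos
  have h1 := hψ.tendsto_arc ht (a := 0) fun y hy => by
    rw [tendsto_zero_iff_norm_tendsto_zero]
    have h2 : Tendsto (fun c : ℝ => (Real.cos (hankelAngle / 2) *
        realResolvent ψ (Real.exp c))⁻¹) atBot (𝓝 0) := by
      refine Tendsto.inv_tendsto_atTop (Tendsto.const_mul_atTop hκ (h.comp ?_))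
      exact Real.tendsto_exp_atBot_nhdsGT
    refine squeeze_zero (fun _ => norm_nonneg _) (fun c => ?_) h2
    rw [norm_inv]
    have := hψ.realResolvent_pos (Real.exp_pos c)
    exact inv_anti₀ (by positivity) (hψ.resolvent_exp_ge hy)
  simpa using h1

/-- Domination by `1/ψ` gives `G(z) → ∫ 1/ψ` in the sector, and twice the angle `3π/4` is the source
of `3π/2`. The almost everywhere condition excludes the points where `1 / ψ` takes the junk value
`0`. -/
theorem tendsto_arc_of_integrable (hψ : IsSymbol ψ) {t : ℝ} (ht : 0 < t)
    (hi : Integrable (fun v => 1 / ψ v)) (h0 : ∀ᵐ v, ψ v ≠ 0) :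
    Tendsto (fun c : ℝ => ∫ y in (-hankelAngle)..hankelAngle,
      hankelIntegrand ψ t (c + y * Complex.I)) atBot
      (𝓝 ((3 * Real.pi / (2 * ∫ v, 1 / ψ v) : ℝ) : ℂ)) := by
  have hκ := cos_half_hankelAngle_pos
  have hpos : 0 < ∫ v, 1 / ψ v := by
    have h1 := hψ.realResolvent_pos one_pos
    refine h1.trans_le (integral_mono_ae (hψ.integrable_inv one_pos) hi ?_)
    filter_upwards [h0] with v hv
    have := (hψ.nonneg v).lt_of_ne' hv
    gcongr
    linarith
  have h1 := hψ.tendsto_arc ht (a := ((∫ v, 1 / ψ v : ℝ) : ℂ)⁻¹) fun y hy => by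
    refine Tendsto.inv₀ ?_ (by exact_mod_cast hpos.ne')
    rw [← integral_complex_ofReal]
    have him : ∀ c : ℝ, (c + y * Complex.I : ℂ).im = y := by simp
    have hlt : ∀ c : ℝ, |(c + y * Complex.I : ℂ).im| < Real.pi := by
      intro c; rw [him]; exact hy.trans_lt hankelAngle_lt
    have hc := hψ.continuous
    refine tendsto_integral_filter_of_dominated_convergence
      (fun v => (Real.cos (hankelAngle / 2))⁻¹ * (1 / ψ v)) ?_ ?_ (hi.const_mul _) ?_
    · refine Eventually.of_forall fun c => ?_
      exact (Continuous.div (by fun_prop) (by fun_prop)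
        (hψ.add_ne_zero (exp_mem_slitPlane (hlt c)))).aestronglyMeasurable
    · refine Eventually.of_forall fun c => ?_
      filter_upwards [h0] with v hv
      have hv' := (hψ.nonneg v).lt_of_ne' hv
      have h2 := hψ.norm_weighted_le (ρ := fun _ => 1) (by simp) (exp_mem_slitPlane (hlt c)) v
      rw [arg_exp_eq_im (hlt c), him, norm_exp_add_mul_I] at h2
      refine h2.trans ?_
      have := cos_half_hankelAngle_le hy
      have := Real.exp_pos c
      gcongr
      linarith
    · filter_upwards [h0] with v hv
      have h4 : Tendsto (fun c : ℝ => Complex.exp (c + y * Complex.I)) atBot (𝓝 0) := by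
        rw [tendsto_zero_iff_norm_tendsto_zero]
        simp_rw [norm_exp_add_mul_I]
        exact Real.tendsto_exp_atBot
      have h5 := (h4.add_const (ψ v : ℂ))
      rw [zero_add] at h5
      have h6 := (tendsto_const_nhds (x := ((1 : ℝ) : ℂ))).div h5 (by exact_mod_cast hv)
      simpa [Pi.div_def] using h6
  convert h1 using 2
  have hne : ((∫ v, 1 / ψ v : ℝ) : ℂ) ≠ 0 := by exact_mod_cast hpos.ne'
  rw [hankelAngle]
  push_cast at hne ⊢
  field_simp
  norm_num

end IsSymbol

/-! ### The stable symbol and identification of the limiting constant. -/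

/-- The characteristic exponent of the difference of the two stable processes. -/
noncomputable def stableSymbol (α₁ α₂ v : ℝ) : ℝ := |v| ^ α₁ + |v| ^ α₂

theorem rpow_abs_le {α : ℝ} (hα : α ∈ Set.Ioc (0 : ℝ) 2) (v : ℝ) : |v| ^ α ≤ 1 + v ^ 2 := by
  rcases le_total |v| 1 with h | h
  · have := Real.rpow_le_one (abs_nonneg v) h hα.1.le
    nlinarith [sq_nonneg v]
  · have := Real.rpow_le_rpow_of_exponent_le h hα.2
    rw [Real.rpow_two, sq_abs] at this
    linarith

theorem inv_one_add_rpow_le {α : ℝ} (hα : 1 < α) (hα2 : α ≤ 2) (v : ℝ) :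
    1 / (1 + |v| ^ α) ≤ 2 * (1 + ‖v‖) ^ (-α) := by
  have h1 : (1 + |v|) ^ α ≤ 2 ^ (α - 1) * (1 + |v| ^ α) := by
    have := NNReal.coe_le_coe.mpr (NNReal.rpow_add_le_mul_rpow_add_rpow 1 ‖v‖₊ hα.le)
    push_cast at this
    simpa using this
  have h2 : (2 : ℝ) ^ (α - 1) ≤ 2 := by
    calc (2 : ℝ) ^ (α - 1) ≤ 2 ^ (1 : ℝ) :=
          Real.rpow_le_rpow_of_exponent_le (by norm_num) (by linarith)
      _ = 2 := Real.rpow_one 2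
  have h3 := Real.rpow_nonneg (abs_nonneg v) α
  have h4 : 0 < (1 + |v|) ^ α := Real.rpow_pos_of_pos (by positivity) _
  rw [Real.norm_eq_abs, Real.rpow_neg (by positivity), ← div_eq_mul_inv,
    div_le_div_iff₀ (by positivity) h4, one_mul]
  exact h1.trans (by gcongr)

theorem isSymbol_stableSymbol {α₁ α₂ : ℝ} (hα₁ : α₁ ∈ Set.Ioc (0 : ℝ) 2)
    (hα₂ : α₂ ∈ Set.Ioc (0 : ℝ) 2) (hmax : 1 < max α₁ α₂) : IsSymbol (stableSymbol α₁ α₂) := by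
  have hc : Continuous (stableSymbol α₁ α₂) :=
    (continuous_abs.rpow_const fun _ => Or.inr hα₁.1.le).add
      (continuous_abs.rpow_const fun _ => Or.inr hα₂.1.le)
  have hn : ∀ v, 0 ≤ stableSymbol α₁ α₂ v := fun v => by unfold stableSymbol; positivity
  refine ⟨hc, hn, ?_, fun v => ?_⟩
  · have hi : Integrable fun v : ℝ => 2 * (1 + ‖v‖) ^ (-(max α₁ α₂)) :=
      (integrable_one_add_norm (by simpa using hmax)).const_mul 2
    refine hi.mono' (continuous_const.div (by fun_prop)
      fun v => by have := hn v; positivity).aestronglyMeasurable (Eventually.of_forall fun v => ?_)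
    have h0 := hn v
    rw [Real.norm_of_nonneg (by positivity)]
    refine le_trans ?_ (inv_one_add_rpow_le hmax (max_le hα₁.2 hα₂.2) v)
    refine one_div_le_one_div_of_le (by positivity) (add_le_add_right ?_ 1)
    have h1 := Real.rpow_nonneg (abs_nonneg v) α₁
    have h2 := Real.rpow_nonneg (abs_nonneg v) α₂
    unfold stableSymbol
    rcases max_choice α₁ α₂ with h | h <;> rw [h] <;> linarith
  · have h1 := rpow_abs_le hα₁ v
    have h2 := rpow_abs_le hα₂ v
    unfold stableSymbol; linarith

theorem stableSymbol_pos (α₁ α₂ : ℝ) {v : ℝ} (hv : v ≠ 0) : 0 < stableSymbol α₁ α₂ v := by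
  have := abs_pos.mpr hv
  unfold stableSymbol; positivity

theorem integrableOn_abs_rpow {m : ℝ} (hm : m < 1) :
    IntegrableOn (fun v : ℝ => |v| ^ (-m)) (Set.Icc (-1) 1) := by
  have h1 : IntervalIntegrable (fun v : ℝ => |v| ^ (-m)) volume 0 1 := by
    refine (intervalIntegral.intervalIntegrable_rpow' (r := -m) (by linarith)).congr ?_
    intro v hv
    rw [Set.uIoc_of_le zero_le_one] at hv
    simp only [abs_of_pos hv.1]
  have h2 : IntervalIntegrable (fun v : ℝ => |v| ^ (-m)) volume (-1) 0 := by
    rw [IntervalIntegrable.iff_comp_neg]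
    simpa using h1.symm
  rw [integrableOn_Icc_iff_integrableOn_Ioc]
  exact (intervalIntegrable_iff_integrableOn_Ioc_of_le (by norm_num)).mp (h2.trans h1)

/-- The smaller index, below one, governs `|v| ≤ 1`. Outside, `ψ ≥ 1`, so `1/ψ ≤ 2/(1 + ψ)`, whose
integrability comes from the larger index. -/
theorem integrable_inv_stableSymbol {α₁ α₂ : ℝ} (hα₁ : α₁ ∈ Set.Ioc (0 : ℝ) 2)
    (hα₂ : α₂ ∈ Set.Ioc (0 : ℝ) 2) (hmax : 1 < max α₁ α₂) (hmin : min α₁ α₂ < 1) :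
    Integrable (fun v => 1 / stableSymbol α₁ α₂ v) := by
  have hψ := isSymbol_stableSymbol hα₁ hα₂ hmax
  have hc := hψ.continuous
  have h1 := (integrable_indicator_iff measurableSet_Icc).mpr (integrableOn_abs_rpow hmin)
  refine (h1.add (hψ.integrable.const_mul 2)).mono'
    (measurable_const.div hc.measurable).aestronglyMeasurable (Eventually.of_forall fun v => ?_)
  have h0 := hψ.nonneg v
  rw [Real.norm_of_nonneg (by positivity)]
  have h3 : 0 ≤ 2 * (1 / (1 + stableSymbol α₁ α₂ v)) := by positivity
  have hr1 := Real.rpow_nonneg (abs_nonneg v) α₁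
  have hr2 := Real.rpow_nonneg (abs_nonneg v) α₂
  by_cases hv : v ∈ Set.Icc (-1 : ℝ) 1
  · rw [Pi.add_apply, Set.indicator_of_mem hv]
    refine le_add_of_le_of_nonneg ?_ h3
    rcases eq_or_ne v 0 with rfl | hne
    · have : stableSymbol α₁ α₂ 0 = 0 := by
        simp [stableSymbol, Real.zero_rpow hα₁.1.ne', Real.zero_rpow hα₂.1.ne']
      rw [this, div_zero]; positivity
    · have hpos := abs_pos.mpr hne
      rw [Real.rpow_neg hpos.le, ← one_div]
      refine one_div_le_one_div_of_le (Real.rpow_pos_of_pos hpos _) ?_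
      unfold stableSymbol
      rcases min_choice α₁ α₂ with h | h <;> rw [h] <;> linarith
  · rw [Pi.add_apply, Set.indicator_of_notMem hv, zero_add]
    have hv1 : 1 ≤ |v| := by
      by_contra hcon
      exact hv (abs_le.mp (not_le.mp hcon).le)
    have h4 : 1 ≤ stableSymbol α₁ α₂ v := by
      have := Real.one_le_rpow hv1 hα₁.1.le
      unfold stableSymbol; linarith
    rw [mul_one_div, div_le_div_iff₀ (by linarith) (by linarith)]
    linarith

/-- When both indices are at least one, `ψ(v) ≤ 2v` on `(0, 1]`, and `∫₀¹ dv / (r + 2v)` diverges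
logarithmically as `r ↓ 0`. -/
theorem tendsto_realResolvent_stableSymbol {α₁ α₂ : ℝ} (hα₁ : α₁ ∈ Set.Ioc (0 : ℝ) 2)
    (hα₂ : α₂ ∈ Set.Ioc (0 : ℝ) 2) (hmax : 1 < max α₁ α₂) (hmin : 1 ≤ min α₁ α₂) :
    Tendsto (realResolvent (stableSymbol α₁ α₂)) (𝓝[>] 0) atTop := by
  have hψ := isSymbol_stableSymbol hα₁ hα₂ hmax
  have h1 : ∀ r : ℝ, 0 < r → 1 / 2 * Real.log (2 / r) ≤
      realResolvent (stableSymbol α₁ α₂) r := by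
    intro r hr
    have hder : ∀ v ∈ Set.uIcc (0 : ℝ) 1, HasDerivAt (fun v => 1 / 2 * Real.log (r + 2 * v))
        (1 / (r + 2 * v)) v := by
      intro v hv
      rw [Set.uIcc_of_le zero_le_one] at hv
      have hne : r + 2 * v ≠ 0 := by linarith [hv.1]
      have h := ((((hasDerivAt_id v).const_mul 2).const_add r).log hne).const_mul (1 / 2)
      refine h.congr_deriv ?_
      simp only [id, mul_one]
      field_simp
    have hcont : ContinuousOn (fun v : ℝ => 1 / (r + 2 * v)) (Set.uIcc 0 1) := by
      refine ContinuousOn.div continuousOn_const (by fun_prop) fun v hv => ?_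
      rw [Set.uIcc_of_le zero_le_one] at hv
      linarith [hv.1]
    have h2 := intervalIntegral.integral_eq_sub_of_hasDerivAt hder hcont.intervalIntegrable
    have h3 : 1 / 2 * Real.log (2 / r) ≤ ∫ v in (0 : ℝ)..1, 1 / (r + 2 * v) := by
      rw [h2, Real.log_div (by norm_num) hr.ne']
      have : Real.log 2 ≤ Real.log (r + 2 * 1) := Real.log_le_log (by norm_num) (by linarith)
      rw [mul_zero, add_zero, mul_sub]
      exact sub_le_sub_right (mul_le_mul_of_nonneg_left this (by norm_num)) _
    refine h3.trans ?_
    rw [intervalIntegral.integral_of_le zero_le_one]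
    have hsub : IntegrableOn (fun v : ℝ => 1 / (r + 2 * v)) (Set.Ioc 0 1) :=
      (intervalIntegrable_iff_integrableOn_Ioc_of_le zero_le_one).mp hcont.intervalIntegrable
    refine (setIntegral_mono_on hsub (hψ.integrable_inv hr).integrableOn measurableSet_Ioc
      fun v hv => ?_).trans (setIntegral_le_integral (hψ.integrable_inv hr)
        (Eventually.of_forall fun v => ?_))
    · have h0 := hψ.nonneg v
      gcongr
      have hle : ∀ α : ℝ, 1 ≤ α → |v| ^ α ≤ v := fun α hα => by
        rw [abs_of_pos hv.1]
        calc v ^ α ≤ v ^ (1 : ℝ) := Real.rpow_le_rpow_of_exponent_ge hv.1 hv.2 hα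
          _ = v := Real.rpow_one v
      have h4 := hle α₁ (hmin.trans (min_le_left _ _))
      have h5 := hle α₂ (hmin.trans (min_le_right _ _))
      unfold stableSymbol; linarith
    · have h0 := hψ.nonneg v
      simp only [Pi.zero_apply]; positivity
  have h2 : Tendsto (fun r : ℝ => 1 / 2 * Real.log (2 / r)) (𝓝[>] 0) atTop := by
    have h3 : Tendsto (fun r : ℝ => 2 / r) (𝓝[>] 0) atTop := by
      simp only [div_eq_mul_inv]
      exact Tendsto.const_mul_atTop (by norm_num) tendsto_inv_nhdsGT_zero
    exact Tendsto.const_mul_atTop (by norm_num) (Real.tendsto_log_atTop.comp h3)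
  exact tendsto_atTop_mono' _ (eventually_nhdsWithin_of_forall fun r hr => h1 r hr) h2

theorem PhiIntegrand_eq {T : ℝ} (hT : 0 < T) (α₁ α₂ : ℝ) (z : ℂ) (v : ℝ) :
    PhiIntegrand T α₁ α₂ z v =
      (T⁻¹ : ℂ) * (((1 : ℝ) : ℂ) / (((T⁻¹ : ℝ) : ℂ) * z + stableSymbol α₁ α₂ v)) := by
  have hT' : (T : ℂ) ≠ 0 := by exact_mod_cast hT.ne'
  have h1 : z + ((T * |v| ^ α₁ : ℝ) : ℂ) + ((T * |v| ^ α₂ : ℝ) : ℂ) =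
      T * (((T⁻¹ : ℝ) : ℂ) * z + stableSymbol α₁ α₂ v) := by
    rw [stableSymbol]; push_cast; field_simp; ring
  rw [PhiIntegrand, h1, Complex.ofReal_one, one_div, mul_inv, one_div]

theorem Phi_eq {T : ℝ} (hT : 0 < T) (α₁ α₂ : ℝ) (z : ℂ) :
    Phi T α₁ α₂ z = (T⁻¹ : ℂ) *
      weightedResolvent (stableSymbol α₁ α₂) (fun _ => 1) (((T⁻¹ : ℝ) : ℂ) * z) := by
  simp_rw [Phi, PhiIntegrand_eq hT]
  rw [integral_const_mul, weightedResolvent]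

theorem integrable_PhiIntegrand {α₁ α₂ : ℝ} (hα₁ : α₁ ∈ Set.Ioc (0 : ℝ) 2)
    (hα₂ : α₂ ∈ Set.Ioc (0 : ℝ) 2) (hmax : 1 < max α₁ α₂) {T : ℝ} (hT : 0 < T) {z : ℂ}
    (hz : z ∈ Complex.slitPlane) : Integrable (PhiIntegrand T α₁ α₂ z) := by
  have hψ := isSymbol_stableSymbol hα₁ hα₂ hmax
  have hz' : ((T⁻¹ : ℝ) : ℂ) * z ∈ Complex.slitPlane := by
    rw [Complex.mem_slitPlane_iff] at hz ⊢
    rw [Complex.re_ofReal_mul, Complex.im_ofReal_mul]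
    have : 0 < T⁻¹ := by positivity
    exact hz.imp (fun h => by positivity) (fun h => mul_ne_zero this.ne' h)
  refine ((hψ.integrable_weighted (ρ := fun _ => 1) continuous_const (by simp) hz').const_mul
    (T⁻¹ : ℂ)).congr (Eventually.of_forall fun v => ?_)
  exact (PhiIntegrand_eq hT α₁ α₂ z v).symm

/-- This is the substitution `r = T exp x`, under which `dr / r = dx`, combined with the scaling
`Φ(z) = T⁻¹ G(z / T)`. The value of `Φ` at angle `-3π/4` is the conjugate of the one at `3π/4`, so
numerator over squared modulus is a quotient by `G`. -/
theorem rayIntegrand_eq {T : ℝ} (hT : 0 < T) (α₁ α₂ x : ℝ) :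
    (T * Real.exp x) * rayIntegrand T α₁ α₂ (T * Real.exp x) =
      T * (hankelIntegrand (stableSymbol α₁ α₂) T (x + hankelAngle * Complex.I)).im := by
  have hT' : (T : ℂ) ≠ 0 := by exact_mod_cast hT.ne'
  set G := weightedResolvent (stableSymbol α₁ α₂) (fun _ => 1)
    (Complex.exp (x + hankelAngle * Complex.I)) with hG
  set r := T * Real.exp x with hr
  have hr0 : 0 < r := by positivity
  have h1 : Phi T α₁ α₂ ((r : ℂ) * Complex.exp (Complex.I * ((3 * Real.pi / 4 : ℝ) : ℂ))) =
      (T⁻¹ : ℂ) * G := by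
    rw [Phi_eq hT, hG]
    congr 2
    rw [hr, Complex.exp_add, hankelAngle, mul_comm Complex.I]
    push_cast
    field_simp
  have h2 : Phi T α₁ α₂ ((r : ℂ) * Complex.exp (-(Complex.I * ((3 * Real.pi / 4 : ℝ) : ℂ)))) =
      (T⁻¹ : ℂ) * (starRingEnd ℂ) G := by
    rw [Phi_eq hT, hG, ← IsSymbol.conj_resolvent, ← Complex.exp_conj]
    congr 2
    rw [hr, map_add, map_mul, Complex.conj_ofReal, Complex.conj_ofReal, Complex.conj_I, hankelAngle,
      Complex.exp_add, mul_comm Complex.I]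
    push_cast
    field_simp
  have h3 : Complex.exp (T * Complex.exp (x + hankelAngle * Complex.I)) =
      Complex.exp (Complex.I * ((r / Real.sqrt 2 : ℝ) : ℂ)) *
        ((Real.exp (-(r / Real.sqrt 2)) : ℝ) : ℂ) := by
    rw [Complex.ofReal_exp, ← Complex.exp_add]
    congr 1
    rw [Complex.exp_add, Complex.exp_mul_I, ← Complex.ofReal_cos, ← Complex.ofReal_sin,
      cos_hankelAngle, sin_hankelAngle, ← Complex.ofReal_exp, ← mul_assoc, ← Complex.ofReal_mul,
      ← hr]
    have h4 : r / Real.sqrt 2 = r * (Real.sqrt 2 / 2) := by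
      rw [Real.sqrt_div_self']; ring
    rw [h4]
    push_cast
    ring
  set a := Complex.exp (Complex.I * ((r / Real.sqrt 2 : ℝ) : ℂ)) with ha
  set b := Real.exp (-(r / Real.sqrt 2)) with hb
  rw [rayIntegrand, h1, h2, hankelIntegrand, h3, ← hG, ← ha, ← hb, norm_mul]
  have h5 : (a * ((T⁻¹ : ℂ) * (starRingEnd ℂ) G)).im = T⁻¹ * (a * (starRingEnd ℂ) G).im := by
    rw [← Complex.im_ofReal_mul]; push_cast; ring_nf
  have h6 : (a * (b : ℂ) / G).im = b * (a * (starRingEnd ℂ) G).im / ‖G‖ ^ 2 := by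
    have : a * (b : ℂ) / G = (((‖G‖ ^ 2)⁻¹ * b : ℝ) : ℂ) * (a * (starRingEnd ℂ) G) := by
      rw [div_eq_mul_inv, Complex.inv_def, Complex.normSq_eq_norm_sq]; push_cast; ring
    rw [this, Complex.im_ofReal_mul]; ring
  have h7 : ‖((T : ℂ))⁻¹‖ = T⁻¹ := by
    rw [norm_inv, Complex.norm_real, Real.norm_of_nonneg hT.le]
  rw [h5, h6, h7]
  field_simp

theorem integrableOn_rayIntegrand {α₁ α₂ : ℝ} (hα₁ : α₁ ∈ Set.Ioc (0 : ℝ) 2)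
    (hα₂ : α₂ ∈ Set.Ioc (0 : ℝ) 2) (hmax : 1 < max α₁ α₂) {T : ℝ} (hT : 0 < T) :
    IntegrableOn (rayIntegrand T α₁ α₂) (Set.Ioi 0) ∧
    ∫ r in Set.Ioi (0 : ℝ), rayIntegrand T α₁ α₂ r = T * ∫ x : ℝ,
      (hankelIntegrand (stableSymbol α₁ α₂) T (x + hankelAngle * Complex.I)).im := by
  have hψ := isSymbol_stableSymbol hα₁ hα₂ hmax
  have hd : ∀ x ∈ (Set.univ : Set ℝ), HasDerivWithinAt (fun x => T * Real.exp x)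
      (T * Real.exp x) Set.univ x := fun x _ =>
    ((Real.hasDerivAt_exp x).const_mul T).hasDerivWithinAt
  have hinj : Set.InjOn (fun x => T * Real.exp x) Set.univ := fun x _ y _ hxy =>
    Real.exp_injective (mul_left_cancel₀ hT.ne' hxy)
  have himage : (fun x => T * Real.exp x) '' Set.univ = Set.Ioi 0 := by
    ext r
    simp only [Set.image_univ, Set.mem_range, Set.mem_Ioi]
    constructor
    · rintro ⟨x, rfl⟩; positivity
    · intro hr
      exact ⟨Real.log (r / T), by rw [Real.exp_log (by positivity)]; field_simp⟩
  have habs : ∀ x : ℝ, |T * Real.exp x| • rayIntegrand T α₁ α₂ (T * Real.exp x) =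
      T * (hankelIntegrand (stableSymbol α₁ α₂) T (x + hankelAngle * Complex.I)).im := by
    intro x
    rw [abs_of_pos (by positivity), smul_eq_mul, rayIntegrand_eq hT]
  constructor
  · rw [← himage, integrableOn_image_iff_integrableOn_abs_deriv_smul MeasurableSet.univ hd hinj]
    simp_rw [habs]
    exact ((hψ.integrable_im_hankelIntegrand hT).const_mul T).integrableOn
  · rw [← himage, integral_image_eq_integral_abs_deriv_smul MeasurableSet.univ hd hinj]
    simp_rw [habs]
    rw [setIntegral_univ, integral_const_mul]

theorem levyTail_stableSymbol {α₁ α₂ : ℝ} (hα₁ : α₁ ∈ Set.Ioc (0 : ℝ) 2)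
    (hα₂ : α₂ ∈ Set.Ioc (0 : ℝ) 2) (hmax : 1 < max α₁ α₂) {T : ℝ} (hT : 0 < T) :
    levyTail (stableSymbol α₁ α₂) T = smallBallConstant T α₁ α₂ := by
  have hψ := isSymbol_stableSymbol hα₁ hα₂ hmax
  rw [smallBallConstant, (integrableOn_rayIntegrand hα₁ hα₂ hmax hT).2]
  split_ifs with hmin
  · have hae : ∀ᵐ v : ℝ, stableSymbol α₁ α₂ v ≠ 0 := by
      filter_upwards [compl_mem_ae_iff.mpr (measure_singleton (0 : ℝ))] with v hv
      exact (stableSymbol_pos α₁ α₂ hv).ne'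
    rw [hψ.levyTail_eq_of_tendsto hT (hψ.tendsto_arc_of_integrable hT
      (integrable_inv_stableSymbol hα₁ hα₂ hmax hmin) hae)]
    simp only [stableSymbol]
    field_simp
  · rw [hψ.levyTail_eq_of_tendsto hT (hψ.tendsto_arc_of_tendsto_atTop hT
      (tendsto_realResolvent_stableSymbol hα₁ hα₂ hmax (not_lt.mp hmin)))]
    field_simp
    ring

/-! ### From conditional characteristic functions to a Lévy process. -/

/-- `exp (i r)`. -/
noncomputable def unitExp (r : ℝ) : ℂ := Complex.exp (Complex.I * r)

theorem unitExp_add (r s : ℝ) : unitExp (r + s) = unitExp r * unitExp s := by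
  rw [unitExp, unitExp, unitExp, ← Complex.exp_add]; push_cast; ring_nf

@[simp] theorem unitExp_zero : unitExp 0 = 1 := by simp [unitExp]

@[fun_prop] theorem continuous_unitExp : Continuous unitExp := by
  unfold unitExp; fun_prop

@[fun_prop] theorem measurable_unitExp : Measurable unitExp := continuous_unitExp.measurable

@[simp] theorem norm_unitExp (r : ℝ) : ‖unitExp r‖ = 1 := by
  rw [unitExp, mul_comm, Complex.norm_exp_ofReal_mul_I]

theorem unitExp_eq (r : ℝ) : unitExp r = Complex.exp (r * Complex.I) := by
  rw [unitExp, mul_comm]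

section Stable

variable {Ω : Type*} {mΩ : MeasurableSpace Ω} {P : Measure Ω}
  {F : Filtration ℝ≥0 mΩ} {α : ℝ} {X : ℝ≥0 → Ω → ℝ}

namespace IsSymmetricStable

theorem measurable (hX : IsSymmetricStable P F α X) (t : ℝ≥0) : Measurable (X t) :=
  ((hX.adapted t).mono (F.le t)).measurable

theorem condExp_increment' (hX : IsSymmetricStable P F α X) {s t : ℝ≥0} (hst : s < t) (u : ℝ) :
    P[fun ω => unitExp (u * (X t ω - X s ω)) | F s]
      =ᵐ[P] fun _ => ((Real.exp (-((t : ℝ) - (s : ℝ)) * |u| ^ α) : ℝ) : ℂ) := by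
  have h := hX.condExp_increment s t hst u
  have h1 : (fun ω => Complex.exp (Complex.I * (u : ℂ) * ((X t ω - X s ω : ℝ) : ℂ))) =
      fun ω => unitExp (u * (X t ω - X s ω)) := by
    ext ω; rw [unitExp]; push_cast; ring_nf
  rwa [h1] at h

end IsSymmetricStable

/-- A process with right-continuous paths, started afresh at every time, whose one-dimensional
laws have exponent `ψ`. -/
structure IsLevyProcess (P : Measure Ω) (ψ : ℝ → ℝ) (Z : ℝ≥0 → Ω → ℝ) : Prop where
  measurable : ∀ t, Measurable (Z t)
  rightCont : ∀ ω t, ContinuousWithinAt (fun t => Z t ω) (Set.Ici t) t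
  charFun_map : ∀ (t : ℝ≥0) (u : ℝ), charFun (P.map (Z t)) u = ((Real.exp (-(t : ℝ) * ψ u) : ℝ) : ℂ)
  markov : ∀ s, P.map (fun ω => (Z s ω, fun t => Z (s + t) ω - Z s ω)) =
    (P.map (Z s)).prod (P.map fun ω t => Z t ω)

theorem linear_form_finset {S : Finset ℝ≥0} (L : StrongDual ℝ (S → ℝ)) (w : ℝ≥0 → ℝ) :
    ∑ t ∈ S, (if h : t ∈ S then L (Pi.single ⟨t, h⟩ 1) else 0) * w t = L fun t : S => w t := by
  rw [← Finset.sum_coe_sort S]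
  have h1 : (fun t : S => w t) = ∑ t : S, (w t) • (Pi.single t (1 : ℝ) : S → ℝ) := by
    ext i
    simp [Finset.sum_apply, Pi.single_apply]
  rw [h1, map_sum]
  refine Finset.sum_congr rfl fun t _ => ?_
  simp [mul_comm]

theorem charFunDual_map_finset {S : Finset ℝ≥0} {W : ℝ≥0 → Ω → ℝ} (hW : ∀ t, Measurable (W t))
    (L : StrongDual ℝ (S → ℝ)) : charFunDual (P.map fun ω (t : S) => W t ω) L =
      ∫ ω, unitExp (∑ t ∈ S, (if h : t ∈ S then L (Pi.single ⟨t, h⟩ 1) else 0) * W t ω) ∂P := by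
  have hm : Measurable fun ω (t : S) => W t ω := by fun_prop
  rw [charFunDual_apply, integral_map hm.aemeasurable
    (Continuous.aestronglyMeasurable (by fun_prop))]
  refine integral_congr_ae (Eventually.of_forall fun ω => ?_)
  simp only
  rw [unitExp_eq]
  rw [linear_form_finset L fun t => W t ω]

variable [IsProbabilityMeasure P]

theorem integrable_unitExp {f : Ω → ℝ} (hf : Measurable f) :
    Integrable (fun ω => unitExp (f ω)) P :=
  (integrable_const (1 : ℝ)).mono' (by fun_prop) (Eventually.of_forall fun ω => by simp)

namespace IsSymmetricStable

/-- The conditional characteristic function of future increments does not depend on the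
starting time. -/
theorem condExp_future (hX : IsSymmetricStable P F α X) (S : Finset ℝ≥0) :
    ∀ u : ℝ≥0 → ℝ, ∃ c : ℂ, ∀ s : ℝ≥0,
      P[fun ω => unitExp (∑ t ∈ S, u t * (X (s + t) ω - X s ω)) | F s] =ᵐ[P] fun _ => c := by
  induction S using Finset.induction_on_max with
  | empty =>
    intro u
    refine ⟨1, fun s => ?_⟩
    simp only [Finset.sum_empty, unitExp_zero]
    rw [condExp_const (F.le s)]
  | insert a S hmax ih =>
    intro u
    have haS : a ∉ S := fun h => lt_irrefl _ (hmax a h)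
    rcases S.eq_empty_or_nonempty with rfl | hne
    · rcases eq_or_ne a 0 with rfl | ha
      · refine ⟨1, fun s => ?_⟩
        simp only [insert_empty_eq, Finset.sum_singleton, add_zero, sub_self, mul_zero,
          unitExp_zero]
        rw [condExp_const (F.le s)]
      · refine ⟨((Real.exp (-(a : ℝ) * |u a| ^ α) : ℝ) : ℂ), fun s => ?_⟩
        simp only [insert_empty_eq, Finset.sum_singleton]
        have h := hX.condExp_increment' (s := s) (t := s + a)
          (lt_add_of_pos_right s (pos_iff_ne_zero.mpr ha)) (u a)
        have h2 : ((s + a : ℝ≥0) : ℝ) - s = a := by push_cast; ring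
        rwa [h2] at h
    · set b := S.max' hne with hb
      have hbS : b ∈ S := S.max'_mem hne
      have hba : b < a := hmax b hbS
      -- The latest increment is split at the preceding time `b`. Its part up to `b` is absorbed
      -- into the coefficient of `b`, and its part after `b` is integrated out by conditioning on `F
      -- (s + b)` first.
      obtain ⟨c, hc⟩ := ih (Function.update u b (u b + u a))
      refine ⟨((Real.exp (-((a : ℝ) - b) * |u a| ^ α) : ℝ) : ℂ) * c, fun s => ?_⟩
      set A : Ω → ℝ := fun ω => ∑ t ∈ S, (Function.update u b (u b + u a)) t *
        (X (s + t) ω - X s ω) with hA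
      set B : Ω → ℝ := fun ω => u a * (X (s + a) ω - X (s + b) ω) with hB
      have hsplit : ∀ ω, ∑ t ∈ insert a S, u t * (X (s + t) ω - X s ω) = A ω + B ω := by
        intro ω
        rw [Finset.sum_insert haS, hA, hB]
        simp only
        rw [← Finset.add_sum_erase S _ hbS, ← Finset.add_sum_erase S _ hbS]
        have : ∑ t ∈ S.erase b, Function.update u b (u b + u a) t * (X (s + t) ω - X s ω) =
            ∑ t ∈ S.erase b, u t * (X (s + t) ω - X s ω) :=
          Finset.sum_congr rfl fun t ht => by
            rw [Function.update_of_ne (Finset.ne_of_mem_erase ht)]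
        rw [this, Function.update_self]
        ring
      have hAF : StronglyMeasurable[F (s + b)] fun ω => unitExp (A ω) := by
        refine continuous_unitExp.comp_stronglyMeasurable ?_
        refine Finset.stronglyMeasurable_fun_sum S fun t ht => ?_
        refine ((hX.adapted (s + t)).mono (F.mono ?_)).sub
          ((hX.adapted s).mono (F.mono ?_)) |>.const_mul _
        · exact add_le_add_right (S.le_max' t ht) s
        · exact le_self_add
      have hmA : Measurable A := by
        have := hX.measurable
        simp only [hA]; fun_prop
      have hmB : Measurable B := by
        have := hX.measurable
        simp only [hB]; fun_prop
      have h1 : P[fun ω => unitExp (A ω) * unitExp (B ω) | F (s + b)] =ᵐ[P]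
          fun ω => unitExp (A ω) * P[fun ω => unitExp (B ω) | F (s + b)] ω := by
        refine condExp_bilin_of_stronglyMeasurable_left (ContinuousLinearMap.mul ℝ ℂ) hAF ?_
          (integrable_unitExp hmB)
        have := integrable_unitExp (P := P) (hmA.add hmB)
        simpa [unitExp_add] using this
      have h2 := hX.condExp_increment' (s := s + b) (t := s + a) (add_lt_add_right hba s) (u a)
      have h2' : ((s + a : ℝ≥0) : ℝ) - ((s + b : ℝ≥0) : ℝ) = (a : ℝ) - b := by push_cast; ring
      rw [h2'] at h2
      set k : ℂ := ((Real.exp (-((a : ℝ) - b) * |u a| ^ α) : ℝ) : ℂ) with hk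
      have h3 : P[fun ω => unitExp (A ω) * unitExp (B ω) | F (s + b)] =ᵐ[P]
          k • fun ω => unitExp (A ω) := by
        filter_upwards [h1, h2] with ω hω1 hω2
        rw [hω1, hω2, Pi.smul_apply, smul_eq_mul, mul_comm]
      have h4 : P[fun ω => unitExp (A ω) * unitExp (B ω) | F s] =ᵐ[P]
          P[P[fun ω => unitExp (A ω) * unitExp (B ω) | F (s + b)] | F s] :=
        (condExp_condExp_of_le (F.mono le_self_add) (F.le _)).symm
      have h5 := condExp_congr_ae (m := F s) h3
      have h6 := condExp_smul (μ := P) k (fun ω => unitExp (A ω)) (F s)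
      simp_rw [hsplit, unitExp_add]
      filter_upwards [h4, h5, h6, hc s] with ω hω4 hω5 hω6 hω7
      rw [hω4, hω5, hω6, Pi.smul_apply, smul_eq_mul, hω7]

/-- Factorization of the joint characteristic function of past and future. -/
theorem integral_unitExp_mul (hX : IsSymmetricStable P F α X) (S : Finset ℝ≥0) (u : ℝ≥0 → ℝ)
    (s : ℝ≥0) (v : ℝ) :
    ∫ ω, unitExp (v * X s ω) * unitExp (∑ t ∈ S, u t * (X (s + t) ω - X s ω)) ∂P =
      (∫ ω, unitExp (v * X s ω) ∂P) * ∫ ω, unitExp (∑ t ∈ S, u t * X t ω) ∂P := by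
  obtain ⟨c, hc⟩ := hX.condExp_future S u
  have hm := hX.measurable
  have hc0 : ∫ ω, unitExp (∑ t ∈ S, u t * X t ω) ∂P = c := by
    have h1 : ∫ ω, unitExp (∑ t ∈ S, u t * (X (0 + t) ω - X 0 ω)) ∂P = c := by
      rw [← integral_condExp (F.le 0), integral_congr_ae (hc 0)]
      simp
    rw [← h1]
    refine integral_congr_ae ?_
    filter_upwards [hX.zero] with ω hω
    simp [hω]
  have hF : StronglyMeasurable[F s] fun ω => unitExp (v * X s ω) :=
    continuous_unitExp.comp_stronglyMeasurable ((hX.adapted s).const_mul v)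
  have hint : Integrable (fun ω => unitExp (∑ t ∈ S, u t * (X (s + t) ω - X s ω))) P :=
    integrable_unitExp (by fun_prop)
  have h1 : P[fun ω => unitExp (v * X s ω) *
      unitExp (∑ t ∈ S, u t * (X (s + t) ω - X s ω)) | F s] =ᵐ[P]
      fun ω => unitExp (v * X s ω) *
        P[fun ω => unitExp (∑ t ∈ S, u t * (X (s + t) ω - X s ω)) | F s] ω := by
    refine condExp_bilin_of_stronglyMeasurable_left (ContinuousLinearMap.mul ℝ ℂ) hF ?_ hint
    have := integrable_unitExp (P := P) (f := fun ω => v * X s ω +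
      ∑ t ∈ S, u t * (X (s + t) ω - X s ω)) (by fun_prop)
    simpa [unitExp_add] using this
  rw [hc0, ← integral_mul_const, ← integral_condExp (F.le s)]
  refine integral_congr_ae ?_
  filter_upwards [h1, hc s] with ω hω1 hω2
  rw [hω1, hω2]

theorem integral_unitExp (hX : IsSymmetricStable P F α X) (t : ℝ≥0) (u : ℝ) :
    ∫ ω, unitExp (u * X t ω) ∂P = ((Real.exp (-(t : ℝ) * |u| ^ α) : ℝ) : ℂ) := by
  rcases eq_or_ne t 0 with rfl | ht
  · have : ∫ ω, unitExp (u * X 0 ω) ∂P = ∫ _, (1 : ℂ) ∂P := by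
      refine integral_congr_ae ?_
      filter_upwards [hX.zero] with ω hω
      simp [hω]
    rw [this]; simp
  · have h := hX.condExp_increment' (pos_iff_ne_zero.mpr ht) u
    have h1 : ∫ ω, unitExp (u * (X t ω - X 0 ω)) ∂P =
        ((Real.exp (-(t : ℝ) * |u| ^ α) : ℝ) : ℂ) := by
      rw [← integral_condExp (F.le 0), integral_congr_ae h]
      simp
    rw [← h1]
    refine integral_congr_ae ?_
    filter_upwards [hX.zero] with ω hω
    simp [hω]

end IsSymmetricStable

/-- Independence of the two whole paths factors every expectation of a product. The joint
characteristic functions of past and future therefore factor for `Z` as they do for `X` and `Y`.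
These determine the finite-dimensional laws, which in turn determine laws and independence on path
space. -/
theorem isLevyProcess_sub {α₁ α₂ : ℝ} {X Y : ℝ≥0 → Ω → ℝ}
    (hX : IsSymmetricStable P F α₁ X) (hY : IsSymmetricStable P F α₂ Y)
    (hXY : IndepFun (fun ω t => X t ω) (fun ω t => Y t ω) P) :
    IsLevyProcess P (stableSymbol α₁ α₂) (fun t ω => X t ω - Y t ω) := by
  have hmX := hX.measurable
  have hmY := hY.measurable
  have hpX : Measurable fun ω t => X t ω := by fun_prop
  have hpY : Measurable fun ω t => Y t ω := by fun_prop
  have hfac : ∀ (f g : (ℝ≥0 → ℝ) → ℂ), Measurable f → Measurable g →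
      ∫ ω, f (fun t => X t ω) * g (fun t => Y t ω) ∂P =
      (∫ ω, f (fun t => X t ω) ∂P) * ∫ ω, g (fun t => Y t ω) ∂P := fun f g hf hg =>
    hXY.integral_fun_comp_mul_comp hpX.aemeasurable hpY.aemeasurable
      hf.aestronglyMeasurable hg.aestronglyMeasurable
  have hone : ∀ (t : ℝ≥0) (u : ℝ), ∫ ω, unitExp (u * (X t ω - Y t ω)) ∂P =
      (∫ ω, unitExp (u * X t ω) ∂P) * ∫ ω, unitExp (-u * Y t ω) ∂P := by
    intro t u
    rw [← hfac (fun x => unitExp (u * x t)) (fun y => unitExp (-u * y t))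
      (by fun_prop) (by fun_prop)]
    refine integral_congr_ae (Eventually.of_forall fun ω => ?_)
    simp only
    rw [← unitExp_add]; ring_nf
  have hfin : ∀ (S : Finset ℝ≥0) (u : ℝ≥0 → ℝ), ∫ ω, unitExp (∑ t ∈ S, u t * (X t ω - Y t ω)) ∂P =
      (∫ ω, unitExp (∑ t ∈ S, u t * X t ω) ∂P) *
        ∫ ω, unitExp (∑ t ∈ S, (-u) t * Y t ω) ∂P := by
    intro S u
    rw [← hfac (fun x => unitExp (∑ t ∈ S, u t * x t))
      (fun y => unitExp (∑ t ∈ S, (-u) t * y t)) (by fun_prop) (by fun_prop)]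
    refine integral_congr_ae (Eventually.of_forall fun ω => ?_)
    simp only
    rw [← unitExp_add, ← Finset.sum_add_distrib]
    congr 1
    refine Finset.sum_congr rfl fun t _ => ?_
    rw [Pi.neg_apply]; ring
  have hjoint : ∀ (S : Finset ℝ≥0) (u : ℝ≥0 → ℝ) (s : ℝ≥0) (v : ℝ),
      ∫ ω, unitExp (v * (X s ω - Y s ω)) * unitExp (∑ t ∈ S, u t *
        ((X (s + t) ω - Y (s + t) ω) - (X s ω - Y s ω))) ∂P =
      (∫ ω, unitExp (v * (X s ω - Y s ω)) ∂P) *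
        ∫ ω, unitExp (∑ t ∈ S, u t * (X t ω - Y t ω)) ∂P := by
    intro S u s v
    rw [hone, hfin, mul_mul_mul_comm, ← hX.integral_unitExp_mul, ← hY.integral_unitExp_mul,
      ← hfac (fun x => unitExp (v * x s) * unitExp (∑ t ∈ S, u t * (x (s + t) - x s)))
        (fun y => unitExp (-v * y s) * unitExp (∑ t ∈ S, (-u) t * (y (s + t) - y s)))
        (by fun_prop) (by fun_prop)]
    refine integral_congr_ae (Eventually.of_forall fun ω => ?_)
    simp only
    simp only [← unitExp_add]
    congr 1
    rw [add_add_add_comm, ← Finset.sum_add_distrib]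
    congr 1
    · ring
    · refine Finset.sum_congr rfl fun t _ => ?_
      rw [Pi.neg_apply]; ring
  set Z : ℝ≥0 → Ω → ℝ := fun t ω => X t ω - Y t ω with hZ
  have hmZ : ∀ t, Measurable (Z t) := fun t => (hmX t).sub (hmY t)
  refine ⟨hmZ, fun ω t => ?_, fun t u => ?_, fun s => ?_⟩
  · exact (hX.cadlag ω t).1.sub (hY.cadlag ω t).1
  · rw [charFun_apply_real, integral_map (hmZ t).aemeasurable
      (Continuous.aestronglyMeasurable (by fun_prop))]
    have h1 : ∫ ω, Complex.exp (u * (Z t ω) * Complex.I) ∂P = ∫ ω, unitExp (u * Z t ω) ∂P := by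
      refine integral_congr_ae (Eventually.of_forall fun ω => ?_)
      simp only; rw [unitExp_eq]; push_cast; rfl
    rw [h1]
    simp only [hZ]
    rw [hone, hX.integral_unitExp, hY.integral_unitExp, abs_neg, ← Complex.ofReal_mul,
      ← Real.exp_add, stableSymbol]
    congr 2; ring
  · have hmF : ∀ t, Measurable fun ω => Z (s + t) ω - Z s ω := fun t => (hmZ _).sub (hmZ s)
    have hpF : Measurable fun ω t => Z (s + t) ω - Z s ω := measurable_pi_lambda _ hmF
    have hpZ : Measurable fun ω t => Z t ω := measurable_pi_lambda _ hmZ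
    have hlaw : P.map (fun ω t => Z (s + t) ω - Z s ω) = P.map fun ω t => Z t ω := by
      rw [map_eq_iff_forall_finset_map_restrict_eq (X := fun t ω => Z (s + t) ω - Z s ω)
        (Y := Z) hpF.aemeasurable hpZ.aemeasurable]
      intro S
      have hm1 : Measurable fun ω (t : S) => Z (s + t) ω - Z s ω := by fun_prop
      have hm2 : Measurable fun ω (t : S) => Z t ω := by fun_prop
      have : IsProbabilityMeasure (P.map fun ω (t : S) => Z (s + t) ω - Z s ω) :=
        Measure.isProbabilityMeasure_map hm1.aemeasurable
      have : IsProbabilityMeasure (P.map fun ω (t : S) => Z t ω) :=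
        Measure.isProbabilityMeasure_map hm2.aemeasurable
      refine Measure.ext_of_charFunDual ?_
      ext L
      refine (charFunDual_map_finset hmF L).trans (Eq.trans ?_ (charFunDual_map_finset hmZ L).symm)
      -- Taking `v = 0` removes the past and leaves equality of the law of the shifted increments
      -- with that of the original process.
      have := hjoint S (fun t => if h : t ∈ S then L (Pi.single ⟨t, h⟩ 1) else 0) s 0
      simpa using this
    rw [← hlaw]
    refine (indepFun_iff_map_prod_eq_prod_map_map (hmZ s).aemeasurable hpF.aemeasurable).mp ?_
    refine IndepFun.indepFun_process (hmZ s) hmF fun S => ?_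
    have hm1 : Measurable fun ω (t : S) => Z (s + t) ω - Z s ω := by fun_prop
    rw [indepFun_iff_charFunDual_prod (hmZ s).aemeasurable hm1.aemeasurable]
    intro L
    have hLadd : ∀ (x : ℝ) (y : S → ℝ), L (x, y) =
        L (1, 0) * x + L.comp (ContinuousLinearMap.inr ℝ ℝ (S → ℝ)) y := by
      intro x y
      have h1 : (x, y) = x • ((1 : ℝ), (0 : S → ℝ)) + ((0 : ℝ), y) := by simp
      rw [h1, map_add, map_smul, smul_eq_mul, mul_comm]
      rfl
    have h0 : charFunDual (P.map fun ω => (Z s ω, fun t : S => Z (s + t) ω - Z s ω)) L =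
        ∫ ω, unitExp (L (1, 0) * Z s ω) * unitExp (∑ t ∈ S, (if h : t ∈ S then
          L.comp (ContinuousLinearMap.inr ℝ ℝ (S → ℝ)) (Pi.single ⟨t, h⟩ 1) else 0) *
            (Z (s + t) ω - Z s ω)) ∂P := by
      rw [charFunDual_apply, integral_map ((hmZ s).prodMk hm1).aemeasurable
        (Continuous.aestronglyMeasurable (by fun_prop))]
      refine integral_congr_ae (Eventually.of_forall fun ω => ?_)
      simp only
      have h3 := linear_form_finset (L.comp (ContinuousLinearMap.inr ℝ ℝ (S → ℝ)))
        fun t => Z (s + t) ω - Z s ω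
      rw [hLadd, ← h3, ← unitExp_add, unitExp_eq]
    have h1 : charFunDual (P.map (Z s)) (L.comp (ContinuousLinearMap.inl ℝ ℝ (S → ℝ))) =
        ∫ ω, unitExp (L (1, 0) * Z s ω) ∂P := by
      rw [charFunDual_apply, integral_map (hmZ s).aemeasurable
        (Continuous.aestronglyMeasurable (by fun_prop))]
      refine integral_congr_ae (Eventually.of_forall fun ω => ?_)
      simp only [ContinuousLinearMap.comp_apply, ContinuousLinearMap.inl_apply]
      rw [hLadd, map_zero, add_zero, unitExp_eq]
    rw [h0, h1, charFunDual_map_finset hmF, hjoint]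
    congr 1
    have := hjoint S (fun t => if h : t ∈ S then
      L.comp (ContinuousLinearMap.inr ℝ ℝ (S → ℝ)) (Pi.single ⟨t, h⟩ 1) else 0) s 0
    simp only [zero_mul, unitExp_zero, one_mul, integral_const, probReal_univ, one_smul] at this
    exact this.symm

end Stable

/-! ### The heat kernel and Fourier inversion. -/

theorem heatKernel_nonneg (ε x : ℝ) : 0 ≤ heatKernel ε x := by
  unfold heatKernel; positivity

theorem heatKernel_le (ε x : ℝ) (hε : 0 < ε) : heatKernel ε x ≤ 1 / Real.sqrt (2 * Real.pi * ε) := by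
  unfold heatKernel
  refine mul_le_of_le_one_right (by positivity) (Real.exp_le_one_iff.mpr ?_)
  rw [neg_div]
  have : 0 ≤ |x| ^ 2 / (2 * ε) := by positivity
  linarith

@[fun_prop] theorem continuous_heatKernel (ε : ℝ) : Continuous (heatKernel ε) := by
  unfold heatKernel; fun_prop

theorem heatKernel_eq_gaussianPDFReal {ε : ℝ} (hε : 0 < ε) (x : ℝ) :
    heatKernel ε x = gaussianPDFReal 0 ε.toNNReal x := by
  rw [heatKernel, gaussianPDFReal, Real.coe_toNNReal _ hε.le, sq_abs, sub_zero, one_div]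

theorem integrable_heatKernel {ε : ℝ} (hε : 0 < ε) : Integrable (heatKernel ε) := by
  have := integrable_gaussianPDFReal 0 ε.toNNReal
  refine this.congr (Eventually.of_forall fun x => (heatKernel_eq_gaussianPDFReal hε x).symm)

theorem integral_heatKernel {ε : ℝ} (hε : 0 < ε) : ∫ x, heatKernel ε x = 1 := by
  simp_rw [heatKernel_eq_gaussianPDFReal hε]
  exact integral_gaussianPDFReal_eq_one 0 (by simpa using hε)

theorem heatKernel_neg (ε x : ℝ) : heatKernel ε (-x) = heatKernel ε x := by
  simp [heatKernel]

theorem sqrt_mul_heatKernel {ε : ℝ} (hε : 0 < ε) (a : ℝ) :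
    Real.sqrt ε * heatKernel ε (Real.sqrt ε * a) = heatKernel 1 a := by
  have h := Real.sq_sqrt hε.le
  have h0 := Real.sqrt_pos.mpr hε
  rw [heatKernel, heatKernel, sq_abs, sq_abs, mul_pow, h, mul_one, mul_one,
    Real.sqrt_mul (by positivity)]
  have : -(ε * a ^ 2) / (2 * ε) = -a ^ 2 / 2 := by field_simp
  rw [this]
  have := Real.sqrt_pos.mpr (by positivity : 0 < 2 * Real.pi)
  field_simp

/-- Rescaling an integral against the heat kernel. -/
theorem integral_heatKernel_mul {ε : ℝ} (hε : 0 < ε) (x : ℝ) (g : ℝ → ℝ) :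
    ∫ z, heatKernel ε (x + z) * g z = ∫ a, heatKernel 1 a * g (Real.sqrt ε * a - x) := by
  have h0 := Real.sqrt_pos.mpr hε
  have h1 := integral_sub_right_eq_self (μ := volume) (fun z => heatKernel ε (x + z) * g z) x
  have h2 := Measure.integral_comp_mul_left
    (fun w => heatKernel ε (x + (w - x)) * g (w - x)) (Real.sqrt ε)
  rw [h1, abs_of_pos (by positivity), smul_eq_mul] at h2
  rw [eq_inv_mul_iff_mul_eq₀ h0.ne'] at h2
  rw [← h2, ← integral_const_mul]
  congr 1; ext a
  rw [← sqrt_mul_heatKernel hε, add_sub_cancel]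
  ring

theorem heatKernel_eq_integral_cos {ε : ℝ} (hε : 0 < ε) (x : ℝ) :
    heatKernel ε x = (2 * Real.pi)⁻¹ * ∫ v, Real.cos (v * x) * Real.exp (-(ε / 2) * v ^ 2) := by
  have hb : 0 < ((ε / 2 : ℝ) : ℂ).re := by simpa using hε
  have h := fourierIntegral_gaussian hb (x : ℂ)
  have h1 : ∀ v : ℝ, Complex.exp (Complex.I * x * v) * Complex.exp (-((ε / 2 : ℝ) : ℂ) * v ^ 2) =
      ((Real.exp (-(ε / 2) * v ^ 2) : ℝ) : ℂ) * unitExp (v * x) := by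
    intro v
    rw [unitExp]; push_cast; ring_nf
  simp_rw [h1] at h
  have hint : Integrable fun v : ℝ => ((Real.exp (-(ε / 2) * v ^ 2) : ℝ) : ℂ) * unitExp (v * x) :=
    (integrable_exp_neg_mul_sq (by positivity : 0 < ε / 2)).mono'
      (Continuous.aestronglyMeasurable (by fun_prop)) (Eventually.of_forall fun v => by
        rw [norm_mul, norm_unitExp, mul_one, Complex.norm_real,
          Real.norm_of_nonneg (Real.exp_pos _).le])
  have h2 := congrArg Complex.re h
  have h3 : (∫ v : ℝ, ((Real.exp (-(ε / 2) * v ^ 2) : ℝ) : ℂ) * unitExp (v * x)).re =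
      ∫ v : ℝ, (((Real.exp (-(ε / 2) * v ^ 2) : ℝ) : ℂ) * unitExp (v * x)).re :=
    (integral_re hint).symm
  rw [h3] at h2
  have h4 : ∀ v : ℝ, (((Real.exp (-(ε / 2) * v ^ 2) : ℝ) : ℂ) * unitExp (v * x)).re =
      Real.cos (v * x) * Real.exp (-(ε / 2) * v ^ 2) := by
    intro v
    rw [Complex.re_ofReal_mul, unitExp_eq, Complex.exp_ofReal_mul_I_re, mul_comm]
  simp_rw [h4] at h2
  rw [h2]
  have h5 : ((Real.pi : ℂ) / ((ε / 2 : ℝ) : ℂ)) ^ (1 / 2 : ℂ) *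
      Complex.exp (-(x : ℂ) ^ 2 / (4 * ((ε / 2 : ℝ) : ℂ))) =
      ((Real.sqrt (Real.pi / (ε / 2)) * Real.exp (-x ^ 2 / (4 * (ε / 2))) : ℝ) : ℂ) := by
    rw [Real.sqrt_eq_rpow, Complex.ofReal_mul, Complex.ofReal_cpow (by positivity)]
    push_cast
    norm_num
  rw [h5, Complex.ofReal_re, heatKernel, sq_abs]
  have h6 : Real.sqrt (Real.pi / (ε / 2)) = 2 * Real.pi / Real.sqrt (2 * Real.pi * ε) := by
    rw [eq_div_iff (by positivity), ← Real.sqrt_mul (by positivity),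
      show Real.pi / (ε / 2) * (2 * Real.pi * ε) = (2 * Real.pi) ^ 2 by field_simp,
      Real.sqrt_sq (by positivity)]
  rw [h6, show 4 * (ε / 2) = 2 * ε by ring]
  field_simp

/-- The Fourier inversion integral of an even characteristic function. -/
noncomputable def cosTransform (φ : ℝ → ℝ) (y : ℝ) : ℝ :=
  (2 * Real.pi)⁻¹ * ∫ v, Real.cos (v * y) * φ v

theorem abs_cosTransform_le {φ : ℝ → ℝ} (hφ : Integrable φ) (y : ℝ) :
    |cosTransform φ y| ≤ (2 * Real.pi)⁻¹ * ∫ v, |φ v| := by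
  rw [cosTransform, abs_mul, abs_of_pos (by have := Real.pi_pos; positivity)]
  gcongr
  rw [← Real.norm_eq_abs]
  refine norm_integral_le_of_norm_le hφ.abs (Eventually.of_forall fun v => ?_)
  rw [norm_mul, Real.norm_eq_abs, Real.norm_eq_abs]
  exact mul_le_of_le_one_left (abs_nonneg _) (Real.abs_cos_le_one _)

theorem continuous_cosTransform {φ : ℝ → ℝ} (hφ : Integrable φ) : Continuous (cosTransform φ) := by
  refine continuous_const.mul (continuous_of_dominated (bound := fun v => |φ v|) ?_ ?_ hφ.abs ?_)
  · exact fun y => (Continuous.aestronglyMeasurable (by fun_prop)).mul hφ.1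
  · refine fun y => Eventually.of_forall fun v => ?_
    rw [norm_mul, Real.norm_eq_abs, Real.norm_eq_abs]
    exact mul_le_of_le_one_left (abs_nonneg _) (Real.abs_cos_le_one _)
  · exact Eventually.of_forall fun v => by fun_prop

section Density

variable {μ : Measure ℝ} [IsProbabilityMeasure μ] {φ : ℝ → ℝ}

/-- The Gaussian factor makes the double integral absolutely convergent, so Fubini applies before
any density is known; `ε ↓ 0` then recovers the inversion formula. -/
theorem integral_heatKernel_sub (hμ : ∀ u, charFun μ u = φ u) {ε : ℝ} (hε : 0 < ε) (y : ℝ) :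
    ∫ x, heatKernel ε (x - y) ∂μ =
      (2 * Real.pi)⁻¹ * ∫ v, Real.cos (v * y) * φ v * Real.exp (-(ε / 2) * v ^ 2) := by
  simp_rw [heatKernel_eq_integral_cos hε]
  rw [integral_const_mul]
  congr 1
  have hint : Integrable (Function.uncurry fun (x v : ℝ) =>
      Real.cos (v * (x - y)) * Real.exp (-(ε / 2) * v ^ 2)) (μ.prod volume) := by
    have h1 : Integrable (fun p : ℝ × ℝ => (1 : ℝ) * Real.exp (-(ε / 2) * p.2 ^ 2))
        (μ.prod volume) :=
      Integrable.mul_prod (integrable_const (1 : ℝ))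
        (integrable_exp_neg_mul_sq (by positivity : 0 < ε / 2))
    refine h1.mono' (Continuous.aestronglyMeasurable (by fun_prop)) (Eventually.of_forall
      fun p => ?_)
    simp only [Function.uncurry]
    rw [norm_mul, Real.norm_of_nonneg (Real.exp_pos _).le]
    gcongr
    exact Real.abs_cos_le_one _
  rw [integral_integral_swap hint]
  refine integral_congr_ae (Eventually.of_forall fun v => ?_)
  simp only
  rw [integral_mul_const]
  congr 1
  have h2 : Integrable (fun x : ℝ => unitExp (-(v * y)) * Complex.exp (v * x * Complex.I)) μ :=
    (integrable_const (1 : ℝ)).mono' (Continuous.aestronglyMeasurable (by fun_prop))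
      (Eventually.of_forall fun x => by
        rw [norm_mul, norm_unitExp, one_mul, ← Complex.ofReal_mul,
          Complex.norm_exp_ofReal_mul_I])
  have h3 : ∫ x, Real.cos (v * (x - y)) ∂μ =
      (∫ x, unitExp (-(v * y)) * Complex.exp (v * x * Complex.I) ∂μ).re := by
    have h4 : (∫ x, unitExp (-(v * y)) * Complex.exp (v * x * Complex.I) ∂μ).re =
        ∫ x, (unitExp (-(v * y)) * Complex.exp (v * x * Complex.I)).re ∂μ :=
      (integral_re h2).symm
    rw [h4]
    refine integral_congr_ae (Eventually.of_forall fun x => ?_)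
    simp only
    rw [← Complex.ofReal_mul, ← unitExp_eq, ← unitExp_add, unitExp_eq,
      Complex.exp_ofReal_mul_I_re]
    ring_nf
  rw [h3, integral_const_mul, ← charFun_apply_real, hμ, mul_comm (unitExp _),
    Complex.re_ofReal_mul, unitExp_eq, Complex.exp_ofReal_mul_I_re, Real.cos_neg, mul_comm]

theorem tendsto_integral_heatKernel_sub (hμ : ∀ u, charFun μ u = φ u) (hφ : Integrable φ) (y : ℝ) :
    Tendsto (fun ε : ℝ => ∫ x, heatKernel ε (x - y) ∂μ) (𝓝[>] 0) (𝓝 (cosTransform φ y)) := by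
  have h1 : Tendsto (fun ε : ℝ => (2 * Real.pi)⁻¹ *
      ∫ v, Real.cos (v * y) * φ v * Real.exp (-(ε / 2) * v ^ 2)) (𝓝[>] 0)
      (𝓝 (cosTransform φ y)) := by
    refine Tendsto.const_mul _ (tendsto_integral_filter_of_dominated_convergence
      (fun v => |φ v|) ?_ ?_ hφ.abs ?_)
    · exact Eventually.of_forall fun ε => ((Continuous.aestronglyMeasurable (by fun_prop)).mul
        hφ.1).mul (Continuous.aestronglyMeasurable (by fun_prop))
    · filter_upwards [self_mem_nhdsWithin] with ε hε
      refine Eventually.of_forall fun v => ?_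
      have hε' : (0 : ℝ) < ε := hε
      rw [norm_mul, norm_mul, Real.norm_of_nonneg (Real.exp_pos _).le, Real.norm_eq_abs,
        Real.norm_eq_abs]
      have h2 : Real.exp (-(ε / 2) * v ^ 2) ≤ 1 := by
        rw [Real.exp_le_one_iff]
        have : 0 ≤ ε / 2 * v ^ 2 := by positivity
        linarith
      calc _ ≤ 1 * |φ v| * 1 := by
            gcongr
            exact Real.abs_cos_le_one _
        _ = |φ v| := by ring
    · refine Eventually.of_forall fun v => ?_
      have h3 : Tendsto (fun ε : ℝ => Real.cos (v * y) * φ v * Real.exp (-(ε / 2) * v ^ 2)) (𝓝 0)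
          (𝓝 (Real.cos (v * y) * φ v * Real.exp (-(0 / 2) * v ^ 2))) :=
        Continuous.tendsto (by fun_prop) 0
      simpa using h3.mono_left nhdsWithin_le_nhds
  refine h1.congr' ?_
  filter_upwards [self_mem_nhdsWithin] with ε hε
  exact (integral_heatKernel_sub hμ hε y).symm

theorem cosTransform_nonneg (hμ : ∀ u, charFun μ u = φ u) (hφ : Integrable φ) (y : ℝ) :
    0 ≤ cosTransform φ y :=
  ge_of_tendsto' (tendsto_integral_heatKernel_sub hμ hφ y) fun ε =>
    integral_nonneg fun _ => heatKernel_nonneg ε _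

/-- Both sides are limits, as `ε ↓ 0`, of the integral of `f` against the heat-kernel smoothing of
`μ`: the kernel is integrated against `μ` for one limit and against `f` for the other. -/
theorem integral_eq_integral_mul_cosTransform (hμ : ∀ u, charFun μ u = φ u) (hφ : Integrable φ)
    (f : CompactlySupportedContinuousMap ℝ ℝ) :
    ∫ x, f x ∂μ = ∫ y, f y * cosTransform φ y := by
  have hfi : Integrable f := f.continuous.integrable_of_hasCompactSupport f.hasCompactSupport
  obtain ⟨M, hM⟩ := f.hasCompactSupport.exists_bound_of_continuous f.continuous
  have hswap : ∀ ε : ℝ, 0 < ε → ∫ y, f y * ∫ x, heatKernel ε (x - y) ∂μ =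
      ∫ x, ∫ a, heatKernel 1 a * f (Real.sqrt ε * a - (-x)) ∂volume ∂μ := by
    intro ε hε
    simp_rw [← integral_const_mul]
    have hint : Integrable (Function.uncurry fun (y x : ℝ) => f y * heatKernel ε (x - y))
        (volume.prod μ) := by
      have h1 : Integrable (fun p : ℝ × ℝ => |f p.1| * (1 / Real.sqrt (2 * Real.pi * ε)))
          (volume.prod μ) :=
        Integrable.mul_prod hfi.abs (integrable_const _)
      refine h1.mono' (Continuous.aestronglyMeasurable ?_) (Eventually.of_forall fun p => ?_)
      · have := f.continuous
        exact (this.comp continuous_fst).mul ((continuous_heatKernel ε).comp (by fun_prop))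
      · simp only [Function.uncurry]
        rw [norm_mul, Real.norm_eq_abs, Real.norm_of_nonneg (heatKernel_nonneg _ _)]
        gcongr
        exact heatKernel_le _ _ hε
    rw [integral_integral_swap hint]
    refine integral_congr_ae (Eventually.of_forall fun x => ?_)
    simp only
    rw [← integral_heatKernel_mul hε (-x) f]
    refine integral_congr_ae (Eventually.of_forall fun z => ?_)
    simp only
    rw [← heatKernel_neg, neg_sub, mul_comm, sub_eq_neg_add]
  have h1 : Tendsto (fun ε : ℝ => ∫ y, f y * ∫ x, heatKernel ε (x - y) ∂μ) (𝓝[>] 0)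
      (𝓝 (∫ y, f y * cosTransform φ y)) := by
    refine tendsto_integral_filter_of_dominated_convergence
      (fun y => |f y| * ((2 * Real.pi)⁻¹ * ∫ v, |φ v|)) ?_ ?_ (hfi.abs.mul_const _) ?_
    · refine Eventually.of_forall fun ε => hfi.1.mul ?_
      have : StronglyMeasurable (fun p : ℝ × ℝ => heatKernel ε (p.2 - p.1)) :=
        ((continuous_heatKernel ε).comp (by fun_prop)).stronglyMeasurable
      exact this.integral_prod_right'.aestronglyMeasurable
    · filter_upwards [self_mem_nhdsWithin] with ε hε
      have hε' : (0 : ℝ) < ε := hε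
      refine Eventually.of_forall fun y => ?_
      rw [norm_mul, Real.norm_eq_abs, integral_heatKernel_sub hμ hε, norm_mul,
        Real.norm_of_nonneg (by have := Real.pi_pos; positivity)]
      gcongr
      refine norm_integral_le_of_norm_le hφ.abs (Eventually.of_forall fun v => ?_)
      rw [norm_mul, norm_mul, Real.norm_of_nonneg (Real.exp_pos _).le, Real.norm_eq_abs,
        Real.norm_eq_abs]
      have h2 : Real.exp (-(ε / 2) * v ^ 2) ≤ 1 := by
        rw [Real.exp_le_one_iff]
        have : 0 ≤ ε / 2 * v ^ 2 := by positivity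
        linarith
      calc _ ≤ 1 * |φ v| * 1 := by
            gcongr
            exact Real.abs_cos_le_one _
        _ = |φ v| := by ring
    · exact Eventually.of_forall fun y => (tendsto_integral_heatKernel_sub hμ hφ y).const_mul _
  have h2 : Tendsto (fun ε : ℝ => ∫ x, ∫ a, heatKernel 1 a * f (Real.sqrt ε * a - (-x)) ∂volume ∂μ)
      (𝓝[>] 0) (𝓝 (∫ x, f x ∂μ)) := by
    have hcont := f.continuous
    have hMi : Integrable fun a => heatKernel 1 a * M := (integrable_heatKernel one_pos).mul_const M
    have hbd : ∀ b a : ℝ, ‖heatKernel 1 a * f b‖ ≤ heatKernel 1 a * M := by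
      intro b a
      rw [norm_mul, Real.norm_of_nonneg (heatKernel_nonneg _ _)]
      gcongr
      · exact heatKernel_nonneg _ _
      · exact hM b
    refine tendsto_integral_filter_of_dominated_convergence (fun _ => M) ?_ ?_
      (integrable_const M) ?_
    · refine Eventually.of_forall fun ε => ?_
      have : StronglyMeasurable (fun p : ℝ × ℝ =>
          heatKernel 1 p.2 * f (Real.sqrt ε * p.2 - (-p.1))) :=
        Continuous.stronglyMeasurable (((continuous_heatKernel 1).comp continuous_snd).mul
          (hcont.comp (by fun_prop)))
      exact this.integral_prod_right'.aestronglyMeasurable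
    · refine Eventually.of_forall fun ε => Eventually.of_forall fun x => ?_
      have h3 := norm_integral_le_of_norm_le hMi (Eventually.of_forall
        fun a => hbd (Real.sqrt ε * a - (-x)) a)
      rwa [integral_mul_const, integral_heatKernel one_pos, one_mul] at h3
    · refine Eventually.of_forall fun x => ?_
      have h4 : f x = ∫ a, heatKernel 1 a * f x := by
        rw [integral_mul_const, integral_heatKernel one_pos, one_mul]
      rw [h4]
      refine tendsto_integral_filter_of_dominated_convergence _ ?_
        (Eventually.of_forall fun ε => Eventually.of_forall fun a => hbd _ a) hMi ?_
      · exact Eventually.of_forall fun ε => (((continuous_heatKernel 1)).mul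
          (hcont.comp (by fun_prop))).aestronglyMeasurable
      · refine Eventually.of_forall fun a => Tendsto.const_mul _ ?_
        have h5 : Tendsto (fun ε : ℝ => f (Real.sqrt ε * a - (-x))) (𝓝 0)
            (𝓝 (f (Real.sqrt 0 * a - (-x)))) :=
          (hcont.comp (by fun_prop : Continuous fun ε : ℝ => Real.sqrt ε * a - (-x))).tendsto 0
        simpa using h5.mono_left nhdsWithin_le_nhds
  refine tendsto_nhds_unique h2 (h1.congr' ?_)
  filter_upwards [self_mem_nhdsWithin] with ε hε
  exact hswap ε hε

/-- A law with integrable even characteristic function has the density given by Fourier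
inversion. -/
theorem eq_withDensity_cosTransform (hμ : ∀ u, charFun μ u = φ u) (hφ : Integrable φ) :
    μ = volume.withDensity fun y => ENNReal.ofReal (cosTransform φ y) := by
  have hc := continuous_cosTransform hφ
  have := IsLocallyFiniteMeasure.withDensity_ofReal (μ := volume) hc
  refine Measure.ext_of_integral_eq_on_compactlySupported fun f => ?_
  rw [integral_eq_integral_mul_cosTransform hμ hφ,
    integral_withDensity_eq_integral_toReal_smul (by fun_prop)
      (Eventually.of_forall fun _ => ENNReal.ofReal_lt_top)]
  refine integral_congr_ae (Eventually.of_forall fun y => ?_)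
  simp only
  rw [ENNReal.toReal_ofReal (cosTransform_nonneg hμ hφ y), smul_eq_mul, mul_comm]

theorem integral_eq_integral_cosTransform_mul (hμ : ∀ u, charFun μ u = φ u) (hφ : Integrable φ)
    (g : ℝ → ℝ) : ∫ x, g x ∂μ = ∫ y, cosTransform φ y * g y := by
  have hc := continuous_cosTransform hφ
  conv_lhs => rw [eq_withDensity_cosTransform hμ hφ]
  rw [integral_withDensity_eq_integral_toReal_smul (by fun_prop)
      (Eventually.of_forall fun _ => ENNReal.ofReal_lt_top)]
  refine integral_congr_ae (Eventually.of_forall fun y => ?_)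
  simp only
  rw [ENNReal.toReal_ofReal (cosTransform_nonneg hμ hφ y), smul_eq_mul]

end Density

/-! ### Time discretization and the Markov property of path functionals. -/

/-- The smallest multiple of `1 / (n + 1)` that is at least `r`. -/
noncomputable def gridTime (n : ℕ) (r : ℝ) : ℝ≥0 := (⌈r * (n + 1)⌉₊ : ℝ≥0) / (n + 1)

theorem le_gridTime (n : ℕ) (r : ℝ) : r.toNNReal ≤ gridTime n r := by
  rw [Real.toNNReal_le_iff_le_coe, gridTime]
  push_cast
  rw [le_div_iff₀ (by positivity)]
  exact Nat.le_ceil _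

/-- The grid times approach from the right, so right-continuity of the path is enough to pass to the
limit. -/
theorem tendsto_gridTime (r : ℝ) :
    Tendsto (fun n => gridTime n r) atTop (𝓝[Set.Ici r.toNNReal] r.toNNReal) := by
  refine tendsto_nhdsWithin_iff.mpr ⟨?_, Eventually.of_forall fun n => le_gridTime n r⟩
  rw [← NNReal.tendsto_coe]
  rcases le_or_gt 0 r with hr | hr
  · rw [Real.coe_toNNReal _ hr]
    have h := (tendsto_nat_ceil_mul_div_atTop hr).comp
      (tendsto_atTop_add_const_right atTop (1 : ℝ) tendsto_natCast_atTop_atTop)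
    refine h.congr fun n => ?_
    simp [gridTime]
  · have h0 : ∀ n : ℕ, gridTime n r = 0 := fun n => by
      have : ⌈r * (n + 1)⌉₊ = 0 := Nat.ceil_eq_zero.mpr
        (mul_nonpos_of_nonpos_of_nonneg hr.le (by positivity))
      rw [gridTime, this]; simp
    simp only [h0, Real.toNNReal_of_nonpos hr.le]
    exact tendsto_const_nhds

/-- Evaluation at a real time is not jointly measurable for the product σ-algebra on all paths. At
grid times only countably many coordinates enter, and measurability holds. -/
theorem measurable_eval_gridTime (n : ℕ) :
    Measurable fun p : (ℝ≥0 → ℝ) × ℝ => p.1 (gridTime n p.2) := by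
  have h1 : Measurable fun p : (ℝ≥0 → ℝ) × ℕ => p.1 ((p.2 : ℝ≥0) / (n + 1)) :=
    measurable_from_prod_countable_left fun k => by
      simpa using measurable_pi_apply ((k : ℝ≥0) / (n + 1))
  exact h1.comp (measurable_fst.prodMk (Nat.measurable_ceil.comp
    (measurable_snd.mul_const ((n : ℝ) + 1))))

/-- The integral of `g` along the path `w` over `(0, u]`. -/
noncomputable def pathIntegral (g : ℝ → ℝ) (u : ℝ) (w : ℝ≥0 → ℝ) : ℝ :=
  ∫ r in Set.Ioc 0 u, g (w r.toNNReal)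

/-- Discretization of `pathIntegral`, measurable for the product σ-algebra. -/
noncomputable def gridIntegral (n : ℕ) (g : ℝ → ℝ) (u : ℝ) (w : ℝ≥0 → ℝ) : ℝ :=
  ∫ r in Set.Ioc 0 u, g (w (gridTime n r))

theorem measurable_gridIntegral {E : Type*} [MeasurableSpace E] (n : ℕ) {g : ℝ → ℝ}
    (hg : Continuous g) (u : ℝ) {w : E → ℝ≥0 → ℝ} (hw : Measurable w) :
    Measurable fun e => gridIntegral n g u (w e) := by
  have h : StronglyMeasurable fun p : E × ℝ => g (w p.1 (gridTime n p.2)) :=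
    (hg.measurable.comp ((measurable_eval_gridTime n).comp
      ((hw.comp measurable_fst).prodMk measurable_snd))).stronglyMeasurable
  exact h.integral_prod_right'.measurable

theorem abs_gridIntegral_le {g : ℝ → ℝ} {C : ℝ} (hC : ∀ x, |g x| ≤ C) {u : ℝ} (hu : 0 ≤ u)
    (n : ℕ) (w : ℝ≥0 → ℝ) : |gridIntegral n g u w| ≤ C * u := by
  have := norm_setIntegral_le_of_norm_le_const (μ := volume) (s := Set.Ioc 0 u)
    (f := fun r => g (w (gridTime n r))) (C := C) (by simp) fun r _ => hC _
  simpa [hu, gridIntegral] using this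

theorem abs_pathIntegral_le {g : ℝ → ℝ} {C : ℝ} (hC : ∀ x, |g x| ≤ C) {u : ℝ} (hu : 0 ≤ u)
    (w : ℝ≥0 → ℝ) : |pathIntegral g u w| ≤ C * u := by
  have := norm_setIntegral_le_of_norm_le_const (μ := volume) (s := Set.Ioc 0 u)
    (f := fun r => g (w r.toNNReal)) (C := C) (by simp) fun r _ => hC _
  simpa [hu, pathIntegral] using this

theorem measurable_path {w : ℝ≥0 → ℝ} (hw : ∀ t, ContinuousWithinAt w (Set.Ici t) t) :
    Measurable fun r : ℝ => w r.toNNReal := by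
  refine measurable_of_tendsto_metrizable (f := fun n r => w (gridTime n r)) (fun n => ?_)
    (tendsto_pi_nhds.mpr fun r => (hw _).tendsto.comp (tendsto_gridTime r))
  exact (measurable_eval_gridTime n).comp (measurable_const.prodMk measurable_id)

theorem tendsto_gridIntegral {g : ℝ → ℝ} (hg : Continuous g) {C : ℝ} (hC : ∀ x, |g x| ≤ C)
    (u : ℝ) {w : ℝ≥0 → ℝ} (hw : ∀ t, ContinuousWithinAt w (Set.Ici t) t) :
    Tendsto (fun n => gridIntegral n g u w) atTop (𝓝 (pathIntegral g u w)) := by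
  refine tendsto_integral_of_dominated_convergence (fun _ => C) (fun n => ?_) (by simp)
    (fun n => Eventually.of_forall fun r => hC _) (Eventually.of_forall fun r => ?_)
  · exact (hg.measurable.comp ((measurable_eval_gridTime n).comp
      (measurable_const.prodMk measurable_id))).aestronglyMeasurable
  · exact (hg.tendsto _).comp ((hw _).tendsto.comp (tendsto_gridTime r))

namespace IsLevyProcess

variable {Ω : Type*} {mΩ : MeasurableSpace Ω} {P : Measure Ω}
  {ψ : ℝ → ℝ} {Z : ℝ≥0 → Ω → ℝ}

theorem measurable_paths (hZ : IsLevyProcess P ψ Z) : Measurable fun ω t => Z t ω :=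
  measurable_pi_lambda _ hZ.measurable

theorem measurable_uncurry (hZ : IsLevyProcess P ψ Z) :
    Measurable fun p : Ω × ℝ => Z p.2.toNNReal p.1 := by
  refine measurable_of_tendsto_metrizable (f := fun n p => Z (gridTime n p.2) p.1) (fun n => ?_)
    (tendsto_pi_nhds.mpr fun p => ?_)
  · exact (measurable_eval_gridTime n).comp
      ((hZ.measurable_paths.comp measurable_fst).prodMk measurable_snd)
  · have h := hZ.rightCont p.1 p.2.toNNReal
    exact Tendsto.comp (g := fun t => Z t p.1) h (tendsto_gridTime p.2)

theorem rightCont_shift (hZ : IsLevyProcess P ψ Z) (s : ℝ≥0) (ω : Ω) (t : ℝ≥0) :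
    ContinuousWithinAt (fun t => Z (s + t) ω) (Set.Ici t) t := by
  have h0 : Tendsto (fun r => s + r) (𝓝 t) (𝓝 (s + t)) :=
    (continuous_const.add continuous_id).tendsto t
  have h : Tendsto (fun r => s + r) (𝓝[Set.Ici t] t) (𝓝[Set.Ici (s + t)] (s + t)) := by
    refine tendsto_nhdsWithin_iff.mpr ⟨h0.mono_left nhdsWithin_le_nhds, ?_⟩
    filter_upwards [self_mem_nhdsWithin] with r hr
    rw [Set.mem_Ici] at hr ⊢
    gcongr
  exact (hZ.rightCont ω (s + t)).tendsto.comp h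

variable [IsProbabilityMeasure P]

/-- The simple Markov property for integral functionals of the path. -/
theorem integral_markov (hZ : IsLevyProcess P ψ Z) (s : ℝ≥0) {u : ℝ} (hu : 0 ≤ u)
    {f g Φ : ℝ → ℝ} (hf : Continuous f) (hg : Continuous g) (hΦ : Continuous Φ)
    {C D : ℝ} (hD : ∀ x, |f x| ≤ D) (hC : ∀ x, |g x| ≤ C) :
    ∫ ω, f (Z s ω) * Φ (pathIntegral g u fun r => Z (s + r) ω) ∂P =
      ∫ a, f a * ∫ ω, Φ (pathIntegral g u fun r => a + Z r ω) ∂P ∂(P.map (Z s)) := by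
  obtain ⟨B, hB⟩ := (isCompact_Icc (a := -(C * u)) (b := C * u)).exists_bound_of_continuousOn
    hΦ.continuousOn
  have hB1 : ∀ n w, ‖Φ (gridIntegral n g u w)‖ ≤ B := fun n w =>
    hB _ (abs_le.mp (abs_gridIntegral_le hC hu n w))
  have hB0 : 0 ≤ B := (norm_nonneg _).trans (hB1 0 0)
  have hD0 : 0 ≤ D := (abs_nonneg _).trans (hD 0)
  have hprob : IsProbabilityMeasure (P.map (Z s)) :=
    Measure.isProbabilityMeasure_map (hZ.measurable s).aemeasurable
  have hpaths := hZ.measurable_paths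
  have hfut : Measurable fun ω => (Z s ω, fun t => Z (s + t) ω - Z s ω) :=
    (hZ.measurable s).prodMk (measurable_pi_lambda _ fun t =>
      (hZ.measurable _).sub (hZ.measurable s))
  have hprob' : IsProbabilityMeasure (P.map fun ω t => Z t ω) :=
    Measure.isProbabilityMeasure_map hpaths.aemeasurable
  have hshift : Measurable fun p : ℝ × (ℝ≥0 → ℝ) => fun r => p.1 + p.2 r :=
    measurable_pi_lambda _ fun r => measurable_fst.add ((measurable_pi_apply r).comp measurable_snd)
  -- The product law of present and future can be applied only to functionals measurable on path
  -- space. It is used for the discretized integral, and bounded convergence removes the grid on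
  -- both sides.
  have hgrid : ∀ n, ∫ ω, f (Z s ω) * Φ (gridIntegral n g u fun r => Z (s + r) ω) ∂P =
      ∫ a, f a * ∫ ω, Φ (gridIntegral n g u fun r => a + Z r ω) ∂P ∂(P.map (Z s)) := by
    intro n
    have hm : Measurable fun p : ℝ × (ℝ≥0 → ℝ) =>
        f p.1 * Φ (gridIntegral n g u fun r => p.1 + p.2 r) :=
      (hf.measurable.comp measurable_fst).mul
        (hΦ.measurable.comp (measurable_gridIntegral n hg u hshift))
    have hi : Integrable (fun p : ℝ × (ℝ≥0 → ℝ) =>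
        f p.1 * Φ (gridIntegral n g u fun r => p.1 + p.2 r))
        ((P.map (Z s)).prod (P.map fun ω t => Z t ω)) :=
      (integrable_const (D * B)).mono' hm.aestronglyMeasurable (Eventually.of_forall fun p => by
        rw [norm_mul]
        exact mul_le_mul (hD _) (hB1 _ _) (norm_nonneg _) hD0)
    have h1 : ∫ ω, f (Z s ω) * Φ (gridIntegral n g u fun r => Z (s + r) ω) ∂P =
        ∫ p, f p.1 * Φ (gridIntegral n g u fun r => p.1 + p.2 r)
          ∂((P.map (Z s)).prod (P.map fun ω t => Z t ω)) := by
      rw [← hZ.markov s, integral_map hfut.aemeasurable hm.aestronglyMeasurable]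
      simp only [add_sub_cancel]
    rw [h1, integral_prod _ hi]
    refine integral_congr_ae (Eventually.of_forall fun a => ?_)
    simp only
    rw [integral_const_mul, integral_map hpaths.aemeasurable]
    exact (hΦ.measurable.comp (measurable_gridIntegral n hg u
      (hshift.comp (measurable_const.prodMk measurable_id)))).aestronglyMeasurable
  have hL : Tendsto (fun n => ∫ ω, f (Z s ω) * Φ (gridIntegral n g u fun r => Z (s + r) ω) ∂P)
      atTop (𝓝 (∫ ω, f (Z s ω) * Φ (pathIntegral g u fun r => Z (s + r) ω) ∂P)) := by
    refine tendsto_integral_of_dominated_convergence (fun _ => D * B) (fun n => ?_)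
      (integrable_const _) (fun n => Eventually.of_forall fun ω => ?_)
      (Eventually.of_forall fun ω => ?_)
    · exact ((hf.measurable.comp (hZ.measurable s)).mul (hΦ.measurable.comp
        (measurable_gridIntegral n hg u (measurable_pi_lambda _ fun r =>
          hZ.measurable (s + r))))).aestronglyMeasurable
    · rw [norm_mul]
      exact mul_le_mul (hD _) (hB1 _ _) (norm_nonneg _) hD0
    · exact ((hΦ.tendsto _).comp (tendsto_gridIntegral hg hC u
        (hZ.rightCont_shift s ω))).const_mul _
  have hR : Tendsto (fun n => ∫ a, f a * ∫ ω, Φ (gridIntegral n g u fun r => a + Z r ω) ∂P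
      ∂(P.map (Z s))) atTop
      (𝓝 (∫ a, f a * ∫ ω, Φ (pathIntegral g u fun r => a + Z r ω) ∂P ∂(P.map (Z s)))) := by
    have hmeas : ∀ n, Measurable fun p : ℝ × Ω =>
        Φ (gridIntegral n g u fun r => p.1 + Z r p.2) := fun n =>
      hΦ.measurable.comp (measurable_gridIntegral n hg u (measurable_pi_lambda _ fun r =>
        measurable_fst.add ((hZ.measurable r).comp measurable_snd)))
    refine tendsto_integral_of_dominated_convergence (fun _ => D * B) (fun n => ?_)
      (integrable_const _) (fun n => Eventually.of_forall fun a => ?_)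
      (Eventually.of_forall fun a => ?_)
    · exact hf.aestronglyMeasurable.mul
        (hmeas n).stronglyMeasurable.integral_prod_right'.aestronglyMeasurable
    · rw [norm_mul]
      refine mul_le_mul (hD _) ?_ (norm_nonneg _) hD0
      have := norm_integral_le_of_norm_le (μ := P) (integrable_const B)
        (Eventually.of_forall fun ω => hB1 n fun r => a + Z r ω)
      simpa using this
    · refine Tendsto.const_mul _ (tendsto_integral_of_dominated_convergence (fun _ => B)
        (fun n => ?_) (integrable_const _) (fun n => Eventually.of_forall fun ω => hB1 n _)
        (Eventually.of_forall fun ω => ?_))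
      · exact ((hmeas n).comp (measurable_const.prodMk measurable_id)).aestronglyMeasurable
      · exact (hΦ.tendsto _).comp (tendsto_gridIntegral hg hC u fun t =>
          continuousWithinAt_const.add (hZ.rightCont ω t))
  exact tendsto_nhds_unique hL (hR.congr fun n => (hgrid n).symm)

end IsLevyProcess

/-- The variable endpoint is moved into an indicator, leaving an integral over a fixed domain with a
jointly measurable integrand. -/
theorem measurable_pathIntegral {E : Type*} [MeasurableSpace E] {g : ℝ → ℝ} (hg : Continuous g)
    {u : E → ℝ} (hu : Measurable u) {w : E → ℝ≥0 → ℝ}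
    (hw : Measurable fun p : E × ℝ => w p.1 p.2.toNNReal) :
    Measurable fun e => pathIntegral g (u e) (w e) := by
  have h1 : ∀ e, pathIntegral g (u e) (w e) =
      ∫ r, {p : E × ℝ | 0 < p.2 ∧ p.2 ≤ u p.1}.indicator (fun p => g (w p.1 p.2.toNNReal))
        (e, r) := by
    intro e
    rw [pathIntegral, ← integral_indicator measurableSet_Ioc]
    congr 1
  have hs : MeasurableSet {p : E × ℝ | 0 < p.2 ∧ p.2 ≤ u p.1} :=
    (measurableSet_lt measurable_const measurable_snd).inter
      (measurableSet_le measurable_snd (hu.comp measurable_fst))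
  have h2 : StronglyMeasurable ({p : E × ℝ | 0 < p.2 ∧ p.2 ≤ u p.1}.indicator
      fun p => g (w p.1 p.2.toNNReal)) :=
    (hg.measurable.comp hw).stronglyMeasurable.indicator hs
  simp_rw [h1]
  exact h2.integral_prod_right'.measurable

/-! ### Pathwise identities splitting at the running time. -/

section Pathwise

variable {f g : ℝ → ℝ} {C D t : ℝ}

theorem intervalIntegrable_of_bounded (hf : Measurable f) (hC : ∀ s, |f s| ≤ C) (a b : ℝ) :
    IntervalIntegrable f volume a b :=
  (intervalIntegrable_const (c := C)).mono_fun' hf.aestronglyMeasurable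
    (Eventually.of_forall hC)

theorem continuous_remainingIntegral (hf : Measurable f) (hC : ∀ s, |f s| ≤ C) :
    Continuous fun s => ∫ r in s..t, f r := by
  have h := intervalIntegral.continuous_primitive
    (fun a b => intervalIntegrable_of_bounded hf hC a b) t
  refine h.neg.congr fun s => ?_
  rw [intervalIntegral.integral_symm t s]
  rfl

theorem hasDerivWithinAt_remainingIntegral (hf : Measurable f) (hC : ∀ s, |f s| ≤ C) {s : ℝ}
    (hs : ContinuousWithinAt f (Set.Ioi s) s) :
    HasDerivWithinAt (fun s => ∫ r in s..t, f r) (-f s) (Set.Ioi s) s :=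
  (intervalIntegral.integral_hasDerivWithinAt_left (s := Set.Ici s) (t := Set.Ioi s)
    (intervalIntegrable_of_bounded hf hC s t)
    (hf.stronglyMeasurable.stronglyMeasurableAtFilter) hs).mono Set.Ioi_subset_Ici_self

/-- This is the fundamental theorem of calculus for `s ↦ exp(-θ ∫ₛᵗ f)`. Differentiating in the
lower endpoint leaves only the path after `s` in the exponential, the form the Markov property
needs. A right derivative suffices, as `f` is only right-continuous. -/
theorem exp_neg_integral_eq (hf : Measurable f) (hC : ∀ s, |f s| ≤ C)
    (hr : ∀ s, ContinuousWithinAt f (Set.Ioi s) s) (θ : ℝ) :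
    Real.exp (-θ * ∫ r in 0..t, f r) =
      1 - θ * ∫ s in 0..t, f s * Real.exp (-θ * ∫ r in s..t, f r) := by
  have hcont : Continuous fun s => Real.exp (-θ * ∫ r in s..t, f r) :=
    Real.continuous_exp.comp (continuous_const.mul (continuous_remainingIntegral hf hC))
  have h := intervalIntegral.integral_eq_sub_of_hasDeriv_right (a := 0) (b := t)
    (f := fun s => Real.exp (-θ * ∫ r in s..t, f r))
    (f' := fun s => θ * (f s * Real.exp (-θ * ∫ r in s..t, f r)))
    hcont.continuousOn
    (fun s _ => by
      refine (((hasDerivWithinAt_remainingIntegral hf hC (hr s)).const_mul (-θ)).exp).congr_deriv ?_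
      ring)
    (((intervalIntegrable_of_bounded hf hC 0 t).mul_continuousOn hcont.continuousOn).const_mul θ)
  rw [intervalIntegral.integral_const_mul] at h
  simp only [intervalIntegral.integral_same, mul_zero, Real.exp_zero] at h
  linarith

/-- The square of times is split according to which variable comes first; in each half the remaining
integral involves only the future. -/
theorem integral_mul_integral_eq (hf : Measurable f) (hC : ∀ s, |f s| ≤ C)
    (hr : ∀ s, ContinuousWithinAt f (Set.Ioi s) s) (hg : Measurable g) (hD : ∀ s, |g s| ≤ D)
    (hr' : ∀ s, ContinuousWithinAt g (Set.Ioi s) s) :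
    (∫ r in 0..t, f r) * ∫ r in 0..t, g r =
      (∫ s in 0..t, f s * ∫ r in s..t, g r) + ∫ s in 0..t, g s * ∫ r in s..t, f r := by
  have hcf := continuous_remainingIntegral (t := t) hf hC
  have hcg := continuous_remainingIntegral (t := t) hg hD
  have h1 := (intervalIntegrable_of_bounded hf hC 0 t).mul_continuousOn hcg.continuousOn
  have h2 := (intervalIntegrable_of_bounded hg hD 0 t).mul_continuousOn hcf.continuousOn
  have h := intervalIntegral.integral_eq_sub_of_hasDeriv_right (a := 0) (b := t)
    (f := fun s => (∫ r in s..t, f r) * ∫ r in s..t, g r)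
    (f' := fun s => -(f s * (∫ r in s..t, g r) + g s * ∫ r in s..t, f r))
    (hcf.mul hcg).continuousOn
    (fun s _ => by
      refine ((hasDerivWithinAt_remainingIntegral hf hC (hr s)).mul
        (hasDerivWithinAt_remainingIntegral hg hD (hr' s))).congr_deriv ?_
      ring)
    (h1.add h2).neg
  rw [intervalIntegral.integral_neg, intervalIntegral.integral_add h1 h2] at h
  simp only [intervalIntegral.integral_same, mul_zero] at h
  linarith

end Pathwise

section PathIdentities

variable {f g : ℝ → ℝ} {C D t : ℝ} {w : ℝ≥0 → ℝ}

theorem continuousWithinAt_path (hg : Continuous g)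
    (hw : ∀ t, ContinuousWithinAt w (Set.Ici t) t) (s : ℝ) :
    ContinuousWithinAt (fun r : ℝ => g (w r.toNNReal)) (Set.Ioi s) s := by
  have h : Tendsto Real.toNNReal (𝓝[>] s) (𝓝[≥] s.toNNReal) := by
    refine tendsto_nhdsWithin_iff.mpr ⟨(continuous_real_toNNReal.tendsto s).mono_left
      nhdsWithin_le_nhds, ?_⟩
    filter_upwards [self_mem_nhdsWithin] with r hr
    exact Real.toNNReal_le_toNNReal (le_of_lt hr)
  exact (hg.tendsto _).comp ((hw s.toNNReal).tendsto.comp h)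

theorem pathIntegral_shift (g : ℝ → ℝ) {s : ℝ} (hs : 0 ≤ s) (hst : s ≤ t) (w : ℝ≥0 → ℝ) :
    pathIntegral g (t - s) (fun r => w (s.toNNReal + r)) = ∫ r in s..t, g (w r.toNNReal) := by
  have h := intervalIntegral.integral_comp_add_left (a := 0) (b := t - s)
    (fun r => g (w r.toNNReal)) s
  rw [add_zero, add_sub_cancel] at h
  rw [← h, intervalIntegral.integral_of_le (by linarith), pathIntegral]
  refine setIntegral_congr_fun measurableSet_Ioc fun r hr => ?_
  rw [Real.toNNReal_add hs hr.1.le]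

theorem pathIntegral_eq (g : ℝ → ℝ) (ht : 0 ≤ t) (w : ℝ≥0 → ℝ) :
    pathIntegral g t w = ∫ r in 0..t, g (w r.toNNReal) := by
  rw [pathIntegral, intervalIntegral.integral_of_le ht]

theorem exp_neg_pathIntegral (ht : 0 ≤ t) (hg : Continuous g) (hC : ∀ s, |g s| ≤ C)
    (hw : ∀ t, ContinuousWithinAt w (Set.Ici t) t) (θ : ℝ) :
    Real.exp (-θ * pathIntegral g t w) = 1 - θ * ∫ s in Set.Ioc 0 t, g (w s.toNNReal) *
      Real.exp (-θ * pathIntegral g (t - s) fun r => w (s.toNNReal + r)) := by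
  rw [pathIntegral_eq g ht, exp_neg_integral_eq (f := fun r => g (w r.toNNReal))
    (hg.measurable.comp (measurable_path hw))
    (fun s => hC _) (continuousWithinAt_path hg hw), intervalIntegral.integral_of_le ht]
  congr 2
  refine setIntegral_congr_fun measurableSet_Ioc fun r hr => ?_
  rw [pathIntegral_shift g hr.1.le hr.2]

theorem pathIntegral_mul_pathIntegral (ht : 0 ≤ t) (hf : Continuous f) (hC : ∀ s, |f s| ≤ C)
    (hg : Continuous g) (hD : ∀ s, |g s| ≤ D) (hw : ∀ t, ContinuousWithinAt w (Set.Ici t) t) :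
    pathIntegral f t w * pathIntegral g t w =
      (∫ s in Set.Ioc 0 t, f (w s.toNNReal) *
        pathIntegral g (t - s) fun r => w (s.toNNReal + r)) +
      ∫ s in Set.Ioc 0 t, g (w s.toNNReal) *
        pathIntegral f (t - s) fun r => w (s.toNNReal + r) := by
  rw [pathIntegral_eq f ht, pathIntegral_eq g ht, integral_mul_integral_eq
    (f := fun r => f (w r.toNNReal)) (g := fun r => g (w r.toNNReal)) (hf.measurable.comp (measurable_path hw)) (fun s => hC _) (continuousWithinAt_path hf hw)
    (hg.measurable.comp (measurable_path hw)) (fun s => hD _) (continuousWithinAt_path hg hw),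
    intervalIntegral.integral_of_le ht, intervalIntegral.integral_of_le ht]
  congr 1 <;>
  · refine setIntegral_congr_fun measurableSet_Ioc fun r hr => ?_
    rw [pathIntegral_shift _ hr.1.le hr.2]

end PathIdentities

namespace IsLevyProcess

variable {Ω : Type*} {mΩ : MeasurableSpace Ω} {P : Measure Ω}
  {ψ : ℝ → ℝ} {Z : ℝ≥0 → Ω → ℝ}

theorem measurable_pathIntegral_shift (hZ : IsLevyProcess P ψ Z) {g : ℝ → ℝ} (hg : Continuous g)
    (t : ℝ) : Measurable fun p : Ω × ℝ =>
      pathIntegral g (t - p.2) fun r => Z (p.2.toNNReal + r) p.1 := by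
  refine measurable_pathIntegral hg (measurable_const.sub measurable_snd) ?_
  -- Conversion to `ℝ≥0` is additive only on nonnegative reals, so both times are truncated at zero
  -- before being added; the truncation does not change the converted times.
  have h : Measurable fun p : (Ω × ℝ) × ℝ => (p.1.1, max p.1.2 0 + max p.2 0) := by fun_prop
  refine (congrArg Measurable (funext fun p => ?_)).mp (hZ.measurable_uncurry.comp h)
  have hmax : ∀ r : ℝ, (max r 0).toNNReal = r.toNNReal := fun r => by
    rw [← Real.coe_toNNReal', Real.toNNReal_coe]
  simp only [Function.comp]
  rw [Real.toNNReal_add (le_max_right _ _) (le_max_right _ _), hmax, hmax]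

variable [IsProbabilityMeasure P]

/-- Decomposition of an integral functional at the time of the running point. -/
theorem integral_path_decomposition (hZ : IsLevyProcess P ψ Z) {t : ℝ}
    {f g Φ : ℝ → ℝ} (hf : Continuous f) (hg : Continuous g) (hΦ : Continuous Φ)
    {C D : ℝ} (hD : ∀ x, |f x| ≤ D) (hC : ∀ x, |g x| ≤ C) :
    Integrable (fun ω => ∫ s in Set.Ioc 0 t, f (Z s.toNNReal ω) *
      Φ (pathIntegral g (t - s) fun r => Z (s.toNNReal + r) ω)) P ∧
    ∫ ω, (∫ s in Set.Ioc 0 t, f (Z s.toNNReal ω) *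
      Φ (pathIntegral g (t - s) fun r => Z (s.toNNReal + r) ω)) ∂P =
    ∫ s in Set.Ioc 0 t, ∫ a, f a * ∫ ω, Φ (pathIntegral g (t - s) fun r => a + Z r ω) ∂P
      ∂(P.map (Z s.toNNReal)) := by
  have hC0 : 0 ≤ C := (abs_nonneg _).trans (hC 0)
  have hD0 : 0 ≤ D := (abs_nonneg _).trans (hD 0)
  obtain ⟨B, hB⟩ := (isCompact_Icc (a := -(C * t)) (b := C * t)).exists_bound_of_continuousOn
    hΦ.continuousOn
  have hm : Measurable fun p : Ω × ℝ => f (Z p.2.toNNReal p.1) *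
      Φ (pathIntegral g (t - p.2) fun r => Z (p.2.toNNReal + r) p.1) :=
    (hf.measurable.comp hZ.measurable_uncurry).mul
      (hΦ.measurable.comp (hZ.measurable_pathIntegral_shift hg t))
  have hint : Integrable (Function.uncurry fun ω s => f (Z s.toNNReal ω) *
      Φ (pathIntegral g (t - s) fun r => Z (s.toNNReal + r) ω))
      (P.prod (volume.restrict (Set.Ioc 0 t))) := by
    refine (integrable_const (D * B)).mono' hm.aestronglyMeasurable ?_
    have h1 : ∀ᵐ p ∂(P.prod (volume.restrict (Set.Ioc 0 t))), p.2 ∈ Set.Ioc 0 t :=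
      Measure.quasiMeasurePreserving_snd.ae (ae_restrict_mem measurableSet_Ioc)
    filter_upwards [h1] with p hp
    simp only [Function.uncurry]
    rw [norm_mul]
    refine mul_le_mul (hD _) (hB _ (abs_le.mp ?_)) (norm_nonneg _) hD0
    refine (abs_pathIntegral_le hC (by linarith [hp.2]) _).trans ?_
    gcongr
    linarith [hp.1]
  refine ⟨hint.integral_prod_left, ?_⟩
  rw [integral_integral_swap hint]
  refine setIntegral_congr_fun measurableSet_Ioc fun s hs => ?_
  exact hZ.integral_markov _ (by linarith [hs.2]) hf hg hΦ hD hC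

end IsLevyProcess

/-! ### Mollified local times and limits of their moments. -/

/-- The density of the transition law with symbol `ψ` at time `s`. -/
noncomputable def transitionDensity (ψ : ℝ → ℝ) (s y : ℝ) : ℝ :=
  cosTransform (fun v => Real.exp (-s * ψ v)) y

namespace IsSymbol

variable {ψ : ℝ → ℝ}

theorem transitionDensity_zero (ψ : ℝ → ℝ) (s : ℝ) :
    transitionDensity ψ s 0 = returnDensity ψ s := by
  simp [transitionDensity, returnDensity, cosTransform]

theorem abs_transitionDensity_le (hψ : IsSymbol ψ) {s : ℝ} (hs : 0 < s) (y : ℝ) :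
    |transitionDensity ψ s y| ≤ returnDensity ψ s := by
  have h := abs_cosTransform_le (hψ.integrable_exp hs) y
  simpa only [Real.abs_exp, transitionDensity, returnDensity] using h

theorem continuous_transitionDensity (hψ : IsSymbol ψ) {s : ℝ} (hs : 0 < s) :
    Continuous (transitionDensity ψ s) :=
  continuous_cosTransform (hψ.integrable_exp hs)

theorem measurable_transitionDensity (hψ : IsSymbol ψ) :
    Measurable fun p : ℝ × ℝ => transitionDensity ψ p.1 p.2 := by
  have hc := hψ.continuous
  have h : StronglyMeasurable fun p : (ℝ × ℝ) × ℝ =>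
      Real.cos (p.2 * p.1.2) * Real.exp (-p.1.1 * ψ p.2) :=
    Continuous.stronglyMeasurable (by fun_prop)
  exact h.integral_prod_right'.measurable.const_mul _

/-- Smoothed convolutions against the transition density converge to convolutions against the
return density. -/
theorem tendsto_smoothed_convolution (hψ : IsSymbol ψ) {ι : Type*} {l : Filter ι}
    [l.IsCountablyGenerated] {ε x y : ι → ℝ} (hε : Tendsto ε l (𝓝 0)) (hx : Tendsto x l (𝓝 0))
    (hy : Tendsto y l (𝓝 0)) {t B : ℝ} (ht : 0 ≤ t) {H : ι → ℝ → ℝ → ℝ} {G : ℝ → ℝ}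
    (hm : ∀ i, Measurable fun p : ℝ × ℝ => H i p.1 p.2)
    (hB : ∀ᶠ i in l, ∀ u ∈ Set.Icc 0 t, ∀ z, |H i u z| ≤ B)
    (hH : ∀ u ∈ Set.Ico 0 t, ∀ z : ι → ℝ, Tendsto z l (𝓝 0) →
      Tendsto (fun i => H i u (z i)) l (𝓝 (G u))) :
    Tendsto (fun i => ∫ s in Set.Ioc 0 t, ∫ a, heatKernel 1 a *
      (transitionDensity ψ s (Real.sqrt (ε i) * a - x i) *
        H i (t - s) (y i + (Real.sqrt (ε i) * a - x i)))) l
      (𝓝 (∫ s in Set.Ioc 0 t, returnDensity ψ s * G (t - s))) := by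
  have hφ := integrable_heatKernel one_pos
  have hmeas : ∀ i, Measurable fun p : ℝ × ℝ => heatKernel 1 p.2 *
      (transitionDensity ψ p.1 (Real.sqrt (ε i) * p.2 - x i) *
        H i (t - p.1) (y i + (Real.sqrt (ε i) * p.2 - x i))) := fun i => by
    have h1 : Measurable fun p : ℝ × ℝ => (p.1, Real.sqrt (ε i) * p.2 - x i) := by fun_prop
    have h2 : Measurable fun p : ℝ × ℝ => (t - p.1, y i + (Real.sqrt (ε i) * p.2 - x i)) := by
      fun_prop
    exact ((continuous_heatKernel 1).measurable.comp measurable_snd).mul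
      ((hψ.measurable_transitionDensity.comp h1).mul ((hm i).comp h2))
  -- The transition density is largest at the origin, so the return density, integrable on `(0, t]`,
  -- dominates uniformly in mollification and level.
  have hbd : ∀ᶠ i in l, ∀ s ∈ Set.Ioc 0 t, ∀ a, ‖heatKernel 1 a *
      (transitionDensity ψ s (Real.sqrt (ε i) * a - x i) *
        H i (t - s) (y i + (Real.sqrt (ε i) * a - x i)))‖ ≤
      heatKernel 1 a * (returnDensity ψ s * B) := by
    filter_upwards [hB] with i hi s hs a
    rw [norm_mul, norm_mul, Real.norm_of_nonneg (heatKernel_nonneg _ _)]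
    refine mul_le_mul_of_nonneg_left ?_ (heatKernel_nonneg _ _)
    exact mul_le_mul (hψ.abs_transitionDensity_le hs.1 _)
      (hi _ ⟨by linarith [hs.2], by linarith [hs.1]⟩ _) (norm_nonneg _)
      (returnDensity_nonneg ψ s)
  refine tendsto_integral_filter_of_dominated_convergence (fun s => returnDensity ψ s * B)
    (Eventually.of_forall fun i =>
      (hmeas i).stronglyMeasurable.integral_prod_right'.aestronglyMeasurable) ?_
    ((hψ.integrableOn_returnDensity ht).mul_const B) ?_
  · filter_upwards [hbd] with i hi
    refine (ae_restrict_iff' measurableSet_Ioc).mpr (Eventually.of_forall fun s hs => ?_)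
    have := norm_integral_le_of_norm_le (hφ.mul_const (returnDensity ψ s * B))
      (Eventually.of_forall (hi s hs))
    rwa [integral_mul_const, integral_heatKernel one_pos, one_mul] at this
  · refine (ae_restrict_iff' measurableSet_Ioc).mpr (Eventually.of_forall fun s hs => ?_)
    have hlim : returnDensity ψ s * G (t - s) =
        ∫ a, heatKernel 1 a * (returnDensity ψ s * G (t - s)) := by
      rw [integral_mul_const, integral_heatKernel one_pos, one_mul]
    -- The limit is written as an average over the heat kernel of a constant, so that the inner
    -- integral is again a dominated limit with the same kernel.
    rw [hlim]
    refine tendsto_integral_filter_of_dominated_convergence _ (Eventually.of_forall fun i =>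
      ((hmeas i).comp (measurable_const.prodMk measurable_id)).aestronglyMeasurable) ?_
      (hφ.mul_const (returnDensity ψ s * B)) (Eventually.of_forall fun a => ?_)
    · filter_upwards [hbd] with i hi
      exact Eventually.of_forall (hi s hs)
    · have hz : Tendsto (fun i => Real.sqrt (ε i) * a - x i) l (𝓝 0) := by
        have h1 : Tendsto (fun i => Real.sqrt (ε i)) l (𝓝 0) := by
          simpa [Function.comp_def] using (Real.continuous_sqrt.tendsto 0).comp hε
        simpa using (h1.mul_const a).sub hx
      refine Tendsto.const_mul _ (Tendsto.mul ?_ ?_)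
      · have := ((hψ.continuous_transitionDensity hs.1).tendsto 0).comp hz
        rwa [transitionDensity_zero] at this
      · refine hH _ ⟨by linarith [hs.2], by linarith [hs.1]⟩ _ ?_
        simpa using hy.add hz

end IsSymbol

theorem heatKernel_le_const (ε x : ℝ) : |heatKernel ε x| ≤ 1 / Real.sqrt (2 * Real.pi * ε) := by
  rw [abs_of_nonneg (heatKernel_nonneg _ _)]
  rcases lt_or_ge 0 ε with hε | hε
  · exact heatKernel_le ε x hε
  · have : Real.sqrt (2 * Real.pi * ε) = 0 :=
      Real.sqrt_eq_zero_of_nonpos (mul_nonpos_of_nonneg_of_nonpos (by positivity) hε)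
    rw [heatKernel, this]; simp

/-- The mollified local time of `Z` at the level `-x` up to time `u`. -/
noncomputable def mollifiedLocalTime {Ω : Type*} (Z : ℝ≥0 → Ω → ℝ) (ε x u : ℝ) (ω : Ω) : ℝ :=
  pathIntegral (fun a => heatKernel ε (x + a)) u fun t => Z t ω

theorem mollifiedLocalTime_nonneg {Ω : Type*} (Z : ℝ≥0 → Ω → ℝ) (ε x u : ℝ) (ω : Ω) :
    0 ≤ mollifiedLocalTime Z ε x u ω :=
  integral_nonneg fun _ => heatKernel_nonneg _ _

theorem abs_mollifiedLocalTime_le {Ω : Type*} (Z : ℝ≥0 → Ω → ℝ) (ε x : ℝ) {u : ℝ} (hu : 0 ≤ u)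
    (ω : Ω) : |mollifiedLocalTime Z ε x u ω| ≤ 1 / Real.sqrt (2 * Real.pi * ε) * u :=
  abs_pathIntegral_le (fun _ => heatKernel_le_const _ _) hu _

namespace IsLevyProcess

variable {Ω : Type*} {mΩ : MeasurableSpace Ω} {P : Measure Ω}
  {ψ : ℝ → ℝ} {Z : ℝ≥0 → Ω → ℝ}

theorem measurable_mollifiedLocalTime (hZ : IsLevyProcess P ψ Z) (ε : ℝ) :
    Measurable fun p : (ℝ × ℝ) × Ω => mollifiedLocalTime Z ε p.1.2 p.1.1 p.2 := by
  have h1 : ∀ p : (ℝ × ℝ) × Ω, mollifiedLocalTime Z ε p.1.2 p.1.1 p.2 =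
      pathIntegral (heatKernel ε) p.1.1 fun t => p.1.2 + Z t p.2 := fun p => rfl
  simp_rw [h1]
  refine measurable_pathIntegral (continuous_heatKernel ε) (by fun_prop) ?_
  have h2 : Measurable fun q : ((ℝ × ℝ) × Ω) × ℝ => (q.1.2, q.2) := by fun_prop
  exact (measurable_snd.comp (measurable_fst.comp measurable_fst)).add
    (hZ.measurable_uncurry.comp h2)

theorem measurable_mollifiedLocalTime_apply (hZ : IsLevyProcess P ψ Z) (ε x u : ℝ) :
    Measurable (mollifiedLocalTime Z ε x u) := by
  exact measurable_pathIntegral (w := fun ω t => Z t ω) (u := fun _ => u) (by fun_prop)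
    measurable_const hZ.measurable_uncurry

variable [IsProbabilityMeasure P]

theorem memLp_mollifiedLocalTime (hZ : IsLevyProcess P ψ Z) (ε x : ℝ) {u : ℝ} (hu : 0 ≤ u)
    (p : ℝ≥0∞) : MemLp (mollifiedLocalTime Z ε x u) p P :=
  MemLp.of_bound (hZ.measurable_mollifiedLocalTime_apply ε x u).aestronglyMeasurable _
    (Eventually.of_forall fun ω => abs_mollifiedLocalTime_le Z ε x hu ω)

theorem measurable_integral_comp_mollifiedLocalTime (hZ : IsLevyProcess P ψ Z) (ε : ℝ)
    {Φ : ℝ → ℝ} (hΦ : Continuous Φ) :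
    Measurable fun p : ℝ × ℝ => ∫ ω, Φ (mollifiedLocalTime Z ε p.2 p.1 ω) ∂P :=
  (hΦ.measurable.comp (hZ.measurable_mollifiedLocalTime
    ε)).stronglyMeasurable.integral_prod_right'.measurable

theorem integral_map_eq (hZ : IsLevyProcess P ψ Z) (hψ : IsSymbol ψ) {s : ℝ} (hs : 0 < s)
    (g : ℝ → ℝ) :
    ∫ a, g a ∂(P.map (Z s.toNNReal)) = ∫ a, transitionDensity ψ s a * g a := by
  have : IsProbabilityMeasure (P.map (Z s.toNNReal)) :=
    Measure.isProbabilityMeasure_map (hZ.measurable _).aemeasurable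
  refine integral_eq_integral_cosTransform_mul (fun u => ?_) (hψ.integrable_exp hs) g
  rw [hZ.charFun_map, Real.coe_toNNReal _ hs.le]

/-- The Markov property at time `s` replaces the past by the transition density. Rescaling space by
`√ε` then fixes the Gaussian weight, so `ε` survives only in arguments that tend to the levels. -/
theorem integral_mollified_decomposition (hZ : IsLevyProcess P ψ Z) (hψ : IsSymbol ψ) (t : ℝ)
    {ε : ℝ} (hε : 0 < ε) (δ x y : ℝ) {Φ : ℝ → ℝ} (hΦ : Continuous Φ) :
    ∫ ω, (∫ s in Set.Ioc 0 t, heatKernel ε (x + Z s.toNNReal ω) *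
      Φ (pathIntegral (fun a => heatKernel δ (y + a)) (t - s)
        fun r => Z (s.toNNReal + r) ω)) ∂P =
    ∫ s in Set.Ioc 0 t, ∫ a, heatKernel 1 a *
      (transitionDensity ψ s (Real.sqrt ε * a - x) *
        ∫ ω, Φ (mollifiedLocalTime Z δ (y + (Real.sqrt ε * a - x)) (t - s) ω) ∂P) := by
  rw [(hZ.integral_path_decomposition (f := fun a => heatKernel ε (x + a)) (by fun_prop)
    (by fun_prop) hΦ (fun _ => heatKernel_le_const _ _) (fun _ => heatKernel_le_const _ _)).2]
  refine setIntegral_congr_fun measurableSet_Ioc fun s hs => ?_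
  rw [hZ.integral_map_eq hψ hs.1, ← integral_heatKernel_mul hε x fun a =>
    transitionDensity ψ s a * ∫ ω, Φ (mollifiedLocalTime Z δ (y + a) (t - s) ω) ∂P]
  refine integral_congr_ae (Eventually.of_forall fun a => ?_)
  simp only [mollifiedLocalTime, pathIntegral, add_assoc]
  ring

theorem integral_mollifiedLocalTime (hZ : IsLevyProcess P ψ Z) (hψ : IsSymbol ψ) (t : ℝ)
    {ε : ℝ} (hε : 0 < ε) (x : ℝ) :
    ∫ ω, mollifiedLocalTime Z ε x t ω ∂P = ∫ s in Set.Ioc 0 t, ∫ a, heatKernel 1 a *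
      (transitionDensity ψ s (Real.sqrt ε * a - x) * 1) := by
  -- For a constant functional the future plays no role, so its mollification `1` and level `0` are
  -- arbitrary.
  have h := hZ.integral_mollified_decomposition hψ t hε 1 x 0 (Φ := fun _ => 1) continuous_const
  simpa [mollifiedLocalTime, pathIntegral] using h

theorem integral_mollifiedLocalTime_le (hZ : IsLevyProcess P ψ Z) (hψ : IsSymbol ψ) {u t : ℝ}
    (hu : 0 ≤ u) (hut : u ≤ t) {ε : ℝ} (hε : 0 < ε) (x : ℝ) :
    |∫ ω, mollifiedLocalTime Z ε x u ω ∂P| ≤ ∫ s in Set.Ioc 0 t, returnDensity ψ s := by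
  have ht := hu.trans hut
  rw [hZ.integral_mollifiedLocalTime hψ u hε, ← Real.norm_eq_abs]
  refine (norm_integral_le_of_norm_le (hψ.integrableOn_returnDensity hu) ?_).trans
    (setIntegral_mono_set (hψ.integrableOn_returnDensity ht)
      (Eventually.of_forall fun s => IsSymbol.returnDensity_nonneg ψ s)
      (Set.Ioc_subset_Ioc_right hut).eventuallyLE)
  refine (ae_restrict_iff' measurableSet_Ioc).mpr (Eventually.of_forall fun s hs => ?_)
  have hb : ∀ a, ‖heatKernel 1 a * (transitionDensity ψ s (Real.sqrt ε * a - x) * 1)‖ ≤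
      heatKernel 1 a * returnDensity ψ s := fun a => by
    rw [norm_mul, mul_one, Real.norm_of_nonneg (heatKernel_nonneg _ _)]
    exact mul_le_mul_of_nonneg_left (hψ.abs_transitionDensity_le hs.1 _) (heatKernel_nonneg _ _)
  have := norm_integral_le_of_norm_le ((integrable_heatKernel one_pos).mul_const
    (returnDensity ψ s)) (Eventually.of_forall hb)
  rwa [integral_mul_const, integral_heatKernel one_pos, one_mul] at this

theorem tendsto_integral_mollifiedLocalTime (hZ : IsLevyProcess P ψ Z) (hψ : IsSymbol ψ)
    {ι : Type*} {l : Filter ι} [l.IsCountablyGenerated] {ε x : ι → ℝ}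
    (hε : Tendsto ε l (𝓝[>] 0)) (hx : Tendsto x l (𝓝 0)) {t : ℝ} (ht : 0 ≤ t) :
    Tendsto (fun i => ∫ ω, mollifiedLocalTime Z (ε i) (x i) t ω ∂P) l
      (𝓝 (∫ s in Set.Ioc 0 t, returnDensity ψ s)) := by
  have h := hψ.tendsto_smoothed_convolution (hε.mono_right nhdsWithin_le_nhds) hx
    (tendsto_const_nhds (x := (0 : ℝ))) ht (H := fun _ _ _ => 1) (G := fun _ => 1) (B := 1)
    (fun _ => measurable_const) (by simp) fun _ _ _ _ => tendsto_const_nhds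
  simp only [mul_one] at h
  refine h.congr' ?_
  filter_upwards [hε self_mem_nhdsWithin] with i hi
  rw [hZ.integral_mollifiedLocalTime hψ t hi]
  simp only [mul_one]

/-- This is the part of the mixed second moment in which the first kernel is visited before the
second. The limit is the same for all mollifications and levels tending to zero. -/
theorem tendsto_integral_half (hZ : IsLevyProcess P ψ Z) (hψ : IsSymbol ψ)
    {ι : Type*} {l : Filter ι} [l.IsCountablyGenerated] {ε x δ y : ι → ℝ}
    (hε : Tendsto ε l (𝓝[>] 0)) (hx : Tendsto x l (𝓝 0)) (hδ : Tendsto δ l (𝓝[>] 0))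
    (hy : Tendsto y l (𝓝 0)) {t : ℝ} (ht : 0 ≤ t) :
    Tendsto (fun i => ∫ ω, (∫ s in Set.Ioc 0 t, heatKernel (ε i) (x i + Z s.toNNReal ω) *
      (pathIntegral (fun a => heatKernel (δ i) (y i + a)) (t - s)
        fun r => Z (s.toNNReal + r) ω)) ∂P) l
      (𝓝 (∫ s in Set.Ioc 0 t, returnDensity ψ s *
        ∫ r in Set.Ioc 0 (t - s), returnDensity ψ r)) := by
  have h := hψ.tendsto_smoothed_convolution (hε.mono_right nhdsWithin_le_nhds) hx hy ht
    (H := fun i u z => ∫ ω, mollifiedLocalTime Z (δ i) z u ω ∂P)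
    (G := fun u => ∫ r in Set.Ioc 0 u, returnDensity ψ r)
    (B := ∫ s in Set.Ioc 0 t, returnDensity ψ s)
    (fun i => hZ.measurable_integral_comp_mollifiedLocalTime (δ i) continuous_id) ?_ ?_
  · refine h.congr' ?_
    filter_upwards [hε self_mem_nhdsWithin] with i hi
    exact (hZ.integral_mollified_decomposition hψ t hi (δ i) (x i) (y i) continuous_id).symm
  · filter_upwards [hδ self_mem_nhdsWithin] with i hi u hu z
    exact hZ.integral_mollifiedLocalTime_le hψ hu.1 hu.2 hi z
  · intro u hu z hz
    exact hZ.tendsto_integral_mollifiedLocalTime hψ hδ hz hu.1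

/-- The two independent parameter pairs produce a limit that does not depend on how they approach
zero; this is what the Cauchy criterion in `L²` requires. -/
theorem tendsto_integral_mul (hZ : IsLevyProcess P ψ Z) (hψ : IsSymbol ψ)
    {ι : Type*} {l : Filter ι} [l.IsCountablyGenerated] {ε x δ y : ι → ℝ}
    (hε : Tendsto ε l (𝓝[>] 0)) (hx : Tendsto x l (𝓝 0)) (hδ : Tendsto δ l (𝓝[>] 0))
    (hy : Tendsto y l (𝓝 0)) {t : ℝ} (ht : 0 ≤ t) :
    Tendsto (fun i => ∫ ω, mollifiedLocalTime Z (ε i) (x i) t ω *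
      mollifiedLocalTime Z (δ i) (y i) t ω ∂P) l
      (𝓝 ((∫ s in Set.Ioc 0 t, returnDensity ψ s *
        ∫ r in Set.Ioc 0 (t - s), returnDensity ψ r) + ∫ s in Set.Ioc 0 t, returnDensity ψ s *
        ∫ r in Set.Ioc 0 (t - s), returnDensity ψ r)) := by
  refine ((hZ.tendsto_integral_half hψ hε hx hδ hy ht).add
    (hZ.tendsto_integral_half hψ hδ hy hε hx ht)).congr fun i => ?_
  rw [← integral_add]
  · refine integral_congr_ae (Eventually.of_forall fun ω => ?_)
    exact (pathIntegral_mul_pathIntegral ht (by fun_prop) (fun _ => heatKernel_le_const _ _)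
      (by fun_prop) (fun _ => heatKernel_le_const _ _) (hZ.rightCont ω)).symm
  · exact (hZ.integral_path_decomposition (f := fun a => heatKernel (ε i) (x i + a)) (by fun_prop)
      (by fun_prop) continuous_id (fun _ => heatKernel_le_const _ _)
      (fun _ => heatKernel_le_const _ _)).1
  · exact (hZ.integral_path_decomposition (f := fun a => heatKernel (δ i) (y i + a)) (by fun_prop)
      (by fun_prop) continuous_id (fun _ => heatKernel_le_const _ _)
      (fun _ => heatKernel_le_const _ _)).1

end IsLevyProcess

/-! ### Existence of the local time and passage of Laplace transforms to the limit. -/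

/-- Expanding `‖f i - f j‖²` gives three inner products with the same limit `M`, and `M - 2M + M =
0`. -/
theorem cauchy_map_of_tendsto_inner {E ι : Type*} [NormedAddCommGroup E] [InnerProductSpace ℝ E]
    {l : Filter ι} [l.NeBot] {f : ι → E} {M : ℝ}
    (h : Tendsto (fun p : ι × ι => inner ℝ (f p.1) (f p.2)) (l ×ˢ l) (𝓝 M)) :
    Cauchy (map f l) := by
  refine cauchy_map_iff.mpr ⟨inferInstance, ?_⟩
  have hdiag : Tendsto (fun i => inner ℝ (f i) (f i)) l (𝓝 M) := h.comp tendsto_diag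
  have h2 : Tendsto (fun p : ι × ι => inner ℝ (f p.1) (f p.1) - 2 * inner ℝ (f p.1) (f p.2) +
      inner ℝ (f p.2) (f p.2)) (l ×ˢ l) (𝓝 (M - 2 * M + M)) :=
    ((hdiag.comp tendsto_fst).sub (h.const_mul 2)).add (hdiag.comp tendsto_snd)
  have h3 : Tendsto (fun p : ι × ι => ‖f p.1 - f p.2‖) (l ×ˢ l) (𝓝 0) := by
    have h4 := (Real.continuous_sqrt.tendsto _).comp h2
    rw [show M - 2 * M + M = 0 by ring, Real.sqrt_zero] at h4
    refine h4.congr fun p => ?_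
    simp only [Function.comp]
    rw [real_inner_self_eq_norm_sq, real_inner_self_eq_norm_sq, ← norm_sub_sq_real,
      Real.sqrt_sq (norm_nonneg _)]
  rw [Metric.uniformity_eq_comap_nhds_zero, tendsto_comap_iff]
  exact h3.congr fun p => (dist_eq_norm _ _).symm

/-- The mollified local times converge in `L²`, jointly in the mollification and the level. -/
theorem IsLevyProcess.exists_localTime {Ω : Type*} {mΩ : MeasurableSpace Ω} {P : Measure Ω}
    {ψ : ℝ → ℝ} {Z : ℝ≥0 → Ω → ℝ} [IsProbabilityMeasure P] (hZ : IsLevyProcess P ψ Z)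
    (hψ : IsSymbol ψ) {t : ℝ} (ht : 0 ≤ t) :
    ∃ L : Ω → ℝ, MemLp L 2 P ∧ Tendsto (fun i : ℝ × ℝ =>
      eLpNorm (mollifiedLocalTime Z i.1 i.2 t - L) 2 P) (𝓝[>] 0 ×ˢ 𝓝 0) (𝓝 0) := by
  have hmem := fun i : ℝ × ℝ => hZ.memLp_mollifiedLocalTime i.1 i.2 ht 2
  set f : ℝ × ℝ → Lp ℝ 2 P := fun i => (hmem i).toLp _ with hf
  have hinner : ∀ p : (ℝ × ℝ) × (ℝ × ℝ), inner ℝ (f p.1) (f p.2) =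
      ∫ ω, mollifiedLocalTime Z p.1.1 p.1.2 t ω * mollifiedLocalTime Z p.2.1 p.2.2 t ω ∂P := by
    intro p
    rw [L2.inner_def]
    refine integral_congr_ae ?_
    filter_upwards [(hmem p.1).coeFn_toLp, (hmem p.2).coeFn_toLp] with ω h1 h2
    rw [hf]
    simp only
    rw [h1, h2, real_inner_eq_re_inner]
    simp [mul_comm]
  have hlim := hZ.tendsto_integral_mul hψ (ι := (ℝ × ℝ) × (ℝ × ℝ))
    (l := ((𝓝[>] (0 : ℝ)) ×ˢ 𝓝 (0 : ℝ)) ×ˢ ((𝓝[>] (0 : ℝ)) ×ˢ 𝓝 (0 : ℝ)))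
    (ε := fun p => p.1.1) (x := fun p => p.1.2) (δ := fun p => p.2.1) (y := fun p => p.2.2)
    (tendsto_fst.comp tendsto_fst) (tendsto_snd.comp tendsto_fst)
    (tendsto_fst.comp tendsto_snd) (tendsto_snd.comp tendsto_snd) ht
  simp_rw [← hinner] at hlim
  obtain ⟨L, hL⟩ := CompleteSpace.complete (cauchy_map_of_tendsto_inner hlim)
  refine ⟨L, Lp.memLp L, ?_⟩
  have hL' : Tendsto f (𝓝[>] 0 ×ˢ 𝓝 0) (𝓝 L) := hL
  rw [← Lp.toLp_coeFn L (Lp.memLp L)] at hL'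
  exact (Lp.tendsto_Lp_iff_tendsto_eLpNorm'' _ hmem _ (Lp.memLp L)).mp hL'

theorem tendsto_comp_pair {α : Type*} {g : ℝ × ℝ → α} {l : Filter α}
    (hg : Tendsto g (𝓝[>] (0 : ℝ) ×ˢ 𝓝 (0 : ℝ)) l) {z : ℝ → ℝ}
    (hz : Tendsto z (𝓝[>] 0) (𝓝 0)) : Tendsto (fun ε => g (ε, z ε)) (𝓝[>] 0) l :=
  hg.comp (tendsto_id.prodMk hz)

section LpLimit

variable {Ω : Type*} {mΩ : MeasurableSpace Ω} {P : Measure Ω} {p : ℝ≥0∞}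
  {ι : Type*} {l : Filter ι} {f : ι → Ω → ℝ} {L : Ω → ℝ}

/-- The negative part of the limit is at most `|f i - L|` because `f i` is nonnegative. -/
theorem ae_nonneg_of_tendsto_eLpNorm [l.NeBot] (hp : p ≠ 0) (hL : AEStronglyMeasurable L P)
    (hf : ∀ i ω, 0 ≤ f i ω) (h : Tendsto (fun i => eLpNorm (f i - L) p P) l (𝓝 0)) :
    ∀ᵐ ω ∂P, 0 ≤ L ω := by
  have h1 : eLpNorm (fun ω => max (-L ω) 0) p P = 0 := by
    refine le_antisymm (ge_of_tendsto' h fun i => eLpNorm_mono fun ω => ?_) zero_le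
    rw [Pi.sub_apply, Real.norm_of_nonneg (le_max_right _ _), Real.norm_eq_abs]
    refine max_le ?_ (abs_nonneg _)
    have := le_abs_self (f i ω - L ω)
    linarith [hf i ω]
  have hm : AEStronglyMeasurable (fun ω => max (-L ω) 0) P :=
    hL.neg.sup aestronglyMeasurable_const
  rw [eLpNorm_eq_zero_iff hm hp] at h1
  filter_upwards [h1] with ω hω
  have := le_max_left (-L ω) 0
  rw [Pi.zero_apply] at hω
  linarith

theorem abs_exp_neg_sub_exp_neg_le {a b : ℝ} (ha : 0 ≤ a) (hb : 0 ≤ b) :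
    |Real.exp (-a) - Real.exp (-b)| ≤ |a - b| := by
  wlog hab : a ≤ b generalizing a b
  · rw [abs_sub_comm, abs_sub_comm a b]
    exact this hb ha (le_of_not_ge hab)
  have h1 : Real.exp (-b) ≤ Real.exp (-a) := Real.exp_le_exp.mpr (by linarith)
  rw [abs_of_nonneg (by linarith), abs_sub_comm, abs_of_nonneg (by linarith)]
  have h2 : Real.exp (-b) = Real.exp (-a) * Real.exp (-(b - a)) := by
    rw [← Real.exp_add]; ring_nf
  have h3 := Real.add_one_le_exp (-(b - a))
  have h4 : Real.exp (-a) ≤ 1 := Real.exp_le_one_iff.mpr (by linarith)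
  have h5 := Real.exp_pos (-a)
  have h6 : Real.exp (-(b - a)) ≤ 1 := Real.exp_le_one_iff.mpr (by linarith)
  rw [h2]
  nlinarith

/-- On the half line `x ↦ exp(-θx)` is `θ`-Lipschitz, so convergence in `L^p`, hence in `L¹`, passes
through it. -/
theorem tendsto_integral_exp_of_tendsto_eLpNorm [IsProbabilityMeasure P] (hp : 1 ≤ p)
    (hfm : ∀ i, AEStronglyMeasurable (f i) P) (hL : AEStronglyMeasurable L P)
    (hf : ∀ i ω, 0 ≤ f i ω) (hL0 : ∀ᵐ ω ∂P, 0 ≤ L ω)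
    (h : Tendsto (fun i => eLpNorm (f i - L) p P) l (𝓝 0)) {θ : ℝ} (hθ : 0 ≤ θ) :
    Tendsto (fun i => ∫ ω, Real.exp (-θ * f i ω) ∂P) l (𝓝 (∫ ω, Real.exp (-θ * L ω) ∂P)) := by
  have hint : ∀ g : Ω → ℝ, AEStronglyMeasurable g P → (∀ᵐ ω ∂P, 0 ≤ g ω) →
      Integrable (fun ω => Real.exp (-θ * g ω)) P := fun g hg hg0 => by
    refine (integrable_const (1 : ℝ)).mono'
      (Real.continuous_exp.comp_aestronglyMeasurable (hg.const_mul (-θ))) ?_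
    filter_upwards [hg0] with ω hω
    rw [Real.norm_of_nonneg (Real.exp_pos _).le, Real.exp_le_one_iff]
    nlinarith
  refine tendsto_integral_of_L1' _ (hint L hL hL0).1
    (Eventually.of_forall fun i => hint _ (hfm i) (Eventually.of_forall (hf i))) ?_
  have h1 : Tendsto (fun i => ‖θ‖ₑ * eLpNorm (f i - L) p P) l (𝓝 0) := by
    have := ENNReal.Tendsto.const_mul (a := ‖θ‖ₑ) h (Or.inr (by simp))
    rwa [mul_zero] at this
  refine tendsto_of_tendsto_of_tendsto_of_le_of_le tendsto_const_nhds h1 (fun _ => zero_le)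
    fun i => ?_
  calc _ ≤ eLpNorm (θ • (f i - L)) 1 P := by
        refine eLpNorm_mono_ae ?_
        filter_upwards [hL0] with ω hω
        rw [Pi.sub_apply, Pi.smul_apply, Pi.sub_apply, smul_eq_mul, Real.norm_eq_abs,
          Real.norm_eq_abs, mul_sub, neg_mul, neg_mul]
        exact abs_exp_neg_sub_exp_neg_le (mul_nonneg hθ (hf i ω)) (mul_nonneg hθ hω)
    _ = ‖θ‖ₑ * eLpNorm (f i - L) 1 P := eLpNorm_const_smul _ _ _ _
    _ ≤ _ := by
        gcongr
        exact eLpNorm_le_eLpNorm_of_exponent_le hp ((hfm i).sub hL)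

end LpLimit

/-! ### The renewal equation for the Laplace transform of the local time. -/

namespace IsLevyProcess

variable {Ω : Type*} {mΩ : MeasurableSpace Ω} {P : Measure Ω}
  {ψ : ℝ → ℝ} {Z : ℝ≥0 → Ω → ℝ}

theorem mollifiedLocalTime_mono (hZ : IsLevyProcess P ψ Z) (ε x : ℝ) {s t : ℝ} (hst : s ≤ t)
    (ω : Ω) : mollifiedLocalTime Z ε x s ω ≤ mollifiedLocalTime Z ε x t ω := by
  have hm : Measurable fun r : ℝ => heatKernel ε (x + Z r.toNNReal ω) :=
    (by fun_prop : Measurable fun a => heatKernel ε (x + a)).comp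
      (measurable_path (hZ.rightCont ω))
  refine setIntegral_mono_set ?_ (Eventually.of_forall fun r => heatKernel_nonneg _ _)
    (Set.Ioc_subset_Ioc_right hst).eventuallyLE
  exact (integrable_const (1 / Real.sqrt (2 * Real.pi * ε))).mono' hm.aestronglyMeasurable
    (Eventually.of_forall fun r => heatKernel_le_const _ _)

variable [IsProbabilityMeasure P]

theorem integral_exp_mollifiedLocalTime (hZ : IsLevyProcess P ψ Z) (hψ : IsSymbol ψ) {t : ℝ}
    (ht : 0 ≤ t) {ε : ℝ} (hε : 0 < ε) (θ : ℝ) :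
    ∫ ω, Real.exp (-θ * mollifiedLocalTime Z ε 0 t ω) ∂P =
      1 - θ * ∫ s in Set.Ioc 0 t, ∫ a, heatKernel 1 a *
        (transitionDensity ψ s (Real.sqrt ε * a - 0) * ∫ ω, Real.exp (-θ *
          mollifiedLocalTime Z ε (0 + (Real.sqrt ε * a - 0)) (t - s) ω) ∂P) := by
  rw [← hZ.integral_mollified_decomposition hψ t hε ε 0 0 (Φ := fun v => Real.exp (-θ * v))
    (by fun_prop)]
  have hint := (hZ.integral_path_decomposition (t := t) (f := fun a => heatKernel ε (0 + a))
    (g := fun a => heatKernel ε (0 + a)) (Φ := fun v => Real.exp (-θ * v)) (by fun_prop)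
    (by fun_prop) (by fun_prop) (fun _ => heatKernel_le_const _ _)
    (fun _ => heatKernel_le_const _ _)).1
  rw [← integral_const_mul]
  have h1 : (1 : ℝ) = ∫ _, (1 : ℝ) ∂P := by simp
  conv_rhs => lhs; rw [h1]
  rw [← integral_sub (integrable_const _) (hint.const_mul θ)]
  refine integral_congr_ae (Eventually.of_forall fun ω => ?_)
  exact exp_neg_pathIntegral ht (by fun_prop) (fun _ => heatKernel_le_const _ _)
    (hZ.rightCont ω) θ

theorem integral_exp_mollifiedLocalTime_mem (hZ : IsLevyProcess P ψ Z) {θ : ℝ} (hθ : 0 ≤ θ)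
    (ε x t : ℝ) : Integrable (fun ω => Real.exp (-θ * mollifiedLocalTime Z ε x t ω)) P ∧
      ∫ ω, Real.exp (-θ * mollifiedLocalTime Z ε x t ω) ∂P ∈ Set.Icc (0 : ℝ) 1 := by
  have hb : ∀ ω, Real.exp (-θ * mollifiedLocalTime Z ε x t ω) ≤ 1 := fun ω => by
    rw [Real.exp_le_one_iff]
    have := mollifiedLocalTime_nonneg Z ε x t ω
    nlinarith
  have hm := hZ.measurable_mollifiedLocalTime_apply ε x t
  have hi : Integrable (fun ω => Real.exp (-θ * mollifiedLocalTime Z ε x t ω)) P :=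
    (integrable_const (1 : ℝ)).mono' (by fun_prop) (Eventually.of_forall fun ω => by
      rw [Real.norm_of_nonneg (Real.exp_pos _).le]; exact hb ω)
  refine ⟨hi, integral_nonneg fun ω => (Real.exp_pos _).le, ?_⟩
  have := integral_mono hi (integrable_const (1 : ℝ)) hb
  simpa using this

/-- The Laplace transform of the local time solves a renewal equation. -/
theorem exists_laplace (hZ : IsLevyProcess P ψ Z) (hψ : IsSymbol ψ) :
    ∃ L : ℝ → Ω → ℝ, (∀ t, 0 ≤ t → MemLp (L t) 2 P ∧ (∀ᵐ ω ∂P, 0 ≤ L t ω) ∧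
      Tendsto (fun ε => eLpNorm (mollifiedLocalTime Z ε 0 t - L t) 2 P) (𝓝[>] 0) (𝓝 0)) ∧
    ∀ θ, 0 ≤ θ → (∀ t, 0 ≤ t → ∫ ω, Real.exp (-θ * L t ω) ∂P ∈ Set.Icc (0 : ℝ) 1) ∧
      AntitoneOn (fun t => ∫ ω, Real.exp (-θ * L t ω) ∂P) (Set.Ici 0) ∧
      ∀ t, 0 ≤ t → ∫ ω, Real.exp (-θ * L t ω) ∂P = 1 - θ * ∫ s in Set.Ioc 0 t,
        returnDensity ψ s * ∫ ω, Real.exp (-θ * L (t - s) ω) ∂P := by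
  have hex : ∀ t : ℝ, ∃ L : Ω → ℝ, 0 ≤ t → MemLp L 2 P ∧ Tendsto (fun i : ℝ × ℝ =>
      eLpNorm (mollifiedLocalTime Z i.1 i.2 t - L) 2 P) (𝓝[>] 0 ×ˢ 𝓝 0) (𝓝 0) := fun t => by
    by_cases ht : 0 ≤ t
    · obtain ⟨L, hL⟩ := hZ.exists_localTime hψ ht
      exact ⟨L, fun _ => hL⟩
    · exact ⟨0, fun h => absurd h ht⟩
  choose L hL using hex
  have hL0 : ∀ t, 0 ≤ t → ∀ᵐ ω ∂P, 0 ≤ L t ω := fun t ht =>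
    ae_nonneg_of_tendsto_eLpNorm (p := 2) (l := 𝓝[>] (0 : ℝ) ×ˢ 𝓝 (0 : ℝ))
      (f := fun i => mollifiedLocalTime Z i.1 i.2 t) (by norm_num) (hL t ht).1.1
      (fun i ω => mollifiedLocalTime_nonneg Z i.1 i.2 t ω) (hL t ht).2
  have hlim : ∀ θ, 0 ≤ θ → ∀ t, 0 ≤ t → ∀ z : ℝ → ℝ, Tendsto z (𝓝[>] 0) (𝓝 0) →
      Tendsto (fun ε => ∫ ω, Real.exp (-θ * mollifiedLocalTime Z ε (z ε) t ω) ∂P) (𝓝[>] 0)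
        (𝓝 (∫ ω, Real.exp (-θ * L t ω) ∂P)) := by
    intro θ hθ t ht z hz
    have h := tendsto_integral_exp_of_tendsto_eLpNorm (P := P) (p := 2)
      (f := fun i : ℝ × ℝ => mollifiedLocalTime Z i.1 i.2 t) (by norm_num)
      (fun i : ℝ × ℝ => (hZ.measurable_mollifiedLocalTime_apply i.1 i.2 t).aestronglyMeasurable)
      (hL t ht).1.1 (fun i ω => mollifiedLocalTime_nonneg Z i.1 i.2 t ω) (hL0 t ht)
      (hL t ht).2 hθ
    exact tendsto_comp_pair h hz
  have h0 : Tendsto (fun _ : ℝ => (0 : ℝ)) (𝓝[>] 0) (𝓝 0) := tendsto_const_nhds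
  refine ⟨L, fun t ht => ⟨(hL t ht).1, hL0 t ht, ?_⟩, fun θ hθ => ⟨fun t ht => ?_,
    fun s hs t ht hst => ?_, fun t ht => ?_⟩⟩
  · exact tendsto_comp_pair (hL t ht).2 h0
  · exact isClosed_Icc.mem_of_tendsto (hlim θ hθ t ht _ h0) (Eventually.of_forall fun ε =>
      (hZ.integral_exp_mollifiedLocalTime_mem hθ ε 0 t).2)
  · refine le_of_tendsto_of_tendsto' (hlim θ hθ t ht _ h0) (hlim θ hθ s hs _ h0) fun ε => ?_
    refine integral_mono (hZ.integral_exp_mollifiedLocalTime_mem hθ ε 0 t).1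
      (hZ.integral_exp_mollifiedLocalTime_mem hθ ε 0 s).1 fun ω => ?_
    refine Real.exp_le_exp.mpr ?_
    have := hZ.mollifiedLocalTime_mono ε 0 hst ω
    nlinarith
  · refine tendsto_nhds_unique (hlim θ hθ t ht _ h0) ?_
    have h := hψ.tendsto_smoothed_convolution (l := 𝓝[>] (0 : ℝ)) (ε := fun ε => ε)
      (tendsto_id.mono_right nhdsWithin_le_nhds) h0 h0 ht
      (H := fun ε u z => ∫ ω, Real.exp (-θ * mollifiedLocalTime Z ε z u ω) ∂P)
      (G := fun u => ∫ ω, Real.exp (-θ * L u ω) ∂P) (B := 1)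
      (fun ε => hZ.measurable_integral_comp_mollifiedLocalTime ε
        (Φ := fun v => Real.exp (-θ * v)) (by fun_prop)) ?_ ?_
    · refine ((h.const_mul θ).const_sub 1).congr' ?_
      filter_upwards [self_mem_nhdsWithin] with ε hε
      exact (hZ.integral_exp_mollifiedLocalTime hψ ht hε θ).symm
    · refine Eventually.of_forall fun ε u _ z => ?_
      have := (hZ.integral_exp_mollifiedLocalTime_mem hθ ε z u).2
      rw [abs_of_nonneg this.1]
      exact this.2
    · intro u hu z hz
      exact hlim θ hθ u hu.1 z hz

end IsLevyProcess

/-! ### Asymptotics of the renewal equation. -/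

theorem setIntegral_ite_add_lt {s t : ℝ} (hs : 0 ≤ s) (g : ℝ → ℝ) :
    ∫ v in Set.Ioc 0 t, (if s + v < t then g v else 0) = ∫ v in Set.Ioc 0 (t - s), g v := by
  have h1 : (fun v => if s + v < t then g v else 0) = (Set.Iio (t - s)).indicator g := by
    ext v
    simp only [Set.indicator, Set.mem_Iio, lt_sub_iff_add_lt']
  rw [h1, setIntegral_indicator measurableSet_Iio, integral_Ioc_eq_integral_Ioo]
  congr 2
  ext v
  simp only [Set.mem_inter_iff, Set.mem_Ioc, Set.mem_Iio, Set.mem_Ioo]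
  constructor
  · rintro ⟨⟨h1, _⟩, h2⟩; exact ⟨h1, h2⟩
  · rintro ⟨h1, h2⟩; exact ⟨⟨h1, by linarith⟩, h2⟩

theorem integrableOn_ite_add_lt {s t : ℝ} {g : ℝ → ℝ} (hg : IntegrableOn g (Set.Ioc 0 (t - s))) :
    IntegrableOn (fun v => if s + v < t then g v else 0) (Set.Ioc 0 t) := by
  have h1 : (fun v => if s + v < t then g v else 0) = (Set.Iio (t - s)).indicator g := by
    ext v
    simp only [Set.indicator, Set.mem_Iio, lt_sub_iff_add_lt']
  rw [h1, integrableOn_indicator_iff measurableSet_Iio]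
  refine hg.mono_set ?_
  rintro v ⟨h1, h2, h3⟩
  exact ⟨h2, le_of_lt h1⟩

theorem setIntegral_sub_left {a : ℝ} (ha : 0 ≤ a) (f : ℝ → ℝ) :
    ∫ v in Set.Ioc 0 a, f (a - v) = ∫ v in Set.Ioc 0 a, f v := by
  have h := intervalIntegral.integral_comp_sub_left (a := 0) (b := a) f a
  rw [sub_self, sub_zero] at h
  rwa [intervalIntegral.integral_of_le ha, intervalIntegral.integral_of_le ha] at h

namespace IsSymbol

variable {ψ : ℝ → ℝ}

/-- Convolving the renewal equation with the Lévy tail. -/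
theorem mul_integral_eq_of_renewal (hψ : IsSymbol ψ) {h : ℝ → ℝ} {θ t : ℝ} (ht : 0 ≤ t)
    (h01 : ∀ s, 0 ≤ s → h s ∈ Set.Icc (0 : ℝ) 1) (hanti : AntitoneOn h (Set.Ici 0))
    (hren : ∀ s, 0 ≤ s → h s = 1 - θ * ∫ r in Set.Ioc 0 s, returnDensity ψ r * h (s - r)) :
    θ * ∫ s in Set.Ioc 0 t, h s = ∫ s in Set.Ioc 0 t, levyTail ψ s * (1 - h (t - s)) := by
  set κ := levyTail ψ with hκdef
  set q := returnDensity ψ with hqdef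
  have hκ : IntegrableOn κ (Set.Ioc 0 t) := hψ.integrableOn_levyTail ht
  have hκm : AEStronglyMeasurable κ (volume.restrict (Set.Ioc 0 t)) := hκ.1
  have hqm : Measurable q := hψ.measurable_returnDensity
  have hq0 : ∀ s, 0 ≤ q s := fun s => returnDensity_nonneg ψ s
  -- Extending by the value at zero to negative times gives a function monotone on the whole line,
  -- hence measurable.
  set h' : ℝ → ℝ := fun s => h (max s 0) with hh'
  have hh'm : Measurable h' := by
    have : Antitone h' := fun a b hab => hanti (Set.mem_Ici.mpr (le_max_right _ _))
      (Set.mem_Ici.mpr (le_max_right _ _)) (max_le_max_right 0 hab)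
    exact this.measurable
  have hh'b : ∀ s, ‖h' s‖ ≤ 1 := fun s => by
    have := h01 (max s 0) (le_max_right _ _)
    rw [Real.norm_of_nonneg this.1]; exact this.2
  have hh'eq : ∀ s, 0 ≤ s → h' s = h s := fun s hs => by simp only [hh', max_eq_left hs]
  -- The triple convolution lives on the triangle `s + v < t`; writing the constraint as a cutoff on
  -- the square allows Fubini over a product.
  set F : ℝ → ℝ → ℝ := fun s v => κ s * ((if s + v < t then q (t - s - v) else 0) * h' v) with hF
  have hqint : ∀ a, 0 ≤ a → IntegrableOn (fun v => q (a - v)) (Set.Ioc 0 a) := fun a ha =>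
    (intervalIntegrable_iff_integrableOn_Ioc_of_le ha).mp
      (hψ.intervalIntegrable_returnDensity_sub ha)
  have hmeasset : MeasurableSet {p : ℝ × ℝ | p.1 + p.2 < t} :=
    measurableSet_lt (by fun_prop) measurable_const
  have hFs : ∀ s ∈ Set.Ioc 0 t, IntegrableOn (F s) (Set.Ioc 0 t) := fun s hs =>
    ((integrableOn_ite_add_lt (hqint (t - s) (by linarith [hs.2]))).mul_bdd
      hh'm.aestronglyMeasurable (Eventually.of_forall hh'b)).const_mul _
  have hFint : Integrable (Function.uncurry F)
      ((volume.restrict (Set.Ioc 0 t)).prod (volume.restrict (Set.Ioc 0 t))) := by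
    have hm : AEStronglyMeasurable (Function.uncurry F)
        ((volume.restrict (Set.Ioc 0 t)).prod (volume.restrict (Set.Ioc 0 t))) := by
      refine hκm.comp_fst.mul (Measurable.aestronglyMeasurable ?_)
      refine (Measurable.ite hmeasset ?_ measurable_const).mul (hh'm.comp measurable_snd)
      exact hqm.comp (by fun_prop)
    rw [integrable_prod_iff hm]
    refine ⟨(ae_restrict_iff' measurableSet_Ioc).mpr (Eventually.of_forall hFs), ?_⟩
    refine (hκ.norm.mul_const (∫ v in Set.Ioc 0 t, q v)).mono' hm.norm.integral_prod_right' ?_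
    refine (ae_restrict_iff' measurableSet_Ioc).mpr (Eventually.of_forall fun s hs => ?_)
    have hts : 0 ≤ t - s := by linarith [hs.2]
    rw [Real.norm_of_nonneg (integral_nonneg fun _ => norm_nonneg _)]
    calc ∫ v in Set.Ioc 0 t, ‖F s v‖
        ≤ ∫ v in Set.Ioc 0 t, ‖κ s‖ * (if s + v < t then q (t - s - v) else 0) := by
          refine integral_mono (hFs s hs).norm
            ((integrableOn_ite_add_lt (hqint (t - s) hts)).const_mul _) fun v => ?_
          simp only [hF]
          rw [norm_mul, norm_mul]
          refine mul_le_mul_of_nonneg_left ?_ (norm_nonneg _)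
          have h0 : 0 ≤ if s + v < t then q (t - s - v) else 0 := by
            split_ifs
            · exact hq0 _
            · exact le_rfl
          rw [Real.norm_of_nonneg h0]
          exact mul_le_of_le_one_right h0 (hh'b v)
      _ = ‖κ s‖ * ∫ v in Set.Ioc 0 (t - s), q v := by
          rw [integral_const_mul, setIntegral_ite_add_lt hs.1.le, setIntegral_sub_left hts]
      _ ≤ _ := by
          refine mul_le_mul_of_nonneg_left ?_ (norm_nonneg _)
          exact setIntegral_mono_set (hψ.integrableOn_returnDensity ht)
            (Eventually.of_forall hq0) (Set.Ioc_subset_Ioc_right (by linarith [hs.1])).eventuallyLE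
  have hleft : ∀ s ∈ Set.Ioc 0 t, ∫ v in Set.Ioc 0 t, F s v =
      κ s * ∫ r in Set.Ioc 0 (t - s), q r * h (t - s - r) := by
    intro s hs
    have hts : 0 ≤ t - s := by linarith [hs.2]
    simp only [hF, ite_mul, zero_mul]
    rw [integral_const_mul, setIntegral_ite_add_lt hs.1.le,
      ← setIntegral_sub_left hts fun r => q r * h (t - s - r)]
    congr 1
    refine setIntegral_congr_fun measurableSet_Ioc fun v hv => ?_
    simp only [sub_sub_cancel]
    rw [hh'eq v hv.1.le]
  -- The endpoint `v = t` is excluded, as `q * κ = 1` holds only at strictly positive times; a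
  -- single point does not affect the integral.
  have hright : ∀ v ∈ Set.Ioo 0 t, ∫ s in Set.Ioc 0 t, F s v = h v := by
    intro v hv
    have htv : 0 < t - v := by linarith [hv.2]
    have h1 : ∀ s, F s v = h' v * (if v + s < t then q (t - v - s) * κ s else 0) := fun s => by
      simp only [hF, add_comm s v, sub_right_comm t s v]
      split_ifs <;> ring
    simp_rw [h1]
    rw [integral_const_mul, setIntegral_ite_add_lt hv.1.le,
      ← intervalIntegral.integral_of_le htv.le, hψ.integral_returnDensity_mul_levyTail htv,
      mul_one, hh'eq v hv.1.le]
  have hswap := integral_integral_swap hFint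
  rw [setIntegral_congr_fun measurableSet_Ioc hleft] at hswap
  have h1 : ∫ v in Set.Ioc 0 t, ∫ s in Set.Ioc 0 t, F s v = ∫ v in Set.Ioc 0 t, h v := by
    rw [integral_Ioc_eq_integral_Ioo, integral_Ioc_eq_integral_Ioo]
    exact setIntegral_congr_fun measurableSet_Ioo hright
  rw [← h1, ← hswap, ← integral_const_mul]
  refine setIntegral_congr_fun measurableSet_Ioc fun s hs => ?_
  rw [hren (t - s) (by linarith [hs.2])]
  ring

theorem hasDerivAt_integral_levyTail (hψ : IsSymbol ψ) {T : ℝ} (hT : 0 < T) :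
    HasDerivAt (fun t => ∫ s in (0 : ℝ)..t, levyTail ψ s) (levyTail ψ T) T := by
  have hc := hψ.continuousOn_levyTail
  refine intervalIntegral.integral_hasDerivAt_right
    ((intervalIntegrable_iff_integrableOn_Ioc_of_le hT.le).mpr (hψ.integrableOn_levyTail hT.le))
    (hc.stronglyMeasurableAtFilter isOpen_Ioi T hT) (hc.continuousAt (Ioi_mem_nhds hT))

/-- Solutions of the renewal equation are asymptotic to the Lévy tail. -/
theorem tendsto_mul_of_renewal (hψ : IsSymbol ψ) {h : ℝ → ℝ → ℝ}
    (h01 : ∀ θ, 0 ≤ θ → ∀ s, 0 ≤ s → h θ s ∈ Set.Icc (0 : ℝ) 1)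
    (hanti : ∀ θ, 0 ≤ θ → AntitoneOn (h θ) (Set.Ici 0))
    (hren : ∀ θ, 0 ≤ θ → ∀ s, 0 ≤ s →
      h θ s = 1 - θ * ∫ r in Set.Ioc 0 s, returnDensity ψ r * h θ (s - r))
    {T : ℝ} (hT : 0 < T) :
    Tendsto (fun θ => θ * h θ T) atTop (𝓝 (levyTail ψ T)) := by
  have hint : ∀ θ, 0 ≤ θ → ∀ a b, 0 ≤ a → 0 ≤ b → IntervalIntegrable (h θ) volume a b :=
    fun θ hθ a b ha hb => ((hanti θ hθ).mono (by
      intro x hx; exact (le_min ha hb).trans hx.1)).intervalIntegrable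
  have hkey : ∀ θ, 0 ≤ θ → ∀ t, 0 ≤ t → θ * ∫ s in (0 : ℝ)..t, h θ s =
      ∫ s in Set.Ioc 0 t, levyTail ψ s * (1 - h θ (t - s)) := fun θ hθ t ht => by
    rw [intervalIntegral.integral_of_le ht]
    exact hψ.mul_integral_eq_of_renewal ht (h01 θ hθ) (hanti θ hθ) (hren θ hθ)
  have hbd : ∀ θ, 0 ≤ θ → ∀ t, 0 ≤ t → ∀ s ∈ Set.Ioc 0 t,
      ‖levyTail ψ s * (1 - h θ (t - s))‖ ≤ ‖levyTail ψ s‖ := fun θ hθ t ht s hs => by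
    have := h01 θ hθ (t - s) (by linarith [hs.2])
    have h1 : 0 ≤ 1 - h θ (t - s) := by linarith [this.2]
    rw [norm_mul, Real.norm_of_nonneg h1]
    exact mul_le_of_le_one_right (norm_nonneg _) (by linarith [this.1])
  -- Monotonicity gives `t h_θ(t) ≤ ∫₀ᵗ h_θ`, and the convolved equation bounds `θ` times that
  -- integral by the `L¹` norm of the tail on `(0, t]`.
  have hzero : ∀ t, 0 < t → Tendsto (fun θ => h θ t) atTop (𝓝 0) := by
    intro t ht
    set C := ∫ s in Set.Ioc 0 t, ‖levyTail ψ s‖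
    have hup : Tendsto (fun θ : ℝ => C / t / θ) atTop (𝓝 0) :=
      tendsto_const_nhds.div_atTop tendsto_id
    refine tendsto_of_tendsto_of_tendsto_of_le_of_le' tendsto_const_nhds hup ?_ ?_
    · filter_upwards [eventually_ge_atTop 0] with θ hθ
      exact (h01 θ hθ t ht.le).1
    · filter_upwards [eventually_gt_atTop 0] with θ hθ
      have h1 : t * h θ t ≤ ∫ s in (0 : ℝ)..t, h θ s := by
        have := intervalIntegral.integral_mono_on (a := 0) (b := t) ht.le
          (f := fun _ => h θ t) intervalIntegrable_const
          (hint θ hθ.le 0 t le_rfl ht.le) fun s hs => hanti θ hθ.le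
            (Set.mem_Ici.mpr hs.1) (Set.mem_Ici.mpr ht.le) hs.2
        simpa using this
      have h2 : θ * ∫ s in (0 : ℝ)..t, h θ s ≤ C := by
        rw [hkey θ hθ.le t ht.le]
        refine (Real.le_norm_self _).trans (norm_integral_le_of_norm_le
          (hψ.integrableOn_levyTail ht.le).norm ?_)
        exact (ae_restrict_iff' measurableSet_Ioc).mpr
          (Eventually.of_forall (hbd θ hθ.le t ht.le))
      rw [le_div_iff₀ hθ, le_div_iff₀ ht]
      nlinarith
  have hlim : ∀ t, 0 < t → Tendsto (fun θ => θ * ∫ s in (0 : ℝ)..t, h θ s) atTop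
      (𝓝 (∫ s in (0 : ℝ)..t, levyTail ψ s)) := by
    intro t ht
    have h1 : Tendsto (fun θ => ∫ s in Set.Ioc 0 t, levyTail ψ s * (1 - h θ (t - s))) atTop
        (𝓝 (∫ s in Set.Ioc 0 t, levyTail ψ s)) := by
      refine tendsto_integral_filter_of_dominated_convergence (fun s => ‖levyTail ψ s‖) ?_ ?_
        (hψ.integrableOn_levyTail ht.le).norm ?_
      · filter_upwards [eventually_ge_atTop 0] with θ hθ
        refine (hψ.integrableOn_levyTail ht.le).1.mul ?_
        have : AntitoneOn (fun s => 1 - h θ (t - s)) (Set.Ioc 0 t) := fun a ha b hb hab => by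
          have := hanti θ hθ (Set.mem_Ici.mpr (by linarith [hb.2] : 0 ≤ t - b))
            (Set.mem_Ici.mpr (by linarith [ha.2] : 0 ≤ t - a)) (by linarith)
          simp only
          linarith
        exact (aemeasurable_restrict_of_antitoneOn measurableSet_Ioc this).aestronglyMeasurable
      · filter_upwards [eventually_ge_atTop 0] with θ hθ
        exact (ae_restrict_iff' measurableSet_Ioc).mpr
          (Eventually.of_forall (hbd θ hθ t ht.le))
      -- At `s = t` the value `h_θ(0) = 1` does not tend to zero, so this null set is removed.
      · have hne : ∀ᵐ s ∂(volume.restrict (Set.Ioc 0 t)), s ≠ t :=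
          ae_restrict_of_ae (by simp [ae_iff])
        filter_upwards [hne, ae_restrict_mem measurableSet_Ioc] with s hs hs'
        have := (hzero (t - s) (by have := lt_of_le_of_ne hs'.2 hs; linarith)).const_sub 1
        simpa using this.const_mul (levyTail ψ s)
    rw [intervalIntegral.integral_of_le ht.le]
    refine h1.congr' ?_
    filter_upwards [eventually_ge_atTop 0] with θ hθ
    exact (hkey θ hθ t ht.le).symm
  set K : ℝ → ℝ := fun t => ∫ s in (0 : ℝ)..t, levyTail ψ s with hK
  have hder := hψ.hasDerivAt_integral_levyTail hT
  have hright := hder.tendsto_slope_zero_right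
  have hleft := hder.tendsto_slope_zero_left
  -- Monotone density argument: `θ h_θ(T)` is at least the average of `θ h_θ` over `[T, T + δ]` and
  -- at most its average just before `T`. These averages converge to difference quotients of the
  -- integrated tail, which are close to its derivative at `T`.
  refine tendsto_order.mpr ⟨fun a ha => ?_, fun a ha => ?_⟩
  · obtain ⟨δ, hδ, hδ0⟩ := ((hright.eventually (lt_mem_nhds ha)).and self_mem_nhdsWithin).exists
    have hδ0' : 0 < δ := hδ0
    have h1 : Tendsto (fun θ => δ⁻¹ * (θ * (∫ s in (0 : ℝ)..(T + δ), h θ s) -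
        θ * ∫ s in (0 : ℝ)..T, h θ s)) atTop (𝓝 (δ⁻¹ * (K (T + δ) - K T))) :=
      ((hlim (T + δ) (by linarith)).sub (hlim T hT)).const_mul _
    filter_upwards [h1.eventually (lt_mem_nhds hδ), eventually_ge_atTop 0] with θ h2 hθ
    refine h2.trans_le ?_
    rw [← mul_sub, intervalIntegral.integral_interval_sub_left
      (hint θ hθ _ _ le_rfl (by linarith)) (hint θ hθ _ _ le_rfl hT.le)]
    have h3 := intervalIntegral.integral_mono_on (a := T) (b := T + δ) (by linarith)
      (g := fun _ => h θ T) (hint θ hθ _ _ hT.le (by linarith)) intervalIntegrable_const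
      fun s hs => hanti θ hθ (Set.mem_Ici.mpr hT.le) (Set.mem_Ici.mpr (hT.le.trans hs.1)) hs.1
    simp only [intervalIntegral.integral_const, add_sub_cancel_left, smul_eq_mul] at h3
    rw [inv_mul_le_iff₀ hδ0']
    nlinarith
  · have hmem : ∀ᶠ δ in 𝓝[<] (0 : ℝ), -T < δ :=
      nhdsWithin_le_nhds (lt_mem_nhds (by linarith))
    obtain ⟨δ, ⟨hδ, hδ0⟩, hδT⟩ := (((hleft.eventually (gt_mem_nhds ha)).and
      self_mem_nhdsWithin).and hmem).exists
    have hδ0' : δ < 0 := hδ0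
    have h1 : Tendsto (fun θ => δ⁻¹ * (θ * (∫ s in (0 : ℝ)..(T + δ), h θ s) -
        θ * ∫ s in (0 : ℝ)..T, h θ s)) atTop (𝓝 (δ⁻¹ * (K (T + δ) - K T))) :=
      ((hlim (T + δ) (by linarith)).sub (hlim T hT)).const_mul _
    filter_upwards [h1.eventually (gt_mem_nhds hδ), eventually_ge_atTop 0] with θ h2 hθ
    refine lt_of_le_of_lt ?_ h2
    rw [← mul_sub, intervalIntegral.integral_interval_sub_left
      (hint θ hθ _ _ le_rfl (by linarith)) (hint θ hθ _ _ le_rfl hT.le),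
      intervalIntegral.integral_symm]
    have h3 := intervalIntegral.integral_mono_on (a := T + δ) (b := T) (by linarith)
      (f := fun _ => h θ T) intervalIntegrable_const (hint θ hθ _ _ (by linarith) hT.le)
      fun s hs => hanti θ hθ (Set.mem_Ici.mpr (by linarith [hs.1])) (Set.mem_Ici.mpr hT.le) hs.2
    simp only [intervalIntegral.integral_const, smul_eq_mul] at h3
    have h4 : δ⁻¹ * (θ * -∫ x in (T + δ)..T, h θ x) = (-δ)⁻¹ * (θ * ∫ x in (T + δ)..T, h θ x) := by
      rw [inv_neg]; ring
    rw [h4, le_inv_mul_iff₀ (by linarith)]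
    nlinarith

end IsSymbol

/-! ### Karamata's Tauberian argument. -/

section Tauberian

variable {Ω : Type*} {mΩ : MeasurableSpace Ω} {P : Measure Ω} [IsProbabilityMeasure P]
  {L : Ω → ℝ} {c : ℝ}

theorem exp_neg_mul_mem_Icc {θ x : ℝ} (hθ : 0 ≤ θ) (hx : 0 ≤ x) :
    Real.exp (-θ * x) ∈ Set.Icc (0 : ℝ) 1 :=
  ⟨(Real.exp_pos _).le, Real.exp_le_one_iff.mpr (by nlinarith)⟩

theorem integrable_exp_mul_comp_exp (hL : AEMeasurable L P) (hL0 : ∀ᵐ ω ∂P, 0 ≤ L ω)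
    {f : ℝ → ℝ} (hf : Continuous f) {θ : ℝ} (hθ : 0 ≤ θ) :
    Integrable (fun ω => Real.exp (-θ * L ω) * f (Real.exp (-θ * L ω))) P := by
  obtain ⟨C, hC⟩ := (isCompact_Icc (a := (0 : ℝ)) (b := 1)).exists_bound_of_continuousOn
    hf.continuousOn
  have hm : AEMeasurable (fun ω => Real.exp (-θ * L ω)) P :=
    Real.measurable_exp.comp_aemeasurable (hL.const_mul _)
  refine (integrable_const C).mono' (hm.mul (hf.measurable.comp_aemeasurable hm)).aestronglyMeasurable
    ?_
  filter_upwards [hL0] with ω hω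
  have h := exp_neg_mul_mem_Icc hθ hω
  rw [norm_mul, Real.norm_of_nonneg h.1]
  exact (mul_le_of_le_one_left (norm_nonneg _) h.2).trans (hC _ h)

/-- For the monomial `yⁿ` the integrand is `exp(-(n+1)θL)`, so the hypothesis at `(n+1)θ` gives `c /
(n+1) = c ∫₀¹ yⁿ dy`. -/
theorem tendsto_laplace_polynomial (hL : AEMeasurable L P) (hL0 : ∀ᵐ ω ∂P, 0 ≤ L ω)
    (h : Tendsto (fun θ : ℝ => θ * ∫ ω, Real.exp (-θ * L ω) ∂P) atTop (𝓝 c))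
    (p : Polynomial ℝ) :
    Tendsto (fun θ : ℝ => θ * ∫ ω, Real.exp (-θ * L ω) * p.eval (Real.exp (-θ * L ω)) ∂P) atTop
      (𝓝 (c * ∫ y in (0 : ℝ)..1, p.eval y)) := by
  induction p using Polynomial.induction_on' with
  | add p q hp hq =>
    simp only [Polynomial.eval_add]
    rw [intervalIntegral.integral_add (p.continuous.intervalIntegrable _ _)
      (q.continuous.intervalIntegrable _ _), mul_add]
    refine (hp.add hq).congr' ?_
    filter_upwards [eventually_ge_atTop 0] with θ hθ
    rw [← mul_add, ← integral_add (integrable_exp_mul_comp_exp hL hL0 p.continuous hθ)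
      (integrable_exp_mul_comp_exp hL hL0 q.continuous hθ)]
    simp only [mul_add]
  | monomial n a =>
    simp only [Polynomial.eval_monomial]
    rw [intervalIntegral.integral_const_mul, integral_pow]
    have hn : (0 : ℝ) < n + 1 := by positivity
    have h1 : Tendsto (fun θ : ℝ => (n + 1 : ℝ) * θ) atTop atTop :=
      tendsto_id.const_mul_atTop hn
    have h2 := (h.comp h1).mul_const (a / (n + 1))
    have h3 : c * (a * ((1 ^ (n + 1) - 0 ^ (n + 1)) / (n + 1))) = c * (a / (n + 1)) := by
      simp [div_eq_mul_inv]
    rw [h3]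
    refine h2.congr fun θ => ?_
    have h4 : ∀ ω, Real.exp (-θ * L ω) * (a * Real.exp (-θ * L ω) ^ n) =
        a * Real.exp (-((n + 1) * θ) * L ω) := fun ω => by
      rw [mul_left_comm, ← pow_succ', ← Real.exp_nat_mul]
      push_cast
      ring_nf
    simp_rw [h4]
    rw [integral_const_mul]
    simp only [Function.comp]
    field_simp

/-- By Weierstrass approximation: the measures with density `θ exp(-θL)` have eventually bounded
mass, so a uniform error on `[0, 1]` costs at most a fixed multiple of itself. -/
theorem tendsto_laplace_continuous (hL : AEMeasurable L P) (hL0 : ∀ᵐ ω ∂P, 0 ≤ L ω)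
    (h : Tendsto (fun θ : ℝ => θ * ∫ ω, Real.exp (-θ * L ω) ∂P) atTop (𝓝 c))
    {f : ℝ → ℝ} (hf : Continuous f) :
    Tendsto (fun θ : ℝ => θ * ∫ ω, Real.exp (-θ * L ω) * f (Real.exp (-θ * L ω)) ∂P) atTop
      (𝓝 (c * ∫ y in (0 : ℝ)..1, f y)) := by
  rw [Metric.tendsto_nhds]
  intro η hη
  -- `M` eventually exceeds the total mass. The choice of `δ` makes each of the three error terms at
  -- most `η / 3`.
  set M := |c| + 1 with hM
  have hM0 : 0 < M := by positivity
  set δ := η / (3 * M) with hδ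
  have hδ0 : 0 < δ := by positivity
  obtain ⟨p, hp⟩ := exists_polynomial_near_of_continuousOn 0 1 f hf.continuousOn δ hδ0
  have hpoly := tendsto_laplace_polynomial hL hL0 h p
  have h3 : |(c * ∫ y in (0 : ℝ)..1, p.eval y) - c * ∫ y in (0 : ℝ)..1, f y| ≤ M * δ := by
    rw [← mul_sub, ← intervalIntegral.integral_sub (p.continuous.intervalIntegrable _ _)
      (hf.intervalIntegrable _ _), abs_mul]
    have h4 : |∫ y in (0 : ℝ)..1, (p.eval y - f y)| ≤ δ := by
      have := intervalIntegral.norm_integral_le_of_norm_le_const (a := (0 : ℝ)) (b := 1)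
        (f := fun y => p.eval y - f y) (C := δ) fun y hy => by
          rw [Set.uIoc_of_le zero_le_one] at hy
          exact (hp y ⟨hy.1.le, hy.2⟩).le
      simpa using this
    exact mul_le_mul (by rw [hM]; linarith) h4 (abs_nonneg _) hM0.le
  have hup : ∀ᶠ θ in atTop, θ * ∫ ω, Real.exp (-θ * L ω) ∂P < M :=
    h.eventually (gt_mem_nhds (by have := le_abs_self c; rw [hM]; linarith))
  have hMδ : M * δ = η / 3 := by rw [hδ]; field_simp
  filter_upwards [hup, Metric.tendsto_nhds.mp hpoly (η / 3) (by positivity),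
    eventually_ge_atTop 0] with θ h1 h2 hθ
  rw [Real.dist_eq] at h2 ⊢
  have hi1 := integrable_exp_mul_comp_exp hL hL0 p.continuous hθ
  have hi2 := integrable_exp_mul_comp_exp hL hL0 hf hθ
  have hi3 : Integrable (fun ω => Real.exp (-θ * L ω)) P := by
    simpa using integrable_exp_mul_comp_exp hL hL0 (continuous_const (y := (1 : ℝ))) hθ
  have h5 : |θ * (∫ ω, Real.exp (-θ * L ω) * f (Real.exp (-θ * L ω)) ∂P) -
      θ * ∫ ω, Real.exp (-θ * L ω) * p.eval (Real.exp (-θ * L ω)) ∂P| ≤ M * δ := by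
    rw [← mul_sub, ← integral_sub hi2 hi1, abs_mul, abs_of_nonneg hθ]
    have h6 : |∫ ω, (Real.exp (-θ * L ω) * f (Real.exp (-θ * L ω)) -
        Real.exp (-θ * L ω) * p.eval (Real.exp (-θ * L ω))) ∂P| ≤
        ∫ ω, Real.exp (-θ * L ω) * δ ∂P := by
      rw [← Real.norm_eq_abs]
      refine norm_integral_le_of_norm_le (hi3.mul_const δ) ?_
      filter_upwards [hL0] with ω hω
      have hy := exp_neg_mul_mem_Icc hθ hω
      rw [← mul_sub, norm_mul, Real.norm_of_nonneg hy.1, Real.norm_eq_abs, abs_sub_comm]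
      exact mul_le_mul_of_nonneg_left (hp _ hy).le hy.1
    rw [integral_mul_const] at h6
    calc _ ≤ θ * ((∫ ω, Real.exp (-θ * L ω) ∂P) * δ) := mul_le_mul_of_nonneg_left h6 hθ
      _ = (θ * ∫ ω, Real.exp (-θ * L ω) ∂P) * δ := by ring
      _ ≤ M * δ := mul_le_mul_of_nonneg_right h1.le hδ0.le
  have h7 := abs_sub_le (θ * ∫ ω, Real.exp (-θ * L ω) * f (Real.exp (-θ * L ω)) ∂P)
    (θ * ∫ ω, Real.exp (-θ * L ω) * p.eval (Real.exp (-θ * L ω)) ∂P)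
    (c * ∫ y in (0 : ℝ)..1, f y)
  have h8 := abs_sub_le (θ * ∫ ω, Real.exp (-θ * L ω) * p.eval (Real.exp (-θ * L ω)) ∂P)
    (c * ∫ y in (0 : ℝ)..1, p.eval y) (c * ∫ y in (0 : ℝ)..1, f y)
  linarith

/-- A piecewise linear cutoff between `a` and `b`. -/
noncomputable def ramp (a b y : ℝ) : ℝ := max 0 (min 1 ((y - a) / (b - a)))

theorem continuous_ramp (a b : ℝ) : Continuous (ramp a b) := by
  unfold ramp; fun_prop

theorem ramp_nonneg (a b y : ℝ) : 0 ≤ ramp a b y := le_max_left _ _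

theorem ramp_le_one (a b y : ℝ) : ramp a b y ≤ 1 := max_le zero_le_one (min_le_left _ _)

theorem ramp_of_le {a b y : ℝ} (hab : a < b) (hy : y ≤ a) : ramp a b y = 0 := by
  have h : (y - a) / (b - a) ≤ 0 := div_nonpos_of_nonpos_of_nonneg (by linarith) (by linarith)
  exact max_eq_left ((min_le_right _ _).trans h)

theorem ramp_of_ge {a b y : ℝ} (hab : a < b) (hy : b ≤ y) : ramp a b y = 1 := by
  have h : 1 ≤ (y - a) / (b - a) := (one_le_div (by linarith)).mpr (by linarith)
  rw [ramp, min_eq_left h, max_eq_right zero_le_one]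

/-- The integral is squeezed between `∫ dy/y` over `[b, 1]` and over `[a, 1]`. The denominator `max
y a` equals `y` wherever the ramp is nonzero and keeps the quotient continuous at zero. -/
theorem integral_ramp_div_mem {a b : ℝ} (ha : 0 < a) (hab : a < b) (hb : b ≤ 1) :
    ∫ y in (0 : ℝ)..1, ramp a b y / max y a ∈ Set.Icc (-Real.log b) (-Real.log a) := by
  have hcont : Continuous fun y => ramp a b y / max y a :=
    (continuous_ramp a b).div (by fun_prop) fun y => (lt_max_of_lt_right ha).ne'
  have hi := fun u v : ℝ => hcont.intervalIntegrable (μ := volume) u v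
  have hinv : ∀ u, 0 < u → u ≤ 1 → ∫ y in u..1, y⁻¹ = -Real.log u := fun u hu _ => by
    rw [integral_inv_of_pos hu one_pos, one_div, Real.log_inv]
  have hii : ∀ u, 0 < u → u ≤ 1 → IntervalIntegrable (fun y : ℝ => y⁻¹) volume u 1 :=
    fun u hu hu1 => intervalIntegral.intervalIntegrable_inv (fun x hx => by
      rw [Set.uIcc_of_le hu1] at hx
      exact (hu.trans_le hx.1).ne') continuousOn_id
  have hnn : ∀ y, 0 ≤ ramp a b y / max y a := fun y =>
    div_nonneg (ramp_nonneg _ _ _) (ha.le.trans (le_max_right _ _))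
  constructor
  · rw [← intervalIntegral.integral_add_adjacent_intervals (hi 0 b) (hi b 1),
      ← hinv b (ha.trans hab) hb]
    have h1 : 0 ≤ ∫ y in (0 : ℝ)..b, ramp a b y / max y a :=
      intervalIntegral.integral_nonneg (ha.trans hab).le fun y _ => hnn y
    have h2 : ∫ y in b..1, y⁻¹ ≤ ∫ y in b..1, ramp a b y / max y a :=
      intervalIntegral.integral_mono_on hb (hii b (ha.trans hab) hb) (hi b 1) fun y hy => by
        rw [ramp_of_ge hab hy.1, max_eq_left (hab.le.trans hy.1), one_div]
    linarith
  · rw [← intervalIntegral.integral_add_adjacent_intervals (hi 0 a) (hi a 1),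
      ← hinv a ha (hab.le.trans hb)]
    have h1 : ∫ y in (0 : ℝ)..a, ramp a b y / max y a = 0 := by
      rw [intervalIntegral.integral_congr (g := fun _ => 0) fun y hy => ?_]
      · simp
      · rw [Set.uIcc_of_le ha.le] at hy
        simp only [ramp_of_le hab hy.2, zero_div]
    have h2 : ∫ y in a..1, ramp a b y / max y a ≤ ∫ y in a..1, y⁻¹ :=
      intervalIntegral.integral_mono_on (hab.le.trans hb) (hi a 1) (hii a ha (hab.le.trans hb))
        fun y hy => by
          rw [max_eq_left hy.1, ← one_div]
          exact div_le_div_of_nonneg_right (ramp_le_one _ _ _) (ha.le.trans hy.1)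
    linarith

/-- A Tauberian theorem: the behaviour of the Laplace transform at infinity determines the small
ball probabilities. -/
theorem tendsto_smallBall_of_laplace (hL : AEMeasurable L P) (hL0 : ∀ᵐ ω ∂P, 0 ≤ L ω)
    (h : Tendsto (fun θ : ℝ => θ * ∫ ω, Real.exp (-θ * L ω) ∂P) atTop (𝓝 c)) :
    Tendsto (fun ε : ℝ => ε⁻¹ * P.real {ω | L ω ≤ ε}) (𝓝[>] 0) (𝓝 c) := by
  have hc : 0 ≤ c := ge_of_tendsto h (by
    filter_upwards [eventually_ge_atTop 0] with θ hθ
    exact mul_nonneg hθ (integral_nonneg fun ω => (Real.exp_pos _).le))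
  have hnull : ∀ x, NullMeasurableSet {ω | L ω ≤ x} P := fun x =>
    nullMeasurableSet_le hL aemeasurable_const
  have hind : ∀ x, ∫ ω, {ω | L ω ≤ x}.indicator (fun _ => (1 : ℝ)) ω ∂P =
      P.real {ω | L ω ≤ x} := fun x => by
    rw [integral_indicator₀ (hnull x)]; simp
  have hindint : ∀ x, Integrable ({ω | L ω ≤ x}.indicator fun _ => (1 : ℝ)) P := fun x =>
    (integrable_const (1 : ℝ)).indicator₀ (hnull x)
  have key : ∀ lam : ℝ, 0 < lam → ∃ J : ℝ → ℝ, ∃ m ∈ Set.Icc (1 : ℝ) (1 + lam),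
      Tendsto J atTop (𝓝 (c * m)) ∧ ∀ θ, 0 < θ → θ * P.real {ω | L ω ≤ 1 / θ} ≤ J θ ∧
        J θ ≤ θ * P.real {ω | L ω ≤ (1 + lam) / θ} := by
    intro lam hlam
    -- With `y = exp(-θL)`, the condition `L ≤ 1/θ` means `y ≥ b`, and `L > (1 + lam)/θ` means `y <
    -- a`. The ramp thus lies between the indicators of `L ≤ 1/θ` and `L ≤ (1 + lam)/θ`, and its
    -- limiting mass factor `m` lies in `[1, 1 + lam]`.
    set a := Real.exp (-(1 + lam)) with ha
    set b := Real.exp (-1) with hb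
    have ha0 : 0 < a := Real.exp_pos _
    have hab : a < b := Real.exp_lt_exp.mpr (by linarith)
    have hb1 : b ≤ 1 := Real.exp_le_one_iff.mpr (by norm_num)
    have hcont : Continuous fun y => ramp a b y / max y a :=
      (continuous_ramp a b).div (by fun_prop) fun y => (lt_max_of_lt_right ha0).ne'
    have hm := integral_ramp_div_mem ha0 hab hb1
    rw [ha, hb, Real.log_exp, Real.log_exp, neg_neg, neg_neg] at hm
    have heq : ∀ θ ω, Real.exp (-θ * L ω) * (ramp a b (Real.exp (-θ * L ω)) /
        max (Real.exp (-θ * L ω)) a) = ramp a b (Real.exp (-θ * L ω)) := fun θ ω => by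
      rcases le_total (Real.exp (-θ * L ω)) a with h1 | h1
      · rw [ramp_of_le hab h1]; simp
      · rw [max_eq_left h1]
        field_simp
    refine ⟨fun θ => θ * ∫ ω, ramp a b (Real.exp (-θ * L ω)) ∂P, _, hm, ?_, fun θ hθ => ?_⟩
    · have := tendsto_laplace_continuous hL hL0 h hcont
      simp_rw [heq] at this
      exact this
    · have hint : Integrable (fun ω => ramp a b (Real.exp (-θ * L ω))) P := by
        have := integrable_exp_mul_comp_exp hL hL0 hcont hθ.le
        simp_rw [heq] at this
        exact this
      constructor
      · rw [← hind]
        refine mul_le_mul_of_nonneg_left (integral_mono (hindint _) hint fun ω => ?_) hθ.le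
        by_cases hω : L ω ≤ 1 / θ
        · rw [le_div_iff₀ hθ] at hω
          rw [ramp_of_ge hab (Real.exp_le_exp.mpr (by linarith))]
          exact Set.indicator_le_self' (fun _ _ => zero_le_one) ω
        · rw [Set.indicator_of_notMem (by exact hω)]
          exact ramp_nonneg _ _ _
      · rw [← hind]
        refine mul_le_mul_of_nonneg_left (integral_mono hint (hindint _) fun ω => ?_) hθ.le
        by_cases hω : L ω ≤ (1 + lam) / θ
        · rw [Set.indicator_of_mem (by exact hω)]
          exact ramp_le_one _ _ _
        · rw [Set.indicator_of_notMem (by exact hω)]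
          rw [not_le, div_lt_iff₀ hθ] at hω
          exact (ramp_of_le hab (Real.exp_le_exp.mpr (by linarith))).le
  refine tendsto_order.mpr ⟨fun x hx => ?_, fun x hx => ?_⟩
  · have h1 : Tendsto (fun lam : ℝ => c / (1 + lam)) (𝓝[>] 0) (𝓝 c) := by
      have : ContinuousAt (fun lam : ℝ => c / (1 + lam)) 0 :=
        continuousAt_const.div (by fun_prop) (by norm_num)
      simpa using this.tendsto.mono_left nhdsWithin_le_nhds
    obtain ⟨lam, hlamx, hlam⟩ :=
      ((h1.eventually (lt_mem_nhds hx)).and self_mem_nhdsWithin).exists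
    have hlam0 : 0 < lam := hlam
    obtain ⟨J, m, hm, hJ, hJb⟩ := key lam hlam0
    -- The choice `θ = (1 + lam) / ε` turns the upper threshold `(1 + lam) / θ` into `ε`; for the
    -- opposite bound `θ = 1 / ε` is used.
    have h2 : Tendsto (fun ε : ℝ => J ((1 + lam) * ε⁻¹)) (𝓝[>] 0) (𝓝 (c * m)) :=
      hJ.comp (tendsto_inv_nhdsGT_zero.const_mul_atTop (by linarith))
    have h3 : x * (1 + lam) < c * m := by
      rw [lt_div_iff₀ (by linarith)] at hlamx
      nlinarith [hm.1]
    filter_upwards [h2.eventually (lt_mem_nhds h3), self_mem_nhdsWithin] with ε h4 hε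
    have hε0 : 0 < ε := hε
    have h5 := (hJb ((1 + lam) * ε⁻¹) (by positivity)).2
    have h6 : (1 + lam) / ((1 + lam) * ε⁻¹) = ε := by field_simp
    rw [h6] at h5
    have h7 : (1 + lam) * x < (1 + lam) * (ε⁻¹ * P.real {ω | L ω ≤ ε}) := by
      calc _ = x * (1 + lam) := mul_comm _ _
        _ < _ := h4.trans_le h5
        _ = _ := by ring
    exact lt_of_mul_lt_mul_left h7 (by linarith)
  · have h1 : Tendsto (fun lam : ℝ => c * (1 + lam)) (𝓝[>] 0) (𝓝 c) := by
      have : Continuous fun lam : ℝ => c * (1 + lam) := by fun_prop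
      simpa using (this.tendsto 0).mono_left nhdsWithin_le_nhds
    obtain ⟨lam, hlamx, hlam⟩ :=
      ((h1.eventually (gt_mem_nhds hx)).and self_mem_nhdsWithin).exists
    obtain ⟨J, m, hm, hJ, hJb⟩ := key lam hlam
    have h2 : Tendsto (fun ε : ℝ => J ε⁻¹) (𝓝[>] 0) (𝓝 (c * m)) :=
      hJ.comp tendsto_inv_nhdsGT_zero
    have h3 : c * m < x := (mul_le_mul_of_nonneg_left hm.2 hc).trans_lt hlamx
    filter_upwards [h2.eventually (gt_mem_nhds h3), self_mem_nhdsWithin] with ε h4 hε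
    have hε0 : 0 < ε := hε
    have h5 := (hJb ε⁻¹ (by positivity)).1
    rw [one_div, inv_inv] at h5
    exact h5.trans_lt h4

end Tauberian

/-! ### Uniqueness of the local time and the main theorem. -/

/-- On a probability space both convergences imply convergence in `L¹`, where the limits can be
compared although the exponents differ. -/
theorem ae_eq_of_tendsto_eLpNorm {Ω ι : Type*} {mΩ : MeasurableSpace Ω} {P : Measure Ω}
    [IsProbabilityMeasure P] {l : Filter ι} [l.NeBot] {p q : ℝ≥0∞} (hp : 1 ≤ p) (hq : 1 ≤ q)
    {f : ι → Ω → ℝ} {L M : Ω → ℝ} (hf : ∀ i, AEStronglyMeasurable (f i) P)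
    (hL : AEStronglyMeasurable L P) (hM : AEStronglyMeasurable M P)
    (hfL : Tendsto (fun i => eLpNorm (f i - L) p P) l (𝓝 0))
    (hfM : Tendsto (fun i => eLpNorm (f i - M) q P) l (𝓝 0)) : L =ᵐ[P] M := by
  have h1 : eLpNorm (L - M) 1 P = 0 := by
    have h2 := hfL.add hfM
    rw [add_zero] at h2
    refine le_antisymm (ge_of_tendsto' h2 fun i => ?_) zero_le
    calc eLpNorm (L - M) 1 P = eLpNorm ((f i - M) - (f i - L)) 1 P := by
          congr 1; ext ω; simp
      _ ≤ eLpNorm (f i - M) 1 P + eLpNorm (f i - L) 1 P :=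
          eLpNorm_sub_le ((hf i).sub hM) ((hf i).sub hL) le_rfl
      _ ≤ eLpNorm (f i - M) q P + eLpNorm (f i - L) p P :=
          add_le_add (eLpNorm_le_eLpNorm_of_exponent_le hq ((hf i).sub hM))
            (eLpNorm_le_eLpNorm_of_exponent_le hp ((hf i).sub hL))
      _ = _ := add_comm _ _
  rw [eLpNorm_eq_zero_iff (hL.sub hM) one_ne_zero] at h1
  filter_upwards [h1] with ω hω
  exact sub_eq_zero.mp hω

theorem approxCollisionLocalTime_eq {Ω : Type*} (X Y : ℝ≥0 → Ω → ℝ) {T : ℝ} (hT : 0 ≤ T) (ε : ℝ) :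
    approxCollisionLocalTime X Y T ε = mollifiedLocalTime (fun t ω => X t ω - Y t ω) ε 0 T := by
  ext ω
  rw [approxCollisionLocalTime, mollifiedLocalTime, pathIntegral_eq _ hT]
  simp only [zero_add]

theorem theorem1p1 {Ω : Type*} {mΩ : MeasurableSpace Ω} (P : Measure Ω) [IsProbabilityMeasure P]
    (F : Filtration ℝ≥0 mΩ) (α₁ α₂ : ℝ) (hα₁ : α₁ ∈ Set.Ioc (0 : ℝ) 2)
    (hα₂ : α₂ ∈ Set.Ioc (0 : ℝ) 2) (hmax : 1 < max α₁ α₂) (T : ℝ) (hT : 0 < T)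
    (X Y : ℝ≥0 → Ω → ℝ) (hX : IsSymmetricStable P F α₁ X) (hY : IsSymmetricStable P F α₂ Y)
    (hXY : IndepFun (fun ω t => X t ω) (fun ω t => Y t ω) P) :
    -- the collision local time exists in `L²`
    (∃ L : Ω → ℝ, IsCollisionLocalTime P X Y T 2 L) ∧
    -- all integrals in the limiting constant converge absolutely
    (∀ z ∈ Complex.slitPlane, Integrable (PhiIntegrand T α₁ α₂ z)) ∧
    IntegrableOn (rayIntegrand T α₁ α₂) (Set.Ioi 0) ∧
    (min α₁ α₂ < 1 → Integrable (fun v : ℝ => 1 / (|v| ^ α₁ + |v| ^ α₂))) ∧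
    -- the small ball asymptotics
    ∀ p : ℝ≥0∞, 1 ≤ p → ∀ L : Ω → ℝ, IsCollisionLocalTime P X Y T p L →
      Tendsto (fun ε : ℝ => ε⁻¹ * P.real {ω | L ω ≤ ε}) (𝓝[>] 0)
        (𝓝 (smallBallConstant T α₁ α₂)) := by
  have hψ := isSymbol_stableSymbol hα₁ hα₂ hmax
  have hZ := isLevyProcess_sub hX hY hXY
  obtain ⟨M, hM, hlaplace⟩ := hZ.exists_laplace hψ
  obtain ⟨hMT, hM0, hMlim⟩ := hM T hT.le
  refine ⟨⟨M T, fun ε _ => ?_, hMT, ?_⟩, fun z hz => integrable_PhiIntegrand hα₁ hα₂ hmax hT hz,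
    (integrableOn_rayIntegrand hα₁ hα₂ hmax hT).1,
    fun hmin => integrable_inv_stableSymbol hα₁ hα₂ hmax hmin, fun p hp L hL => ?_⟩
  · rw [approxCollisionLocalTime_eq X Y hT.le]
    exact hZ.memLp_mollifiedLocalTime ε 0 hT.le 2
  · simp only [approxCollisionLocalTime_eq X Y hT.le]
    exact hMlim
  · have hLlim := hL.2.2
    simp only [approxCollisionLocalTime_eq X Y hT.le] at hLlim
    -- Any `L^p` limit agrees almost surely with the `L²` limit constructed above, so only the
    -- latter's small ball probabilities have to be found.
    have hae : L =ᵐ[P] M T := ae_eq_of_tendsto_eLpNorm (p := p) (q := 2) hp (by norm_num)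
      (fun ε => (hZ.measurable_mollifiedLocalTime_apply ε 0 T).aestronglyMeasurable)
      hL.2.1.1 hMT.1 hLlim hMlim
    have htail := hψ.tendsto_mul_of_renewal (h := fun θ t => ∫ ω, Real.exp (-θ * M t ω) ∂P)
      (fun θ hθ => (hlaplace θ hθ).1) (fun θ hθ => (hlaplace θ hθ).2.1)
      (fun θ hθ => (hlaplace θ hθ).2.2) hT
    rw [levyTail_stableSymbol hα₁ hα₂ hmax hT] at htail
    refine (tendsto_smallBall_of_laplace hMT.1.aemeasurable hM0 htail).congr fun ε => ?_
    congr 1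
    refine measureReal_congr ?_
    filter_upwards [hae] with ω hω
    exact propext (by change M T ω ≤ ε ↔ L ω ≤ ε; rw [hω])
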